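/- Let $\theta_1(p,\tau)=2\sum_{n\ge 0}(-1)^n e^{\pi i\tau(n+1/2)^2}\sin((2n+1)p)$ for $p\in\mathbb C$, $\operatorname{Im}\tau>0$, and let $E_2(\tau)=1+\frac{3}{\pi^2}\sum_{m\ne0}\sum_{n\in\mathbb Z}\frac1{(m\tau+n)^2}$ be the normalised Eisenstein series of weight $2$. Let $\kappa\in\mathbb C\setminus\{0\}$ (a choice of scale for the coordinate $p$), let $U=\{(t^1,t^2,t^3)\in\mathbb C^3:\operatorname{Im}t^3>0\}$, $V=\{(t^1,t^2,t^3,p)\in U\times\mathbb C:\theta_1(\kappa p,t^3)\neq0\}$ and $$F=\frac{(t^1)^2t^3}{2}+\frac{t^1(t^2)^2}{2}-\frac{i\pi}{48}(t^2)^4E_2(t^3),\qquad \Omega=t^1p+\frac{\pi i}{4\kappa^2}(t^2)^2\,\frac{\partial\log\theta_1(\kappa p,t^3)}{\partial p}.$$ (For $\kappa=1$ the coefficient in $\Omega$ is $\pi i/4$; for $\kappa=\pi$, i.e. period lattice $\mathbb Z+t^3\mathbb Z$, it is $i/(4\pi)$; for $\kappa^2=\pi i/4$ it is $1$.) 1.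 *Closed WDVV.* $F$ is a solution of the WDVV equations on $U$: it is holomorphic; with $F_{\alpha\beta\gamma}=\partial_\alpha\partial_\beta\partial_\gamma F$ the matrix $\eta_{\alpha\beta}=F_{1\alpha\beta}$ is constant and nondegenerate; $F_{\alpha\beta\mu}\eta^{\mu\lambda}F_{\lambda\gamma\delta}=F_{\gamma\beta\mu}\eta^{\mu\lambda}F_{\lambda\alpha\delta}$ for all indices; and for $E=t^1\partial_1+\frac12t^2\partial_2$ the function $F$ is quasi-homogeneous of charge $d=1$, i.e. $EF=(3-d)F$ up to a polynomial of degree at most $2$ in $t$. 2. *Open WDVV.* $(F,\Omega)$ is a solution of the open WDVV equations on $V$: with $t^4=p$, $\Omega$ is holomorphic on $V$ and, for all $\alpha,\beta,\gamma\in\{1,2,3,4\}$ (where $F$ does not depend on $t^4$ and $\mu,\lambda$ run over $1,2,3$), $$F_{\alpha\beta\mu}\eta^{\mu\lambda}\Omega_{\lambda\gamma}+\Omega_{\alpha\beta}\Omega_{4\gamma}=F_{\gamma\beta\mu}\eta^{\mu\lambda}\Omega_{\lambda\alpha}+\Omega_{\gamma\beta}\Omega_{4\alpha};$$ moreover $\Omega_{1\beta}=0$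 for $\beta\le 3$, $\Omega_{14}=1$, and $\Omega$ is quasi-homogeneous: $E\Omega+\frac{1-d}2p\,\partial_p\Omega=\frac{3-d}2\Omega$ with $d=1$, up to a polynomial of degree at most $1$ in $(t,p)$. 3. *Relation to the Hurwitz space $H_{1,1}$.* On $V$ one has $\partial_p\Omega=\lambda:=t^1+\frac{\pi i}{4\kappa^2}(t^2)^2\,\partial_p^2\log\theta_1(\kappa p,t^3)$. For every $t\in U$ with $t^2\ne0$, $\lambda(\cdot,t)$ is a meromorphic function on the torus $\mathbb C/(\frac{\pi}{\kappa}\mathbb Z+\frac{\pi t^3}{\kappa}\mathbb Z)$ whose only pole is a double pole at $0$ (a point of $H_{1,1}$). It has exactly three finite critical points on the torus; they are simple, with distinct critical values, and $E\lambda=\lambda$ at each of them. For all $\alpha,\beta,\gamma\in\{1,2,3\}$, with $N=2i\kappa^2/\pi$ and sums over these three critical points, $$\eta_{\alpha\beta}=N\sum\operatorname{Res}_{d\lambda=0}\frac{\partial_\alpha\lambda\,\partial_\beta\lambda}{\partial_p\lambda}\,dp,\qquad \partial_\alpha\partial_\beta\partial_\gamma F=N\sum\operatorname{Res}_{d\lambda=0}\frac{\partial_\alpha\lambda\,\partial_\beta\lambda\,\partial_\gamma\lambda}{\partial_p\lambda}\,dp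 .$$ So $F$ is the potential of the Frobenius structure on $H_{1,1}$ given by $\lambda$ and the holomorphic differential $\sqrt N\,dp$, and $\Omega$ is its open extension. -/

import Mathlib

open scoped BigOperators Topology

noncomputable section

namespace OpenWDVV

/-! ### Closed and open WDVV equations -/

/-- The partial derivative `∂f/∂t^α` of a function of `n` complex variables. -/
def pd {n : ℕ} (α : Fin n) (f : (Fin n → ℂ) → ℂ) (t : Fin n → ℂ) : ℂ :=
  fderiv ℂ f t (Pi.single α 1)

/-- `c_{αβγ} = ∂_α ∂_β ∂_γ F`. -/
def cLow {n : ℕ} (F : (Fin n → ℂ) → ℂ) (t : Fin n → ℂ) (α β γ : Fin n) : ℂ :=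
  pd α (pd β (pd γ F)) t

/-- `η_{αβ} = c_{1αβ}`; the first coordinate `t^1` has the index `0`. -/
def eta {n : ℕ} [NeZero n] (F : (Fin n → ℂ) → ℂ) (t : Fin n → ℂ) :
    Matrix (Fin n) (Fin n) ℂ :=
  Matrix.of fun α β => cLow F t 0 α β

/-- The derivative of `F` along the Euler field `E = ∑_α ((1 - q_α) t^α + r_α) ∂_α`. -/
def eulerDeriv {n : ℕ} (q r : Fin n → ℂ) (F : (Fin n → ℂ) → ℂ) (t : Fin n → ℂ) : ℂ :=
  ∑ α, ((1 - q α) * t α + r α) * pd α F t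

/-- `F` is a solution of the (closed) WDVV equations on the open set `U ⊆ ℂⁿ`, with charge `d`
and Euler field `E = ∑_α ((1 - q_α) t^α + r_α) ∂_α`. -/
structure IsWDVVSolution {n : ℕ} [NeZero n] (U : Set (Fin n → ℂ)) (F : (Fin n → ℂ) → ℂ)
    (q r : Fin n → ℂ) (d : ℂ) : Prop where
  isOpen : IsOpen U
  analytic : AnalyticOnNhd ℂ F U
  /-- `η` is a constant nondegenerate matrix. -/
  metric : ∃ η₀ : Matrix (Fin n) (Fin n) ℂ, IsUnit η₀.det ∧ ∀ t ∈ U, eta F t = η₀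
  /-- `c_{αβμ} η^{μλ} c_{λγδ} = c_{γβμ} η^{μλ} c_{λαδ}`. -/
  assoc : ∀ t ∈ U, ∀ α β γ δ : Fin n,
    ∑ μ, ∑ l, cLow F t α β μ * (eta F t)⁻¹ μ l * cLow F t l γ δ =
      ∑ μ, ∑ l, cLow F t γ β μ * (eta F t)⁻¹ μ l * cLow F t l α δ
  /-- `E F = (3 - d) F` up to a polynomial of degree at most two. -/
  quasihomogeneous : ∃ (A : Fin n → Fin n → ℂ) (B : Fin n → ℂ) (C : ℂ), ∀ t ∈ U,
    eulerDeriv q r F t =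
      (3 - d) * F t + ((∑ α, ∑ β, A α β * t α * t β) + (∑ α, B α * t α) + C)

/-- A function of `(t^1, …, t^n)` as a function of `(t^1, …, t^n, t^{n+1})`. -/
def lift {n : ℕ} (F : (Fin n → ℂ) → ℂ) (x : Fin (n + 1) → ℂ) : ℂ :=
  F fun α => x α.castSucc

/-- One side of the open WDVV equations:
`F_{αβμ} η^{μλ} Ω_{λγ} + Ω_{αβ} Ω_{n+1,γ}`, for indices `α β γ` in `1, …, n+1`
(and `F` does not depend on the last coordinate). -/
def openTerm {n : ℕ} [NeZero n] (F : (Fin n → ℂ) → ℂ) (Ω : (Fin (n + 1) → ℂ) → ℂ)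
    (x : Fin (n + 1) → ℂ) (α β γ : Fin (n + 1)) : ℂ :=
  (∑ μ : Fin n, ∑ l : Fin n,
      cLow (lift F) x α β μ.castSucc * (eta F fun i => x i.castSucc)⁻¹ μ l *
        pd l.castSucc (pd γ Ω) x) +
    pd α (pd β Ω) x * pd (Fin.last n) (pd γ Ω) x

/-- `(F, Ω)` is a solution of the open WDVV equations, where `F` is a solution of the WDVV
equations on `U ⊆ ℂⁿ` and `Ω` is defined on `V ⊆ ℂⁿ⁺¹`; the last coordinate is the open variable
`p = t^{n+1}`. -/
structure IsOpenWDVVSolution {n : ℕ} [NeZero n] (U : Set (Fin n → ℂ)) (F : (Fin n → ℂ) → ℂ)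
    (V : Set (Fin (n + 1) → ℂ)) (Ω : (Fin (n + 1) → ℂ) → ℂ) (q r : Fin n → ℂ) (d : ℂ) :
    Prop where
  closed : IsWDVVSolution U F q r d
  isOpen : IsOpen V
  mapsTo : ∀ x ∈ V, (fun α : Fin n => x α.castSucc) ∈ U
  analytic : AnalyticOnNhd ℂ Ω V
  /-- The open WDVV equations. For `α, β, γ ≤ n` this is the first family; `γ = n+1` gives
  `c_{αβ}^δ Ω_{δp} + Ω_{αβ} Ω_{pp} = Ω_{αp} Ω_{βp}`. -/
  assoc : ∀ x ∈ V, ∀ α β γ : Fin (n + 1), openTerm F Ω x α β γ = openTerm F Ω x γ β α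
  /-- `∂_1` is a unit: `Ω_{1β} = 0` for `β ≤ n`, and `Ω_{1p} = 1`. -/
  unit : ∀ x ∈ V, ∀ β : Fin (n + 1),
    pd (0 : Fin n).castSucc (pd β Ω) x = if β = Fin.last n then 1 else 0
  /-- `E Ω + (1 - d)/2 · p ∂_p Ω = (3 - d)/2 · Ω` up to a polynomial of degree at most one. -/
  quasihomogeneous : ∃ (B : Fin (n + 1) → ℂ) (C : ℂ), ∀ x ∈ V,
    (∑ α : Fin n, ((1 - q α) * x α.castSucc + r α) * pd α.castSucc Ω x) +
        (1 - d) / 2 * x (Fin.last n) * pd (Fin.last n) Ω x =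
      (3 - d) / 2 * Ω x + ((∑ α, B α * x α) + C)

/-! ### The Hurwitz space `H_{1,1}` and its Frobenius structure -/

/-- `f` is (the lift to `ℂ` of) a meromorphic function on the torus `ℂ / L` whose only pole is a
double pole at the origin: together with the torus, a point of `H_{1,1}`. The values of `f` on the
lattice itself are irrelevant. -/
structure IsH11Covering (L : PeriodPair) (f : ℂ → ℂ) : Prop where
  periodic : ∀ p ∉ L.lattice, ∀ ω ∈ L.lattice, f (p + ω) = f p
  analytic : ∀ p ∉ L.lattice, AnalyticAt ℂ f p
  pole : MeromorphicAt f 0 ∧ meromorphicOrderAt f 0 = ((-2 : ℤ) : WithTop ℤ)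

/-- `S` contains exactly one representative modulo `L` of each (finite) critical point of `f`. -/
structure IsCriticalSystem (L : PeriodPair) (f : ℂ → ℂ) (S : Finset ℂ) : Prop where
  critical : ∀ s ∈ S, s ∉ L.lattice ∧ deriv f s = 0
  complete : ∀ p ∉ L.lattice, deriv f p = 0 → ∃! s, s ∈ S ∧ p - s ∈ L.lattice

/-- The residue at an isolated singularity, as a contour integral over small circles. -/
def residue (f : ℂ → ℂ) (c : ℂ) : ℂ :=
  Filter.limUnder (𝓝[>] (0 : ℝ)) fun ρ =>
    (2 * (Real.pi : ℂ) * Complex.I)⁻¹ * ∮ z in C(c, ρ), f z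

/-- The point `(t^1, …, t^n, p)`. -/
def pt {n : ℕ} (t : Fin n → ℂ) (p : ℂ) : Fin (n + 1) → ℂ := Fin.snoc (α := fun _ => ℂ) t p

/-- `t ↦ (ℂ / L t, lam(·, t))` is a family of points of `H_{1,1}` over the domain `U ⊆ ℂ³`, and
`F` is the potential of the Frobenius structure that the superpotential `lam` and the differential
`√N dp` define on it: the critical values `u_1, u_2, u_3` of `lam` are
distinct (they are the canonical coordinates), the Euler field `∑ ((1 - q_α) t^α + r_α) ∂_α` is
`∑ u_i ∂/∂u_i`, and the metric and structure constants are
`η_{αβ} = ∑_{d lam = 0} Res (∂_α lam ∂_β lam / ∂_p lam) N dp`,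
`c_{αβγ} = ∑_{d lam = 0} Res (∂_α lam ∂_β lam ∂_γ lam / ∂_p lam) N dp`. -/
structure IsH11Potential (U : Set (Fin 3 → ℂ)) (F : (Fin 3 → ℂ) → ℂ)
    (L : (Fin 3 → ℂ) → PeriodPair) (lam : (Fin 4 → ℂ) → ℂ) (N : ℂ) (q r : Fin 3 → ℂ) :
    Prop where
  covering : ∀ t ∈ U, IsH11Covering (L t) fun p => lam (pt t p)
  exists_criticalSystem : ∀ t ∈ U, ∃ S : Finset ℂ,
    IsCriticalSystem (L t) (fun p => lam (pt t p)) S ∧ S.card = 3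
  /-- The critical points are simple. -/
  simple : ∀ t ∈ U, ∀ p ∉ (L t).lattice, pd 3 lam (pt t p) = 0 →
    pd 3 (pd 3 lam) (pt t p) ≠ 0
  distinct : ∀ t ∈ U, ∀ S : Finset ℂ,
    IsCriticalSystem (L t) (fun p => lam (pt t p)) S →
      Set.InjOn (fun p => lam (pt t p)) (S : Set ℂ)
  euler : ∀ t ∈ U, ∀ p ∉ (L t).lattice, pd 3 lam (pt t p) = 0 →
    ∑ α : Fin 3, ((1 - q α) * t α + r α) * pd α.castSucc lam (pt t p) = lam (pt t p)
  metric : ∀ t ∈ U, ∀ S : Finset ℂ,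
    IsCriticalSystem (L t) (fun p => lam (pt t p)) S → ∀ α β : Fin 3,
      eta F t α β = N * ∑ s ∈ S, residue (fun p =>
        pd α.castSucc lam (pt t p) * pd β.castSucc lam (pt t p) / pd 3 lam (pt t p)) s
  structureConstants : ∀ t ∈ U, ∀ S : Finset ℂ,
    IsCriticalSystem (L t) (fun p => lam (pt t p)) S → ∀ α β γ : Fin 3,
      cLow F t α β γ = N * ∑ s ∈ S, residue (fun p =>
        pd α.castSucc lam (pt t p) * pd β.castSucc lam (pt t p) * pd γ.castSucc lam (pt t p) /
          pd 3 lam (pt t p)) s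

/-! ### The explicit functions -/

/-- The Jacobi theta function
`θ₁(p, τ) = 2 ∑_{n ≥ 0} (-1)^n exp(π i τ (n + 1/2)²) sin((2n + 1) p)`. -/
def theta1 (p τ : ℂ) : ℂ :=
  2 * ∑' n : ℕ, (-1 : ℂ) ^ n *
    Complex.exp ((Real.pi : ℂ) * Complex.I * τ * ((n : ℂ) + 1 / 2) ^ 2) *
    Complex.sin ((2 * (n : ℂ) + 1) * p)

/-- `∂_p log θ₁(κ p, τ)`, where `κ` fixes the scale of `p`. -/
def dlogTheta1 (κ p τ : ℂ) : ℂ := logDeriv (fun z => theta1 (κ * z) τ) p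

/-- The coefficient `π i / (4 κ²)`. -/
def coeff (κ : ℂ) : ℂ := (Real.pi : ℂ) * Complex.I / (4 * κ ^ 2)

/-- `F = (t^1)² t^3 / 2 + t^1 (t^2)² / 2 - (i π / 48) (t^2)⁴ E₂(t^3)`. -/
def F11 (t : Fin 3 → ℂ) : ℂ :=
  t 0 ^ 2 * t 2 / 2 + t 0 * t 1 ^ 2 / 2 -
    Complex.I * (Real.pi : ℂ) / 48 * t 1 ^ 4 *
      EisensteinSeries.E2 (UpperHalfPlane.ofComplex (t 2))

/-- `Ω = t^1 p + (π i / (4 κ²)) (t^2)² ∂_p log θ₁(κ p, t^3)`, in the coordinates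
`(t^1, t^2, t^3, p)`. -/
def Omega11 (κ : ℂ) (x : Fin 4 → ℂ) : ℂ :=
  x 0 * x 3 + coeff κ * x 1 ^ 2 * dlogTheta1 κ (x 3) (x 2)

/-- The superpotential `λ = t^1 + (π i / (4 κ²)) (t^2)² ∂_p² log θ₁(κ p, t^3)`. -/
def lambda11 (κ : ℂ) (x : Fin 4 → ℂ) : ℂ :=
  x 0 + coeff κ * x 1 ^ 2 * deriv (fun p => dlogTheta1 κ p (x 2)) (x 3)

/-- The domain of `F`. -/
def U11 : Set (Fin 3 → ℂ) := {t | 0 < (t 2).im}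

/-- The part of the domain over which `λ` is nonconstant in `p`. -/
def U11' : Set (Fin 3 → ℂ) := {t | 0 < (t 2).im ∧ t 1 ≠ 0}

/-- The domain of `Ω`. -/
def V11 (κ : ℂ) : Set (Fin 4 → ℂ) := {x | 0 < (x 2).im ∧ theta1 (κ * x 3) (x 2) ≠ 0}

end OpenWDVV

end

/-! All computations take place in one differential ring. Let θ = θ₁(z, τ), g = ∂_z log θ, k = πi/4,
and let ℘ be the Weierstrass function of πℤ + πτℤ with invariants g₂, g₃. Three facts make the ring
generated by g, ℘, ℘', E₂, g₂, g₃ closed under ∂_z and ∂_τ.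

(a) ∂_z g = -℘ - E₂/3 (`deriv_gTheta`). The function ∂_z g + ℘ is elliptic with removable
singularities, hence constant by Liouville (`eq_const_of_periodic`); the product formula for θ and
the Lambert series of E₂ give its value at z = 0. (b) The heat equation θ_τ = -k θ_zz becomes g_τ =
-k (g_zz + 2 g g_z) (`dt_theta`, `dt_gFun`). (c) Ramanujan's equations. Since g₂ = 12℘² - 2℘'' is
independent of z, its τ-derivative, computed from (a) and (b), is a polynomial of degree one in ℘
with coefficients independent of z. Comparing two half periods yields E₂' and g₂'
(`ramanujan_e2_g2`), and the cubic equation then yields g₃'.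

The closed WDVV equations reduce to the Chazy equation for a multiple of E₂, which (c) makes an
identity of polynomials (`chazy`). The Hessian of Ω has entries in the ring above; once g₃ is
eliminated through the cubic, the open WDVV equations are polynomial identities (`openTerm_comm`).

For the Hurwitz space, λ = t¹ - k (t²)² (℘(κp) + E₂/3), so its critical points are the half periods.
Their classification and the distinctness of the critical values come from the factorisation of ℘(z)
- ℘(a) into theta functions (`weierstrassP_sub_mul_theta`). At a critical point ℘' = 0, and every
∂_α λ is a polynomial of degree at most two in ℘ (`pd_lambda11_critical`). The residue sums thus
become sums over the roots e₁, e₂, e₃ of the cubic, which `lagrange_sum` evaluates; N is the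
constant that matches the result with the third derivatives of F. -/

noncomputable section

namespace OpenWDVV

/-! ### Sums of exponentials -/

section ExpSum

variable {ι E : Type*} [NormedAddCommGroup E] [NormedSpace ℂ E]

/-- The power series of `y ↦ ∑ d_i exp(L_i y)` at the origin. -/
def expSumSeries (d : ι → ℂ) (L : ι → E →L[ℂ] ℂ) : FormalMultilinearSeries ℂ E ℂ :=
  fun k => ∑' i, d i • (NormedSpace.expSeries ℂ ℂ).compContinuousLinearMap (L i) k

lemma norm_expSeries_comp_le (l : E →L[ℂ] ℂ) (k : ℕ) :
    ‖(NormedSpace.expSeries ℂ ℂ).compContinuousLinearMap l k‖ ≤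
      (k.factorial : ℝ)⁻¹ * ‖l‖ ^ k := by
  refine (ContinuousMultilinearMap.norm_compContinuousLinearMap_le _ _).trans ?_
  have : ‖NormedSpace.expSeries ℂ ℂ k‖ ≤ (k.factorial : ℝ)⁻¹ := by
    rw [NormedSpace.expSeries, norm_smul, ContinuousMultilinearMap.norm_mkPiAlgebraFin]
    simp
  simpa using mul_le_mul_of_nonneg_right this (by positivity : 0 ≤ ‖l‖ ^ k)

lemma expSeries_comp_apply (l : E →L[ℂ] ℂ) (k : ℕ) (y : E) :
    (NormedSpace.expSeries ℂ ℂ).compContinuousLinearMap l k (fun _ => y) =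
      (k.factorial : ℂ)⁻¹ * l y ^ k := by
  rw [FormalMultilinearSeries.compContinuousLinearMap_apply]
  have := NormedSpace.expSeries_apply_eq (𝕂 := ℂ) (l y) k
  simpa [Function.comp_def] using this

lemma hasSum_real_exp (x : ℝ) : HasSum (fun k : ℕ => (k.factorial : ℝ)⁻¹ * x ^ k) (Real.exp x) := by
  have := NormedSpace.exp_series_hasSum_exp' (𝕂 := ℝ) x
  rw [Real.exp_eq_exp_ℝ]
  simpa using this

lemma hasSum_complex_exp (x : ℂ) :
    HasSum (fun k : ℕ => (k.factorial : ℂ)⁻¹ * x ^ k) (Complex.exp x) := by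
  have := NormedSpace.exp_series_hasSum_exp' (𝕂 := ℂ) x
  rw [Complex.exp_eq_exp_ℂ]
  simpa using this

variable {d : ι → ℂ} {L : ι → E →L[ℂ] ℂ} {r : ℝ}

lemma summable_prod_exp (hr : 0 ≤ r)
    (hs : Summable fun i => ‖d i‖ * Real.exp (r * ‖L i‖)) :
    Summable fun x : ι × ℕ => ‖d x.1‖ * ((x.2.factorial : ℝ)⁻¹ * (r * ‖L x.1‖) ^ x.2) := by
  rw [summable_prod_of_nonneg (fun x => by positivity)]
  refine ⟨fun i => ((hasSum_real_exp (r * ‖L i‖)).mul_left ‖d i‖).summable, ?_⟩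
  have h : ∀ i, ∑' k : ℕ, ‖d i‖ * ((k.factorial : ℝ)⁻¹ * (r * ‖L i‖) ^ k) =
      ‖d i‖ * Real.exp (r * ‖L i‖) :=
    fun i => ((hasSum_real_exp (r * ‖L i‖)).mul_left ‖d i‖).tsum_eq
  exact hs.congr fun i => (h i).symm

lemma summable_expSeries_comp (hr : 0 < r)
    (hs : Summable fun i => ‖d i‖ * Real.exp (r * ‖L i‖)) (k : ℕ) :
    Summable fun i => ‖d i • (NormedSpace.expSeries ℂ ℂ).compContinuousLinearMap (L i) k‖ := by
  have h := ((summable_prod_exp hr.le hs).prod_symm.prod_factor k).mul_left ((r ^ k)⁻¹)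
  refine h.of_nonneg_of_le (fun i => norm_nonneg _) fun i => ?_
  rw [norm_smul]
  refine (mul_le_mul_of_nonneg_left (norm_expSeries_comp_le (L i) k) (norm_nonneg _)).trans ?_
  simp only [Prod.swap_prod_mk]
  rw [mul_pow]
  field_simp
  rfl

/-- Expand each exponential and interchange the sums: for ‖y‖ < r the double series over (i, k)
converges absolutely, the norms of the i-th row adding up to at most ‖d_i‖ exp(r‖L_i‖). A power
series on E itself gives analyticity in all variables jointly. -/
theorem hasFPowerSeriesOnBall_expSum (hr : 0 < r)
    (hs : Summable fun i => ‖d i‖ * Real.exp (r * ‖L i‖)) :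
    HasFPowerSeriesOnBall (fun y => ∑' i, d i * Complex.exp (L i y)) (expSumSeries d L) 0
      (ENNReal.ofReal r) := by
  have hprod := summable_prod_exp hr.le hs
  constructor
  · have : ENNReal.ofReal r = (r.toNNReal : ENNReal) := rfl
    rw [this]
    refine FormalMultilinearSeries.le_radius_of_summable_norm _ ?_
    have h := hprod.prod_symm.prod
    refine h.of_nonneg_of_le (fun k => by positivity) fun k => ?_
    rw [Real.coe_toNNReal _ hr.le]
    have h1 := summable_expSeries_comp hr hs k
    refine (mul_le_mul_of_nonneg_right (norm_tsum_le_tsum_norm h1)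
      (by positivity : 0 ≤ r ^ k)).trans ?_
    rw [← tsum_mul_right]
    refine (h1.mul_right _).tsum_le_tsum (fun i => ?_) (hprod.prod_symm.prod_factor k)
    rw [norm_smul, mul_assoc]
    refine mul_le_mul_of_nonneg_left ?_ (norm_nonneg _)
    refine (mul_le_mul_of_nonneg_right (norm_expSeries_comp_le (L i) k) (by positivity)).trans ?_
    simp only [Prod.swap_prod_mk]
    rw [mul_pow]
    apply le_of_eq
    ring
  · simpa using hr
  · intro y hy
    have hy' : ‖y‖ < r := by
      rw [Metric.mem_eball, edist_zero_right, ← ofReal_norm] at hy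
      exact (ENNReal.ofReal_lt_ofReal_iff hr).1 hy
    have hb : Summable fun x : ι × ℕ => d x.1 * ((x.2.factorial : ℂ)⁻¹ * (L x.1 y) ^ x.2) := by
      refine Summable.of_norm (hprod.of_nonneg_of_le (fun _ => norm_nonneg _) fun x => ?_)
      rw [norm_mul, norm_mul, norm_pow]
      simp only [norm_inv, Complex.norm_natCast]
      gcongr
      exact (L x.1).le_opNorm y |>.trans (by rw [mul_comm]; gcongr)
    have h1 : HasSum (fun x : ι × ℕ => d x.1 * ((x.2.factorial : ℂ)⁻¹ * (L x.1 y) ^ x.2))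
        (∑' i, d i * Complex.exp (L i y)) := by
      have h2 := hb.hasSum
      have h3 := h2.prod_fiberwise fun i => (hasSum_complex_exp (L i y)).mul_left (d i)
      rwa [h3.tsum_eq]
    have h4 := (Equiv.prodComm ℕ ι).hasSum_iff.2 h1
    rw [zero_add]
    refine h4.prod_fiberwise fun k => ?_
    have h5 := ContinuousMultilinearMap.hasSum_eval
      (summable_expSeries_comp hr hs k).of_norm.hasSum fun _ => y
    refine h5.congr_fun fun i => ?_
    rw [smul_apply, expSeries_comp_apply]
    rfl

/-- Local normal convergence of a sum of exponentials, with room for differentiation. -/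
def ExpSummableAt (c : ι → ℂ) (L : ι → E →L[ℂ] ℂ) (x : E) : Prop :=
  ∃ r > 0, Summable fun i => ‖c i * Complex.exp (L i x)‖ * Real.exp (r * ‖L i‖)

variable {c : ι → ℂ} {x : E}

/-- These are the coefficients of a directional derivative, so termwise differentiation can be
iterated. Half of the radius absorbs the linear factor, by s ≤ exp s with s = r‖L_i‖/2. -/
lemma ExpSummableAt.mul_apply (h : ExpSummableAt c L x) (v : E) :
    ExpSummableAt (fun i => c i * L i v) L x := by
  obtain ⟨r, hr, hs⟩ := h
  refine ⟨r / 2, half_pos hr, (hs.mul_left (‖v‖ * (2 / r))).of_nonneg_of_le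
    (fun i => by positivity) fun i => ?_⟩
  have h1 : ‖L i v‖ ≤ ‖v‖ * (2 / r) * Real.exp (r / 2 * ‖L i‖) := by
    have h2 := Real.add_one_le_exp (r / 2 * ‖L i‖)
    calc ‖L i v‖ ≤ ‖L i‖ * ‖v‖ := (L i).le_opNorm v
      _ = ‖v‖ * (2 / r) * (r / 2 * ‖L i‖) := by field_simp
      _ ≤ _ := by gcongr; linarith
  have h3 : Real.exp (r * ‖L i‖) = Real.exp (r / 2 * ‖L i‖) * Real.exp (r / 2 * ‖L i‖) := by
    rw [← Real.exp_add]; ring_nf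
  rw [h3, mul_right_comm, norm_mul]
  calc ‖c i * Complex.exp (L i x)‖ * ‖L i v‖ * Real.exp (r / 2 * ‖L i‖)
      ≤ ‖c i * Complex.exp (L i x)‖ * (‖v‖ * (2 / r) * Real.exp (r / 2 * ‖L i‖)) *
        Real.exp (r / 2 * ‖L i‖) := by gcongr
    _ = _ := by ring

lemma ExpSummableAt.summable (h : ExpSummableAt c L x) :
    Summable fun i => c i * Complex.exp (L i x) := by
  obtain ⟨r, hr, hs⟩ := h
  refine Summable.of_norm (hs.of_nonneg_of_le (fun _ => norm_nonneg _) fun i => ?_)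
  exact le_mul_of_one_le_right (norm_nonneg _) (Real.one_le_exp (by positivity))

lemma ExpSummableAt.exists_hasFPowerSeriesAt (h : ExpSummableAt c L x) :
    HasFPowerSeriesAt (fun y => ∑' i, c i * Complex.exp (L i y))
      (expSumSeries (fun i => c i * Complex.exp (L i x)) L) x := by
  obtain ⟨r, hr, hs⟩ := h
  have h1 := (hasFPowerSeriesOnBall_expSum hr hs).comp_sub x
  rw [zero_add] at h1
  have h2 : (fun y => ∑' i, c i * Complex.exp (L i y)) =
      fun z => ∑' i, c i * Complex.exp (L i x) * Complex.exp (L i (z - x)) := by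
    funext y
    refine tsum_congr fun i => ?_
    rw [mul_assoc, ← Complex.exp_add, map_sub, add_sub_cancel]
  rw [h2]
  exact h1.hasFPowerSeriesAt

theorem ExpSummableAt.analyticAt (h : ExpSummableAt c L x) :
    AnalyticAt ℂ (fun y => ∑' i, c i * Complex.exp (L i y)) x :=
  h.exists_hasFPowerSeriesAt.analyticAt

theorem ExpSummableAt.fderiv_apply (h : ExpSummableAt c L x) (v : E) :
    fderiv ℂ (fun y => ∑' i, c i * Complex.exp (L i y)) x v =
      ∑' i, c i * L i v * Complex.exp (L i x) := by
  rw [h.exists_hasFPowerSeriesAt.hasFDerivAt.fderiv]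
  obtain ⟨r, hr, hs⟩ := h
  have h5 := ContinuousMultilinearMap.tsum_eval
    (summable_expSeries_comp hr hs 1).of_norm fun _ => v
  simp only [continuousMultilinearCurryFin1_apply, expSumSeries]
  have h6 : (Fin.snoc 0 v : Fin 1 → E) = fun _ => v := by
    funext j; fin_cases j; simp [Fin.snoc]
  rw [h6, h5]
  refine tsum_congr fun i => ?_
  rw [smul_apply, expSeries_comp_apply]
  simp only [Nat.factorial_one, Nat.cast_one, inv_one, pow_one, one_mul, smul_eq_mul]
  ring

end ExpSum

/-! ### The theta series as a function of two variables -/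

/-- The partial derivative in the first variable. -/
def dz (f : ℂ × ℂ → ℂ) (x : ℂ × ℂ) : ℂ := fderiv ℂ f x (1, 0)

/-- The partial derivative in the second variable. -/
def dt (f : ℂ × ℂ → ℂ) (x : ℂ × ℂ) : ℂ := fderiv ℂ f x (0, 1)

/-- The theta function on pairs `(z, τ)`. -/
def theta (x : ℂ × ℂ) : ℂ := theta1 x.1 x.2

/-- The half space `Im τ > 0`. -/
def halfSpace : Set (ℂ × ℂ) := {x | 0 < x.2.im}

lemma isOpen_halfSpace : IsOpen halfSpace :=
  isOpen_lt continuous_const (Complex.continuous_im.comp continuous_snd)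

/-- The exponents of the theta series. -/
def thetaExponent (n : ℤ) : ℂ × ℂ →L[ℂ] ℂ :=
  (Complex.I * (2 * n + 1)) • ContinuousLinearMap.fst ℂ ℂ ℂ +
    (Real.pi * Complex.I * ((n : ℂ) + 1 / 2) ^ 2) • ContinuousLinearMap.snd ℂ ℂ ℂ

/-- The coefficients of the theta series. -/
def thetaCoeff (n : ℤ) : ℂ := -Complex.I * (-1) ^ n

lemma thetaExponent_apply (n : ℤ) (x : ℂ × ℂ) : thetaExponent n x =
    Complex.I * (2 * n + 1) * x.1 + Real.pi * Complex.I * ((n : ℂ) + 1 / 2) ^ 2 * x.2 := by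
  simp [thetaExponent]

lemma norm_thetaCoeff (n : ℤ) : ‖thetaCoeff n‖ = 1 := by
  simp [thetaCoeff]

lemma norm_thetaExponent_le (n : ℤ) :
    ‖thetaExponent n‖ ≤ |2 * (n : ℝ) + 1| + Real.pi * ((n : ℝ) + 1 / 2) ^ 2 := by
  refine (norm_add_le _ _).trans (add_le_add ?_ ?_)
  · rw [norm_smul]
    have h : ‖Complex.I * (2 * n + 1)‖ = |2 * (n : ℝ) + 1| := by
      rw [norm_mul, Complex.norm_I, one_mul, ← Real.norm_eq_abs, ← Complex.norm_real]
      push_cast; rfl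
    rw [h]
    exact mul_le_of_le_one_right (abs_nonneg _) (ContinuousLinearMap.norm_fst_le ℂ ℂ ℂ)
  · rw [norm_smul]
    have h : ‖(Real.pi : ℂ) * Complex.I * ((n : ℂ) + 1 / 2) ^ 2‖ =
        Real.pi * ((n : ℝ) + 1 / 2) ^ 2 := by
      have : (Real.pi : ℂ) * Complex.I * ((n : ℂ) + 1 / 2) ^ 2 =
          Complex.I * ((Real.pi * ((n : ℝ) + 1 / 2) ^ 2 : ℝ) : ℂ) := by push_cast; ring
      rw [this, norm_mul, Complex.norm_I, one_mul, Complex.norm_real, Real.norm_of_nonneg]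
      positivity
    rw [h]
    exact mul_le_of_le_one_right (by positivity) (ContinuousLinearMap.norm_snd_le ℂ ℂ ℂ)

lemma norm_exp_thetaExponent (n : ℤ) (x : ℂ × ℂ) : ‖Complex.exp (thetaExponent n x)‖ =
    Real.exp (-(2 * (n : ℝ) + 1) * x.1.im - Real.pi * ((n : ℝ) + 1 / 2) ^ 2 * x.2.im) := by
  rw [Complex.norm_exp, thetaExponent_apply]
  congr 1
  have : Complex.I * (2 * n + 1) * x.1 + Real.pi * Complex.I * ((n : ℂ) + 1 / 2) ^ 2 * x.2 =
      Complex.I * (((2 * (n : ℝ) + 1 : ℝ) : ℂ) * x.1 +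
        ((Real.pi * ((n : ℝ) + 1 / 2) ^ 2 : ℝ) : ℂ) * x.2) := by push_cast; ring
  rw [this, Complex.I_mul_re, Complex.add_im, Complex.im_ofReal_mul, Complex.im_ofReal_mul]
  ring

/-- Gaussian decay wins: the radius Im τ/2 costs half of π(n + 1/2)² Im τ and a linear term, which
is put into M. The other half, bounded below by (n + 1/2)² ≥ n² - |n|, leaves a majorant of Jacobi
theta type. -/
lemma expSummableAt_theta {x : ℂ × ℂ} (hx : x ∈ halfSpace) :
    ExpSummableAt thetaCoeff thetaExponent x := by
  have hT : 0 < x.2.im := hx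
  set T := x.2.im with hTdef
  set M := |x.1.im| + T / 2 with hM
  refine ⟨T / 2, half_pos hT, ?_⟩
  have hb := (summable_pow_mul_jacobiTheta₂_term_bound (M / Real.pi + T / 4)
    (half_pos hT) 0).mul_left (Real.exp M)
  refine hb.of_nonneg_of_le (fun i => by positivity) fun n => ?_
  rw [norm_mul, norm_thetaCoeff, one_mul, norm_exp_thetaExponent, pow_zero, one_mul,
    ← Real.exp_add, ← Real.exp_add, Real.exp_le_exp]
  have h1 : T / 2 * ‖thetaExponent n‖ ≤
      T / 2 * (|2 * (n : ℝ) + 1| + Real.pi * ((n : ℝ) + 1 / 2) ^ 2) := by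
    gcongr; exact norm_thetaExponent_le n
  have h2 : -(2 * (n : ℝ) + 1) * x.1.im ≤ |2 * (n : ℝ) + 1| * |x.1.im| := by
    rw [← abs_mul]
    calc _ = -((2 * (n : ℝ) + 1) * x.1.im) := by ring
      _ ≤ _ := neg_le_abs _
  have h3 : |2 * (n : ℝ) + 1| ≤ 2 * |(n : ℝ)| + 1 := by
    refine (abs_add_le _ _).trans ?_
    simp [abs_mul]
  have h4 : |2 * (n : ℝ) + 1| * M ≤ (2 * |(n : ℝ)| + 1) * M := by gcongr
  have h5 : -|(n : ℝ)| ≤ (n : ℝ) := neg_abs_le _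
  have h6 : Real.pi * (T / 2) * ((n : ℝ) ^ 2 - |(n : ℝ)|) ≤
      Real.pi * (T / 2) * ((n : ℝ) + 1 / 2) ^ 2 := by
    gcongr
    nlinarith
  have h7 : -Real.pi * (T / 2 * (n : ℝ) ^ 2 - 2 * (M / Real.pi + T / 4) * |(n : ℝ)|) =
      2 * M * |(n : ℝ)| - Real.pi * (T / 2) * ((n : ℝ) ^ 2 - |(n : ℝ)|) := by
    field_simp
    ring
  push_cast
  rw [h7]
  rw [hM] at *
  nlinarith

/-- The exponential form of the theta series. -/
def thetaSum (x : ℂ × ℂ) : ℂ := ∑' n : ℤ, thetaCoeff n * Complex.exp (thetaExponent n x)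

/-- The terms with indices n and -n-1 have the same Gaussian factor and opposite signs, so together
they form a sine. -/
lemma theta_eq_thetaSum {x : ℂ × ℂ} (hx : x ∈ halfSpace) : theta x = thetaSum x := by
  have hs := (expSummableAt_theta hx).summable
  have h1 : Summable fun n : ℕ => thetaCoeff n * Complex.exp (thetaExponent n x) :=
    hs.comp_injective (i := fun n : ℕ => (n : ℤ)) Nat.cast_injective
  have h2 : Summable fun n : ℕ =>
      thetaCoeff (-((n : ℤ) + 1)) * Complex.exp (thetaExponent (-((n : ℤ) + 1)) x) :=
    hs.comp_injective (i := fun n : ℕ => -((n : ℤ) + 1)) fun a b h => by simpa using h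
  rw [thetaSum, tsum_of_nat_of_neg_add_one (f := fun n : ℤ =>
    thetaCoeff n * Complex.exp (thetaExponent n x)) h1 h2, ← h1.tsum_add h2, theta, theta1,
    ← tsum_mul_left]
  refine tsum_congr fun n => ?_
  simp only [thetaExponent_apply, thetaCoeff]
  have e1 : Complex.exp (Complex.I * (2 * ((n : ℤ) : ℂ) + 1) * x.1 +
      Real.pi * Complex.I * (((n : ℤ) : ℂ) + 1 / 2) ^ 2 * x.2) =
      Complex.exp (Real.pi * Complex.I * x.2 * ((n : ℂ) + 1 / 2) ^ 2) *
        Complex.exp ((2 * (n : ℂ) + 1) * x.1 * Complex.I) := by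
    rw [← Complex.exp_add]; congr 1; push_cast; ring
  have e2 : Complex.exp (Complex.I * (2 * ((-((n : ℤ) + 1) : ℤ) : ℂ) + 1) * x.1 +
      Real.pi * Complex.I * (((-((n : ℤ) + 1) : ℤ) : ℂ) + 1 / 2) ^ 2 * x.2) =
      Complex.exp (Real.pi * Complex.I * x.2 * ((n : ℂ) + 1 / 2) ^ 2) *
        Complex.exp (-((2 * (n : ℂ) + 1) * x.1) * Complex.I) := by
    rw [← Complex.exp_add]; congr 1; push_cast; ring
  have e3 : (-1 : ℂ) ^ (-((n : ℤ) + 1)) = -(-1) ^ n := by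
    rw [zpow_neg, zpow_add₀ (by norm_num), zpow_natCast, zpow_one]
    rcases neg_one_pow_eq_or ℂ n with h | h <;> simp [h]
  rw [e1, e2, e3, zpow_natCast, Complex.sin]
  ring

lemma theta_eventuallyEq {x : ℂ × ℂ} (hx : x ∈ halfSpace) : theta =ᶠ[𝓝 x] thetaSum := by
  filter_upwards [isOpen_halfSpace.mem_nhds hx] with y hy using theta_eq_thetaSum hy

lemma analyticAt_theta {x : ℂ × ℂ} (hx : x ∈ halfSpace) : AnalyticAt ℂ theta x :=
  (expSummableAt_theta hx).analyticAt.congr (theta_eventuallyEq hx).symm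

/-- The heat equation. Each exponential is an eigenfunction of both sides: πi(n + 1/2)² is -πi/4
times (i(2n + 1))². -/
lemma dt_theta {x : ℂ × ℂ} (hx : x ∈ halfSpace) :
    dt theta x = -(Real.pi * Complex.I / 4) * dz (dz theta) x := by
  have hs := expSummableAt_theta hx
  have h1 : dz theta =ᶠ[𝓝 x] fun y =>
      ∑' n, thetaCoeff n * thetaExponent n (1, 0) * Complex.exp (thetaExponent n y) := by
    filter_upwards [isOpen_halfSpace.mem_nhds hx] with y hy
    rw [dz, (theta_eventuallyEq hy).fderiv_eq]
    exact (expSummableAt_theta hy).fderiv_apply _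
  have h2 : dz (dz theta) x = ∑' n, thetaCoeff n * thetaExponent n (1, 0) *
      thetaExponent n (1, 0) * Complex.exp (thetaExponent n x) := by
    rw [dz, h1.fderiv_eq]
    exact (hs.mul_apply _).fderiv_apply _
  have h3 : dt theta x = ∑' n, thetaCoeff n * thetaExponent n (0, 1) *
      Complex.exp (thetaExponent n x) := by
    rw [dt, (theta_eventuallyEq hx).fderiv_eq]
    exact hs.fderiv_apply _
  rw [h2, h3, ← tsum_mul_left]
  refine tsum_congr fun n => ?_
  generalize Complex.exp (thetaExponent n x) = q
  simp only [thetaExponent_apply]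
  linear_combination ((Real.pi * Complex.I / 4) * thetaCoeff n * q *
    (2 * n + 1) ^ 2) * Complex.I_sq

lemma theta_neg (z τ : ℂ) : theta1 (-z) τ = -theta1 z τ := by
  simp [theta1, Complex.sin_neg, tsum_neg]

lemma theta_add_pi (z τ : ℂ) : theta1 (z + Real.pi) τ = -theta1 z τ := by
  simp only [theta1]
  rw [← mul_neg, ← tsum_neg]
  congr 1
  refine tsum_congr fun n => ?_
  rw [← mul_neg]
  congr 1
  have : (2 * (n : ℂ) + 1) * (z + Real.pi) = ((2 * (n : ℂ) + 1) * z + Real.pi) +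
      (n : ℤ) * (2 * Real.pi) := by push_cast; ring
  rw [this, Complex.sin_add_int_mul_two_pi, Complex.sin_add_pi]

lemma theta_add_pi_mul {τ : ℂ} (hτ : 0 < τ.im) (z : ℂ) : theta1 (z + Real.pi * τ) τ =
    -Complex.exp (-Real.pi * Complex.I * τ - 2 * Complex.I * z) * theta1 z τ := by
  have h1 := theta_eq_thetaSum (x := (z + Real.pi * τ, τ)) hτ
  have h2 := theta_eq_thetaSum (x := (z, τ)) hτ
  simp only [theta, thetaSum] at h1 h2
  rw [h1, h2, ← tsum_mul_left, ← (Equiv.addRight (1 : ℤ)).tsum_eq fun n : ℤ =>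
    -Complex.exp (-Real.pi * Complex.I * τ - 2 * Complex.I * z) *
      (thetaCoeff n * Complex.exp (thetaExponent n (z, τ)))]
  refine tsum_congr fun n => ?_
  simp only [Equiv.coe_addRight, thetaCoeff, thetaExponent_apply]
  rw [zpow_add₀ (by norm_num), zpow_one]
  have : Complex.exp (Complex.I * (2 * n + 1) * (z + Real.pi * τ) +
      Real.pi * Complex.I * ((n : ℂ) + 1 / 2) ^ 2 * τ) =
      Complex.exp (-Real.pi * Complex.I * τ - 2 * Complex.I * z) *
      Complex.exp (Complex.I * (2 * ((n + 1 : ℤ) : ℂ) + 1) * z +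
      Real.pi * Complex.I * (((n + 1 : ℤ) : ℂ) + 1 / 2) ^ 2 * τ) := by
    rw [← Complex.exp_add]; congr 1; push_cast; ring
  rw [this]
  ring

/-! ### The product `∏ (1 - Q ^ (n + 1) w)` -/

section EulerProd

/-- The Euler product `∏_{n ≥ 1} (1 - Q^n w)`. -/
def eulerProd (Q w : ℂ) : ℂ := ∏' n : ℕ, (1 - Q ^ (n + 1) * w)

variable {Q : ℂ}

lemma summable_norm_pow_succ (hQ : ‖Q‖ < 1) : Summable fun n : ℕ => ‖Q‖ ^ (n + 1) :=
  (summable_nat_add_iff 1).2 (summable_geometric_of_lt_one (norm_nonneg _) hQ)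

lemma summable_norm_pow_mul (hQ : ‖Q‖ < 1) (w : ℂ) :
    Summable fun n : ℕ => ‖-(Q ^ (n + 1) * w)‖ := by
  simpa using (summable_norm_pow_succ hQ).mul_right ‖w‖

lemma multipliable_eulerProd (hQ : ‖Q‖ < 1) (w : ℂ) :
    Multipliable fun n : ℕ => 1 - Q ^ (n + 1) * w := by
  simpa only [sub_eq_add_neg] using multipliable_one_add_of_summable (summable_norm_pow_mul hQ w)

lemma multipliableLocallyUniformlyOn_eulerProd (hQ : ‖Q‖ < 1) :
    MultipliableLocallyUniformlyOn (fun (n : ℕ) w => 1 - Q ^ (n + 1) * w) Set.univ := by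
  use eulerProd Q
  unfold eulerProd
  simp_rw [sub_eq_add_neg]
  apply hasProdLocallyUniformlyOn_of_forall_compact isOpen_univ
  intro K _ hcK
  obtain ⟨R, hR⟩ := hcK.isBounded.exists_norm_le
  refine ((summable_norm_pow_succ hQ).mul_right R).hasProdUniformlyOn_nat_one_add hcK
    (.of_forall fun n w hw => ?_) (fun _ => by fun_prop)
  rw [norm_neg, norm_mul, norm_pow]
  exact mul_le_mul_of_nonneg_left (hR w hw) (by positivity)

lemma differentiable_eulerProd (hQ : ‖Q‖ < 1) : Differentiable ℂ (eulerProd Q) := by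
  rw [← differentiableOn_univ]
  exact (multipliableLocallyUniformlyOn_eulerProd hQ).hasProdLocallyUniformlyOn.differentiableOn
    (.of_forall fun _ => by simpa [Finset.prod_fn] using
      DifferentiableOn.finsetProd (fun _ _ => by fun_prop)) isOpen_univ

lemma eulerProd_eq_mul (hQ : ‖Q‖ < 1) (w : ℂ) :
    eulerProd Q w = (1 - Q * w) * eulerProd Q (Q * w) := by
  have hm : Multipliable fun n : ℕ => 1 - Q ^ (n + 1 + 1) * w := by
    have := multipliable_eulerProd hQ (Q * w)
    refine this.congr fun n => ?_
    ring
  have h := tprod_eq_zero_mul' (f := fun n : ℕ => 1 - Q ^ (n + 1) * w) hm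
  have h2 : ∏' n : ℕ, (1 - Q ^ (n + 1 + 1) * w) = eulerProd Q (Q * w) :=
    tprod_congr fun n => by rw [pow_succ _ (n + 1), mul_assoc]
  rw [h2, zero_add, pow_one] at h
  exact h

lemma eulerProd_ne_zero (hQ : ‖Q‖ < 1) {w : ℂ} (hw : ∀ n : ℕ, Q ^ (n + 1) * w ≠ 1) :
    eulerProd Q w ≠ 0 := by
  have := tprod_one_add_ne_zero_of_summable (f := fun n : ℕ => -(Q ^ (n + 1) * w))
    (fun n => by simpa [← sub_eq_add_neg, sub_eq_zero] using (hw n).symm)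
    (summable_norm_pow_mul hQ w)
  simpa only [eulerProd, sub_eq_add_neg] using this

lemma pow_mul_ne_one (hQ : ‖Q‖ < 1) {w : ℂ} (hw : ‖Q‖ * ‖w‖ < 1) (n : ℕ) :
    Q ^ (n + 1) * w ≠ 1 := by
  intro h
  have h1 : ‖Q ^ (n + 1) * w‖ = 1 := by rw [h, norm_one]
  rw [norm_mul, norm_pow, pow_succ, mul_assoc] at h1
  have h2 : ‖Q‖ ^ n ≤ 1 := pow_le_one₀ (norm_nonneg _) hQ.le
  nlinarith [mul_nonneg (norm_nonneg Q) (norm_nonneg w)]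

lemma norm_pow_mul_le (hQ : ‖Q‖ < 1) {w : ℂ} {ρ : ℝ} (hw : ‖Q‖ * ‖w‖ ≤ ρ) (n : ℕ) :
    1 - ρ ≤ ‖1 - Q ^ (n + 1) * w‖ := by
  have h1 : ‖Q ^ (n + 1) * w‖ ≤ ρ := by
    rw [norm_mul, norm_pow, pow_succ, mul_assoc]
    exact (mul_le_of_le_one_left (by positivity) (pow_le_one₀ (norm_nonneg _) hQ.le)).trans hw
  have h2 := norm_sub_norm_le (1 : ℂ) (Q ^ (n + 1) * w)
  rw [norm_one] at h2
  linarith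

lemma summable_logDeriv_eulerProd (hQ : ‖Q‖ < 1) {w : ℂ} (hw : ‖Q‖ * ‖w‖ < 1) :
    Summable fun n : ℕ => -Q ^ (n + 1) / (1 - Q ^ (n + 1) * w) := by
  refine Summable.of_norm (((summable_norm_pow_succ hQ).mul_right
    (1 - ‖Q‖ * ‖w‖)⁻¹).of_nonneg_of_le (fun _ => norm_nonneg _) fun n => ?_)
  rw [norm_div, norm_neg, norm_pow, div_eq_mul_inv]
  gcongr
  exact norm_pow_mul_le hQ le_rfl n

lemma logDeriv_eulerProd (hQ : ‖Q‖ < 1) {w : ℂ} (hw : ‖Q‖ * ‖w‖ < 1) :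
    logDeriv (eulerProd Q) w = ∑' n : ℕ, -Q ^ (n + 1) / (1 - Q ^ (n + 1) * w) := by
  have h1 : ∀ n : ℕ, logDeriv (fun w => 1 - Q ^ (n + 1) * w) w =
      -Q ^ (n + 1) / (1 - Q ^ (n + 1) * w) := by
    intro n
    rw [logDeriv_apply]
    congr 1
    simp [deriv_const_mul_id]
  have h2 := logDeriv_tprod_eq_tsum (f := fun (n : ℕ) w => 1 - Q ^ (n + 1) * w) isOpen_univ
    (Set.mem_univ w)
    (fun n => sub_ne_zero.2 (pow_mul_ne_one hQ hw n).symm) (fun n => by fun_prop)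
    (by simpa only [h1] using summable_logDeriv_eulerProd hQ hw)
    (multipliableLocallyUniformlyOn_eulerProd hQ)
    (eulerProd_ne_zero hQ (pow_mul_ne_one hQ hw))
  simp only [h1] at h2
  exact h2

/-- The Lambert series `∑ Q^n / (1 - Q^n)²`. -/
def lambert (Q : ℂ) : ℂ := ∑' n : ℕ, Q ^ (n + 1) / (1 - Q ^ (n + 1)) ^ 2

/-- Termwise, -Qⁿw/(1 - Qⁿw) has derivative -Qⁿ/(1 - Qⁿw)². This is how the Lambert series of E₂
enters the expansion of log θ. -/
lemma hasDerivAt_mul_logDeriv_eulerProd (hQ : ‖Q‖ < 1) :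
    HasDerivAt (fun w => w * logDeriv (eulerProd Q) w) (-lambert Q) 1 := by
  -- With ‖Q‖ < ρ < 1 the disc ‖w‖ < ρ/‖Q‖ contains 1, and every denominator is at least 1 - ρ in
  -- norm there. The case Q = 0 is separate because this radius divides by ‖Q‖.
  obtain ⟨ρ, hρ1, hρ2⟩ := exists_between hQ
  by_cases hQ0 : Q = 0
  · subst hQ0
    have h1 : eulerProd 0 = fun _ => 1 := by
      funext w; simp [eulerProd]
    rw [h1]
    simpa [lambert, logDeriv_const] using hasDerivAt_const (1 : ℂ) (0 : ℂ)
  have hQp : 0 < ‖Q‖ := norm_pos_iff.2 hQ0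
  set t : Set ℂ := Metric.ball 0 (ρ / ‖Q‖) with ht
  have hmem : ∀ w ∈ t, ‖Q‖ * ‖w‖ ≤ ρ := by
    intro w hw
    rw [ht, mem_ball_zero_iff, lt_div_iff₀ hQp] at hw
    linarith
  have h1t : (1 : ℂ) ∈ t := by
    rw [ht, mem_ball_zero_iff, norm_one, lt_div_iff₀ hQp]; linarith
  have hne : ∀ (n : ℕ), ∀ w ∈ t, 1 - Q ^ (n + 1) * w ≠ 0 := fun n w hw =>
    sub_ne_zero.2 (pow_mul_ne_one hQ ((hmem w hw).trans_lt hρ2) n).symm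
  have hd := hasDerivAt_tsum_of_isPreconnected (t := t) (y₀ := 1) (y := 1)
    (g := fun (n : ℕ) w => -(Q ^ (n + 1) * w) / (1 - Q ^ (n + 1) * w))
    (g' := fun (n : ℕ) w => -Q ^ (n + 1) / (1 - Q ^ (n + 1) * w) ^ 2)
    (u := fun n : ℕ => ‖Q‖ ^ (n + 1) * ((1 - ρ) ^ 2)⁻¹)
    ((summable_norm_pow_succ hQ).mul_right _) Metric.isOpen_ball
    (convex_ball _ _).isPreconnected
    (fun n w hw => by
      have h1 : HasDerivAt (fun w => Q ^ (n + 1) * w) (Q ^ (n + 1)) w := by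
        simpa using (hasDerivAt_id w).const_mul (Q ^ (n + 1))
      refine (h1.fun_neg.fun_div (h1.const_sub 1) (hne n w hw)).congr_deriv ?_
      congr 1
      ring)
    (fun n w hw => by
      rw [norm_div, norm_neg, norm_pow, norm_pow, div_eq_mul_inv]
      have := norm_pow_mul_le hQ (hmem w hw) n
      have h3 : 0 < 1 - ρ := by linarith
      gcongr)
    h1t
    (by
      have := summable_logDeriv_eulerProd hQ (w := 1) (by simpa using hQ)
      simpa using this)
    h1t
  have hv : ∑' n : ℕ, -Q ^ (n + 1) / (1 - Q ^ (n + 1) * 1) ^ 2 = -lambert Q := by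
    rw [lambert, ← tsum_neg]
    exact tsum_congr fun n => by rw [mul_one, neg_div]
  rw [hv] at hd
  refine hd.congr_of_eventuallyEq ?_
  filter_upwards [Metric.isOpen_ball.mem_nhds h1t] with w hw
  rw [logDeriv_eulerProd hQ ((hmem w hw).trans_lt hρ2), ← tsum_mul_left]
  exact tsum_congr fun n => by ring

/-- Expand Qⁿ/(1 - Qⁿ)² = ∑ m Q^{nm} and collect equal powers of Q. -/
lemma lambert_eq_tsum_sigma (hQ : ‖Q‖ < 1) :
    lambert Q = ∑' n : ℕ+, (ArithmeticFunction.sigma 1 n : ℂ) * Q ^ (n : ℕ) := by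
  rw [← tsum_prod_pow_eq_tsum_sigma 1 hQ, lambert,
    tsum_pnat_eq_tsum_succ (f := fun d : ℕ => ∑' c : ℕ+, ((c : ℕ) : ℂ) ^ 1 * Q ^ (d * c : ℕ))]
  refine tsum_congr fun n => ?_
  have h1 : ‖Q ^ (n + 1)‖ < 1 := by
    rw [norm_pow]; exact pow_lt_one₀ (norm_nonneg _) hQ (by omega)
  have h2 := hasSum_coe_mul_geometric_of_norm_lt_one h1
  rw [← h2.tsum_eq, ← tsum_zero_pnat_eq_tsum_nat h2.summable]
  simp only [Nat.cast_zero, zero_mul, zero_add]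
  exact tsum_congr fun m => by rw [pow_one, pow_mul]

lemma E2_eq_lambert {τ : ℂ} (hτ : 0 < τ.im) :
    EisensteinSeries.E2 (UpperHalfPlane.ofComplex τ) =
      1 - 24 * lambert (Complex.exp (2 * Real.pi * Complex.I * τ)) := by
  rw [EisensteinSeries.E2_eq_tsum_cexp, UpperHalfPlane.ofComplex_apply_of_im_pos hτ,
    lambert_eq_tsum_sigma]
  · exact UpperHalfPlane.norm_exp_two_pi_I_lt_one ⟨τ, hτ⟩

end EulerProd

/-! ### Elliptic functions without poles are constant -/

/-- The lattice spanned by `c` and `c τ`. -/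
def periodPair (c τ : ℂ) (hc : c ≠ 0) (hτ : 0 < τ.im) : PeriodPair where
  ω₁ := c
  ω₂ := c * τ
  indep := by
    rw [LinearIndependent.pair_iff]
    intro s t h
    have h1 : c * ((s : ℂ) + t * τ) = 0 := by
      rw [← h, Complex.real_smul, Complex.real_smul]; ring
    have h2 := (mul_eq_zero.1 h1).resolve_left hc
    have h3 := congrArg Complex.im h2
    simp only [Complex.add_im, Complex.ofReal_im, Complex.im_ofReal_mul, zero_add,
      Complex.zero_im, mul_eq_zero, hτ.ne', or_false] at h3
    subst h3
    simpa using h2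

section Liouville

variable {L : PeriodPair}

lemma periodic_of_generators {f : ℂ → ℂ} (h₁ : ∀ z, f (z + L.ω₁) = f z)
    (h₂ : ∀ z, f (z + L.ω₂) = f z) {ω : ℂ} (hω : ω ∈ L.lattice) (z : ℂ) : f (z + ω) = f z := by
  obtain ⟨m, n, rfl⟩ := PeriodPair.mem_lattice.1 hω
  rw [← add_assoc]
  exact (Function.Periodic.int_mul (f := f) (c := L.ω₂) h₂ n _).trans
    (Function.Periodic.int_mul (f := f) (c := L.ω₁) h₁ m _)

lemma eventually_notMem_lattice (L : PeriodPair) : ∀ᶠ z in 𝓝[≠] (0 : ℂ), z ∉ L.lattice := by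
  have := L.compl_lattice_sdiff_singleton_mem_nhds 0
  rw [eventually_nhdsWithin_iff]
  filter_upwards [this] with z hz h0 hzL
  exact hz ⟨hzL, h0⟩

lemma compl_lattice_mem_nhds {z : ℂ} (hz : z ∉ L.lattice) : (L.lattice : Set ℂ)ᶜ ∈ 𝓝 z :=
  L.isClosed_lattice.isOpen_compl.mem_nhds hz

/-- Liouville: assigning the value c on the lattice removes the singularities, and a periodic entire
function has compact range. -/
theorem eq_const_of_periodic {f : ℂ → ℂ} {c : ℂ}
    (hper : ∀ z ∉ L.lattice, ∀ ω ∈ L.lattice, f (z + ω) = f z)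
    (hd : ∀ z ∉ L.lattice, DifferentiableAt ℂ f z)
    (hlim : Filter.Tendsto f (𝓝[≠] 0) (𝓝 c)) {z : ℂ} (hz : z ∉ L.lattice) : f z = c := by
  classical
  set h : ℂ → ℂ := fun z => if z ∈ L.lattice then c else f z with hh
  have hp : ∀ z, ∀ ω ∈ L.lattice, h (z + ω) = h z := by
    intro z ω hω
    by_cases hzL : z ∈ L.lattice
    · simp [hh, hzL, L.lattice.add_mem hzL hω]
    · have : z + ω ∉ L.lattice := fun h => hzL (by simpa using L.lattice.sub_mem h hω)
      simp [hh, hzL, this, hper z hzL ω hω]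
  have hoff : ∀ z ∉ L.lattice, DifferentiableAt ℂ h z := by
    intro z hz
    refine (hd z hz).congr_of_eventuallyEq ?_
    filter_upwards [compl_lattice_mem_nhds hz] with w hw
    exact if_neg hw
  have h0 : DifferentiableAt ℂ h 0 := by
    refine (Complex.analyticAt_of_differentiable_on_punctured_nhds_of_continuousAt
      ?_ ?_).differentiableAt
    · filter_upwards [eventually_notMem_lattice L] with w hw using hoff w hw
    · rw [continuousAt_iff_punctured_nhds]
      have : h 0 = c := if_pos L.lattice.zero_mem
      rw [this]
      refine hlim.congr' ?_
      filter_upwards [eventually_notMem_lattice L] with w hw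
      exact (if_neg hw).symm
  have hdiff : Differentiable ℂ h := by
    intro w
    by_cases hw : w ∈ L.lattice
    · have h1 : h = fun v => h (v - w) := by
        funext v
        simpa using hp (v - w) w hw
      rw [h1]
      have h2 : DifferentiableAt ℂ h (w - w) := by rwa [sub_self]
      exact h2.comp w (f := fun v => v - w) (by fun_prop)
    · exact hoff w hw
  have hb := IsZLattice.isCompact_range_of_periodic L.lattice h hdiff.continuous hp
  have := hdiff.apply_eq_apply_of_bounded hb.isBounded z 0
  simpa [hh, hz] using this

end Liouville

/-! ### The product formula for the theta function -/

section Product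

variable {τ : ℂ}

/-- The period lattice `π ℤ + π τ ℤ`. -/
def thetaPair (τ : ℂ) (hτ : 0 < τ.im) : PeriodPair :=
  periodPair Real.pi τ (by exact_mod_cast Real.pi_ne_zero) hτ

/-- The square of the nome. -/
def nomeSq (τ : ℂ) : ℂ := Complex.exp (2 * Real.pi * Complex.I * τ)

lemma norm_nomeSq_lt_one (hτ : 0 < τ.im) : ‖nomeSq τ‖ < 1 :=
  UpperHalfPlane.norm_exp_two_pi_I_lt_one ⟨τ, hτ⟩

/-- The product `sin z ∏ (1 - Q^n e^{2iz}) (1 - Q^n e^{-2iz})`. -/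
def thetaProd (τ z : ℂ) : ℂ :=
  Complex.sin z * eulerProd (nomeSq τ) (Complex.exp (2 * Complex.I * z)) *
    eulerProd (nomeSq τ) (Complex.exp (-(2 * Complex.I * z)))

lemma differentiable_thetaProd (hτ : 0 < τ.im) : Differentiable ℂ (thetaProd τ) := by
  have h := differentiable_eulerProd (norm_nomeSq_lt_one hτ)
  have h1 : Differentiable ℂ fun z => eulerProd (nomeSq τ) (Complex.exp (2 * Complex.I * z)) :=
    h.comp (by fun_prop)
  have h2 : Differentiable ℂ fun z => eulerProd (nomeSq τ) (Complex.exp (-(2 * Complex.I * z))) :=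
    h.comp (by fun_prop)
  exact (Complex.differentiable_sin.mul h1).mul h2

lemma thetaProd_add_pi (z : ℂ) : thetaProd τ (z + Real.pi) = -thetaProd τ z := by
  have h1 : Complex.exp (2 * Complex.I * (z + Real.pi)) = Complex.exp (2 * Complex.I * z) := by
    rw [← Complex.exp_periodic (2 * Complex.I * z)]; congr 1; ring
  simp only [thetaProd, Complex.exp_neg, h1, Complex.sin_add_pi]
  ring

/-- The shift multiplies exp(2iz) by Q, so one Euler product loses its first factor and the other
gains one; the two sines account for the remaining quotient. -/
lemma thetaProd_add_pi_mul (hτ : 0 < τ.im) (z : ℂ) : thetaProd τ (z + Real.pi * τ) =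
    -Complex.exp (-Real.pi * Complex.I * τ - 2 * Complex.I * z) * thetaProd τ z := by
  have hQ := norm_nomeSq_lt_one hτ
  set Q := nomeSq τ with hQdef
  set u := Complex.exp (Complex.I * z) with hu
  set v := Complex.exp (Complex.I * (Real.pi * τ)) with hv
  have hu0 : u ≠ 0 := Complex.exp_ne_zero _
  have hv0 : v ≠ 0 := Complex.exp_ne_zero _
  have e1 : Complex.exp (2 * Complex.I * z) = u ^ 2 := by
    rw [hu, ← Complex.exp_nat_mul]; congr 1; push_cast; ring
  have e2 : Q = v ^ 2 := by
    rw [hQdef, nomeSq, hv, ← Complex.exp_nat_mul]; congr 1; push_cast; ring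
  have e3 : Complex.exp (2 * Complex.I * (z + Real.pi * τ)) = Q * u ^ 2 := by
    rw [e2, ← e1, hv, ← Complex.exp_nat_mul, ← Complex.exp_add]; congr 1; push_cast; ring
  have e4 : Complex.exp (-Real.pi * Complex.I * τ - 2 * Complex.I * z) = v⁻¹ * (u ^ 2)⁻¹ := by
    rw [hv, ← e1, ← Complex.exp_neg, ← Complex.exp_neg, ← Complex.exp_add]; congr 1; ring
  have e5 : ∀ w, Complex.sin w = (Complex.exp (Complex.I * w) - (Complex.exp (Complex.I * w))⁻¹) /
      (2 * Complex.I) := by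
    intro w
    rw [Complex.sin, ← Complex.exp_neg]
    field_simp
    rw [Complex.I_sq]
    ring_nf
  have e6 : Complex.exp (Complex.I * (z + Real.pi * τ)) = u * v := by
    rw [mul_add, Complex.exp_add]
  have f1 := eulerProd_eq_mul hQ (u ^ 2)
  have f2 := eulerProd_eq_mul hQ ((Q * u ^ 2)⁻¹)
  have hQ0 : Q ≠ 0 := by rw [e2]; positivity
  have f3 : Q * (Q * u ^ 2)⁻¹ = (u ^ 2)⁻¹ := by field_simp
  rw [f3] at f2
  simp only [thetaProd, Complex.exp_neg, e1, e3, e4, e5 (z + Real.pi * τ), e6, e5 z, ← hu,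
    ← hQdef] at *
  rw [f2, f1, e2]
  field_simp
  ring

lemma exists_lattice_of_exp_eq_one (hτ : 0 < τ.im) {n : ℤ} {z : ℂ}
    (h : nomeSq τ ^ n * Complex.exp (2 * Complex.I * z) = 1) : z ∈ (thetaPair τ hτ).lattice := by
  rw [nomeSq, ← Complex.exp_int_mul, ← Complex.exp_add, Complex.exp_eq_one_iff] at h
  obtain ⟨k, hk⟩ := h
  refine PeriodPair.mem_lattice.2 ⟨k, -n, ?_⟩
  simp only [thetaPair, periodPair]
  have h2 : (2 * Complex.I) ≠ 0 := by simp
  apply mul_left_cancel₀ h2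
  push_cast
  linear_combination -hk

lemma thetaProd_ne_zero (hτ : 0 < τ.im) {z : ℂ} (hz : z ∉ (thetaPair τ hτ).lattice) :
    thetaProd τ z ≠ 0 := by
  have hQ := norm_nomeSq_lt_one hτ
  refine mul_ne_zero (mul_ne_zero ?_ ?_) ?_
  · intro h
    obtain ⟨k, hk⟩ := Complex.sin_eq_zero_iff.1 h
    refine hz (PeriodPair.mem_lattice.2 ⟨k, 0, ?_⟩)
    simp [thetaPair, periodPair, hk]
  · refine eulerProd_ne_zero hQ fun n h => hz ?_
    exact exists_lattice_of_exp_eq_one hτ (n := n + 1) (by exact_mod_cast h)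
  · refine eulerProd_ne_zero hQ fun n h => hz ?_
    have : -z ∈ (thetaPair τ hτ).lattice :=
      exists_lattice_of_exp_eq_one hτ (n := n + 1) (by rw [mul_neg]; exact_mod_cast h)
    simpa using (thetaPair τ hτ).lattice.neg_mem this

lemma hasDerivAt_thetaProd_zero (hτ : 0 < τ.im) :
    HasDerivAt (thetaProd τ) (eulerProd (nomeSq τ) 1 ^ 2) 0 := by
  have h := differentiable_eulerProd (norm_nomeSq_lt_one hτ)
  have h1 : Differentiable ℂ fun z => eulerProd (nomeSq τ) (Complex.exp (2 * Complex.I * z)) :=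
    h.comp (by fun_prop)
  have h2 : Differentiable ℂ fun z => eulerProd (nomeSq τ) (Complex.exp (-(2 * Complex.I * z))) :=
    h.comp (by fun_prop)
  have h3 := ((Complex.hasDerivAt_sin 0).mul (h1 0).hasDerivAt).mul (h2 0).hasDerivAt
  refine h3.congr_deriv ?_
  simp
  ring

lemma eulerProd_one_ne_zero (hτ : 0 < τ.im) : eulerProd (nomeSq τ) 1 ≠ 0 :=
  eulerProd_ne_zero (norm_nomeSq_lt_one hτ)
    (pow_mul_ne_one (norm_nomeSq_lt_one hτ) (by simpa using norm_nomeSq_lt_one hτ))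

lemma differentiable_theta1 (hτ : 0 < τ.im) : Differentiable ℂ fun z => theta1 z τ := fun z =>
  (analyticAt_theta (x := (z, τ)) hτ).differentiableAt.comp z (f := fun z => (z, τ)) (by fun_prop)

/-- A Fourier coefficient: integrating exp(-is) θ₁(s, τ) over [0, π] annihilates every term except n
= 0, which is nonzero. -/
lemma exists_theta1_ne_zero (hτ : 0 < τ.im) : ∃ z, theta1 z τ ≠ 0 := by
  by_contra! h
  have h0 : ∀ z, thetaSum (z, τ) = 0 := fun z => by
    rw [← theta_eq_thetaSum (x := (z, τ)) hτ]; exact h z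
  let f : ℤ → ℝ → ℂ := fun n s => thetaCoeff n * Complex.exp (thetaExponent n (0, τ)) *
    Complex.exp (2 * n * Complex.I * s)
  have hf : ∀ (n : ℤ) (s : ℝ), f n s = Complex.exp (-(Complex.I * s)) *
      (thetaCoeff n * Complex.exp (thetaExponent n (s, τ))) := by
    intro n s
    have : Complex.exp (thetaExponent n (0, τ)) * Complex.exp (2 * n * Complex.I * s) =
        Complex.exp (-(Complex.I * s)) * Complex.exp (thetaExponent n (s, τ)) := by
      rw [← Complex.exp_add, ← Complex.exp_add, thetaExponent_apply, thetaExponent_apply]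
      congr 1; ring
    simp only [f]
    rw [mul_assoc, this]; ring
  have hsum := intervalIntegral.hasSum_intervalIntegral_of_summable_norm (a := 0) (b := Real.pi)
    (f := fun n => (⟨f n, by fun_prop⟩ : C(ℝ, ℂ))) (by
      have hs := (expSummableAt_theta (x := (0, τ)) hτ).summable.norm
      refine hs.of_nonneg_of_le (fun _ => norm_nonneg _) fun n => ?_
      refine (ContinuousMap.norm_le _ (norm_nonneg _)).2 fun s => ?_
      simp only [ContinuousMap.restrict_apply, ContinuousMap.coe_mk, f]
      rw [norm_mul (thetaCoeff n * _)]
      have : ‖Complex.exp (2 * n * Complex.I * ((s : ℝ) : ℂ))‖ = 1 := by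
        have : (2 * n * Complex.I * ((s : ℝ) : ℂ)) = ((2 * n * (s : ℝ) : ℝ) : ℂ) * Complex.I := by
          push_cast; ring
        rw [this, Complex.norm_exp_ofReal_mul_I]
      rw [this, mul_one])
  have hz : ∀ s : ℝ, ∑' n, f n s = 0 := by
    intro s
    simp only [hf, tsum_mul_left]
    have := h0 s
    rw [thetaSum] at this
    rw [this, mul_zero]
  have hint : ∀ n : ℤ, ∫ s in (0 : ℝ)..Real.pi, f n s =
      if n = 0 then Real.pi * (thetaCoeff 0 * Complex.exp (thetaExponent 0 (0, τ))) else 0 := by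
    intro n
    simp only [f]
    rw [intervalIntegral.integral_const_mul]
    split_ifs with hn
    · subst hn; simp; ring
    · have hc : (2 * n * Complex.I : ℂ) ≠ 0 := by simp [hn]
      rw [integral_exp_mul_complex hc]
      have : Complex.exp (2 * n * Complex.I * (Real.pi : ℝ)) = 1 := by
        rw [Complex.exp_eq_one_iff]; exact ⟨n, by ring⟩
      simp [this]
  simp only [ContinuousMap.coe_mk, hz, hint, intervalIntegral.integral_zero] at hsum
  have h1 := hsum.unique (hasSum_ite_eq 0 _)
  have hpi : (Real.pi : ℂ) ≠ 0 := by exact_mod_cast Real.pi_ne_zero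
  have h2 : thetaCoeff 0 ≠ 0 := by rw [← norm_ne_zero_iff, norm_thetaCoeff]; exact one_ne_zero
  exact mul_ne_zero hpi (mul_ne_zero h2 (Complex.exp_ne_zero _)) h1.symm

lemma theta1_zero (τ : ℂ) : theta1 0 τ = 0 := by
  simp [theta1]

lemma theta1_eq_zero_of_mem (hτ : 0 < τ.im) {z : ℂ} (hz : z ∈ (thetaPair τ hτ).lattice) :
    theta1 z τ = 0 := by
  classical
  -- Quasi-periodicity multiplies θ₁ by nonvanishing factors, so the indicator function of its zero
  -- set is genuinely periodic.
  have := periodic_of_generators (L := thetaPair τ hτ)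
    (f := fun z => if theta1 z τ = 0 then (0 : ℂ) else 1)
    (fun z => by simp [thetaPair, periodPair, theta_add_pi])
    (fun z => by simp [thetaPair, periodPair, theta_add_pi_mul hτ, Complex.exp_ne_zero]) hz 0
  simpa [theta1_zero] using this

/-- Both functions have the same multipliers, so the quotient is elliptic; `thetaProd` vanishes only
on the lattice and has a simple zero at 0, where θ₁ vanishes too. Hence the quotient is constant,
and the constant is nonzero because θ₁ is not identically zero. Its exact value plays no role. -/
lemma theta1_eq_mul_thetaProd (hτ : 0 < τ.im) : ∃ C : ℂ, C ≠ 0 ∧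
    ∀ z, z ∉ (thetaPair τ hτ).lattice → theta1 z τ = C * thetaProd τ z := by
  set L := thetaPair τ hτ with hL
  have hB := eulerProd_one_ne_zero hτ
  have hΦ := differentiable_thetaProd hτ
  have hθ := differentiable_theta1 hτ
  set D := deriv (fun z => theta1 z τ) 0 with hD
  have hlim : Filter.Tendsto (fun z => theta1 z τ / thetaProd τ z) (𝓝[≠] 0)
      (𝓝 (D / eulerProd (nomeSq τ) 1 ^ 2)) := by
    have h1 := (hθ 0).hasDerivAt.tendsto_slope
    have h2 := (hasDerivAt_thetaProd_zero hτ).tendsto_slope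
    refine (h1.div h2 (pow_ne_zero 2 hB)).congr' ?_
    filter_upwards [self_mem_nhdsWithin] with z (hz : z ≠ 0)
    have h3 : thetaProd τ 0 = 0 := by simp [thetaProd]
    simp only [Pi.div_apply, slope_def_field, theta1_zero, h3, sub_zero]
    field_simp
  have key : ∀ z ∉ L.lattice, theta1 z τ / thetaProd τ z = D / eulerProd (nomeSq τ) 1 ^ 2 := by
    intro z hz
    refine eq_const_of_periodic (L := L) (f := fun z => theta1 z τ / thetaProd τ z) ?_ ?_ hlim hz
    · intro z _ ω hω
      refine periodic_of_generators (L := L) (f := fun z => theta1 z τ / thetaProd τ z)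
        (fun z => ?_) (fun z => ?_) hω z
      · simp only [hL, thetaPair, periodPair, theta_add_pi, thetaProd_add_pi, neg_div_neg_eq]
      · simp only [hL, thetaPair, periodPair, theta_add_pi_mul hτ, thetaProd_add_pi_mul hτ]
        exact mul_div_mul_left _ _ (neg_ne_zero.2 (Complex.exp_ne_zero _))
    · intro z hz
      exact (hθ z).div (hΦ z) (thetaProd_ne_zero hτ hz)
  refine ⟨D / eulerProd (nomeSq τ) 1 ^ 2, ?_, fun z hz => ?_⟩
  · intro h
    obtain ⟨z, hz⟩ := exists_theta1_ne_zero hτ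
    have hzL : z ∉ L.lattice := fun h => hz (theta1_eq_zero_of_mem hτ h)
    have := key z hzL
    rw [h, div_eq_zero_iff] at this
    exact this.elim hz (thetaProd_ne_zero hτ hzL)
  · rw [← key z hz, div_mul_cancel₀ _ (thetaProd_ne_zero hτ hz)]

theorem theta1_eq_zero_iff (hτ : 0 < τ.im) (z : ℂ) :
    theta1 z τ = 0 ↔ z ∈ (thetaPair τ hτ).lattice := by
  refine ⟨fun h => ?_, theta1_eq_zero_of_mem hτ⟩
  by_contra hz
  obtain ⟨C, hC, h1⟩ := theta1_eq_mul_thetaProd hτ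
  rw [h1 z hz] at h
  exact mul_ne_zero hC (thetaProd_ne_zero hτ hz) h

end Product

/-! ### The second logarithmic derivative of the theta function and `℘` -/

lemma periodic_of_generators_off_lattice {L : PeriodPair} {f : ℂ → ℂ}
    (h₁ : ∀ z ∉ L.lattice, f (z + L.ω₁) = f z) (h₂ : ∀ z ∉ L.lattice, f (z + L.ω₂) = f z)
    {ω : ℂ} (hω : ω ∈ L.lattice) {z : ℂ} (hz : z ∉ L.lattice) : f (z + ω) = f z := by
  classical
  have hmem : ∀ {z ω}, ω ∈ L.lattice → (z + ω ∈ L.lattice ↔ z ∈ L.lattice) := fun h =>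
    ⟨fun h' => by simpa using L.lattice.sub_mem h' h, fun h' => L.lattice.add_mem h' h⟩
  have := periodic_of_generators (L := L) (f := fun z => if z ∈ L.lattice then 0 else f z)
    (fun z => by
      simp only [hmem L.ω₁_mem_lattice]
      split_ifs with h
      exacts [rfl, h₁ z h])
    (fun z => by
      simp only [hmem L.ω₂_mem_lattice]
      split_ifs with h
      exacts [rfl, h₂ z h]) hω z
  simpa [hmem hω, hz] using this

lemma norm_sin_sub_le {z : ℂ} (hz : ‖z‖ ≤ 1) : ‖Complex.sin z - (z - z ^ 3 / 6)‖ ≤ ‖z‖ ^ 4 := by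
  have h1 := Complex.exp_bound (x := z * Complex.I) (by simpa using hz) (n := 4) (by norm_num)
  have h2 := Complex.exp_bound (x := -z * Complex.I) (by simpa using hz) (n := 4) (by norm_num)
  simp only [Finset.sum_range_succ, Finset.sum_range_zero, Nat.factorial, norm_mul, norm_neg,
    Complex.norm_I, mul_one] at h1 h2
  have e : Complex.sin z - (z - z ^ 3 / 6) =
      ((Complex.exp (-z * Complex.I) - (0 + (-z * Complex.I) ^ 0 / ((1 : ℕ) : ℂ) +
        (-z * Complex.I) ^ 1 / (((0 + 1) * 1 : ℕ) : ℂ) +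
        (-z * Complex.I) ^ 2 / (((1 + 1) * ((0 + 1) * 1) : ℕ) : ℂ) +
        (-z * Complex.I) ^ 3 / (((2 + 1) * ((1 + 1) * ((0 + 1) * 1)) : ℕ) : ℂ))) -
      (Complex.exp (z * Complex.I) - (0 + (z * Complex.I) ^ 0 / ((1 : ℕ) : ℂ) +
        (z * Complex.I) ^ 1 / (((0 + 1) * 1 : ℕ) : ℂ) +
        (z * Complex.I) ^ 2 / (((1 + 1) * ((0 + 1) * 1) : ℕ) : ℂ) +
        (z * Complex.I) ^ 3 / (((2 + 1) * ((1 + 1) * ((0 + 1) * 1)) : ℕ) : ℂ)))) *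
        (Complex.I / 2) := by
    rw [Complex.sin]
    push_cast
    ring_nf
    rw [show Complex.I ^ 4 = 1 from Complex.I_pow_four, Complex.I_sq]
    ring
  rw [e, norm_mul]
  have h3 : ‖Complex.I / 2‖ = 1 / 2 := by simp
  rw [h3]
  have h4 := norm_sub_le (Complex.exp (-z * Complex.I) - (0 + (-z * Complex.I) ^ 0 / ((1 : ℕ) : ℂ) +
        (-z * Complex.I) ^ 1 / (((0 + 1) * 1 : ℕ) : ℂ) +
        (-z * Complex.I) ^ 2 / (((1 + 1) * ((0 + 1) * 1) : ℕ) : ℂ) +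
        (-z * Complex.I) ^ 3 / (((2 + 1) * ((1 + 1) * ((0 + 1) * 1)) : ℕ) : ℂ)))
      (Complex.exp (z * Complex.I) - (0 + (z * Complex.I) ^ 0 / ((1 : ℕ) : ℂ) +
        (z * Complex.I) ^ 1 / (((0 + 1) * 1 : ℕ) : ℂ) +
        (z * Complex.I) ^ 2 / (((1 + 1) * ((0 + 1) * 1) : ℕ) : ℂ) +
        (z * Complex.I) ^ 3 / (((2 + 1) * ((1 + 1) * ((0 + 1) * 1)) : ℕ) : ℂ)))
  have h5 : ‖z‖ ^ 4 * (((3 + 1 + 1 : ℕ) : ℝ) *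
      (((3 + 1) * ((2 + 1) * ((1 + 1) * ((0 + 1) * 1))) : ℕ) * ((4 : ℕ) : ℝ))⁻¹) ≤ ‖z‖ ^ 4 := by
    refine mul_le_of_le_one_right (by positivity) (by norm_num)
  norm_num at h1 h2 h4 h5 ⊢
  linarith

/-- Write sin z = z S with S = 1 + z² q and q → -1/6. The difference is then q (S + 1)/S². -/
lemma tendsto_inv_sq_sub_inv_sin_sq :
    Filter.Tendsto (fun z : ℂ => 1 / z ^ 2 - 1 / Complex.sin z ^ 2) (𝓝[≠] 0) (𝓝 (-1 / 3)) := by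
  have hid : Filter.Tendsto (fun z : ℂ => z) (𝓝[≠] 0) (𝓝 0) :=
    Filter.tendsto_id.mono_left nhdsWithin_le_nhds
  have hr : Filter.Tendsto (fun z : ℂ => (Complex.sin z - (z - z ^ 3 / 6)) / z ^ 3) (𝓝[≠] 0)
      (𝓝 0) := by
    refine squeeze_zero_norm' ?_ (hid.norm.trans (by simp))
    have h1 : ∀ᶠ z : ℂ in 𝓝[≠] 0, ‖z‖ ≤ 1 := by
      have := hid.norm
      rw [norm_zero] at this
      exact this.eventually_le_const one_pos
    filter_upwards [self_mem_nhdsWithin, h1] with z (hz : z ≠ 0) hz1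
    rw [norm_div, norm_pow, div_le_iff₀ (by positivity), ← pow_succ']
    exact norm_sin_sub_le hz1
  have hS : Filter.Tendsto (fun z : ℂ => 1 + z ^ 2 * (-1 / 6 +
      (Complex.sin z - (z - z ^ 3 / 6)) / z ^ 3)) (𝓝[≠] 0) (𝓝 1) := by
    have := ((hid.pow 2).mul (hr.const_add (-1 / 6))).const_add 1
    simpa using this
  have h2 := ((hr.const_add (-1 / 6)).mul (hS.add_const 1)).div (hS.pow 2) (by norm_num)
  have h3 : ((-1 / 6 + 0) * (1 + 1) / 1 ^ 2 : ℂ) = -1 / 3 := by norm_num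
  rw [h3] at h2
  refine h2.congr' ?_
  have hS0 := hS.eventually_ne one_ne_zero
  filter_upwards [self_mem_nhdsWithin, hS0] with z (hz : z ≠ 0) h0
  have hS' : 1 + z ^ 2 * (-1 / 6 + (Complex.sin z - (z - z ^ 3 / 6)) / z ^ 3) =
      Complex.sin z / z := by
    field_simp; ring
  simp only [Pi.div_apply]
  rw [hS'] at h0 ⊢
  have hs : Complex.sin z ≠ 0 := fun h => h0 (by rw [h, zero_div])
  field_simp
  ring

section

variable {τ : ℂ}

/-- The logarithmic derivative `∂_z log θ₁(z, τ)`. -/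
def gTheta (z τ : ℂ) : ℂ := logDeriv (fun z => theta1 z τ) z

/-- `w ∂_w log ∏ (1 - Q^n w)`. -/
def eulerLog (Q w : ℂ) : ℂ := w * logDeriv (eulerProd Q) w

lemma gTheta_eq_sum (hτ : 0 < τ.im) {z : ℂ} (hz : z ∉ (thetaPair τ hτ).lattice) :
    gTheta z τ = Complex.cos z / Complex.sin z + 2 * Complex.I *
      (eulerLog (nomeSq τ) (Complex.exp (2 * Complex.I * z)) -
        eulerLog (nomeSq τ) (Complex.exp (-(2 * Complex.I * z)))) := by
  obtain ⟨C, hC, h⟩ := theta1_eq_mul_thetaProd hτ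
  have hd := differentiable_eulerProd (norm_nomeSq_lt_one hτ)
  have h1 : (fun z => theta1 z τ) =ᶠ[𝓝 z] fun z => C * thetaProd τ z := by
    filter_upwards [compl_lattice_mem_nhds hz] with w hw using h w hw
  have hne := thetaProd_ne_zero hτ hz
  rw [thetaProd] at hne
  have hs := left_ne_zero_of_mul (left_ne_zero_of_mul hne)
  have hb1 := right_ne_zero_of_mul (left_ne_zero_of_mul hne)
  have hb2 := right_ne_zero_of_mul hne
  have c1 : HasDerivAt (fun z => Complex.exp (2 * Complex.I * z))
      (Complex.exp (2 * Complex.I * z) * (2 * Complex.I)) z := by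
    simpa using ((hasDerivAt_id z).const_mul (2 * Complex.I)).cexp
  have c2 : HasDerivAt (fun z => Complex.exp (-(2 * Complex.I * z)))
      (Complex.exp (-(2 * Complex.I * z)) * (-(2 * Complex.I))) z := by
    simpa using ((hasDerivAt_id z).const_mul (2 * Complex.I)).fun_neg.cexp
  have d1 := (hd _).hasDerivAt.comp z c1
  have d2 := (hd _).hasDerivAt.comp z c2
  have d := ((Complex.hasDerivAt_sin z).mul d1).mul d2
  rw [gTheta, (logDeriv_congr_nhds h1).eq_of_nhds, logDeriv_const_mul z C hC, logDeriv_apply]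
  have d' : deriv (thetaProd τ) z = _ := d.deriv
  rw [d']
  simp only [thetaProd, eulerLog, logDeriv_apply, Function.comp_apply, Pi.mul_apply]
  field_simp
  ring

lemma hasDerivAt_eulerLog (hτ : 0 < τ.im) :
    HasDerivAt (eulerLog (nomeSq τ)) (-lambert (nomeSq τ)) 1 :=
  hasDerivAt_mul_logDeriv_eulerProd (norm_nomeSq_lt_one hτ)

lemma analyticAt_eulerLog (hτ : 0 < τ.im) : AnalyticAt ℂ (eulerLog (nomeSq τ)) 1 := by
  have hd := (differentiable_eulerProd (norm_nomeSq_lt_one hτ)).analyticAt 1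
  have := hd.deriv.div hd (eulerProd_one_ne_zero hτ)
  exact analyticAt_id.mul this

/-- The cotangent in the expansion of g contributes -1/3 to the limit, and the Euler products
contribute 8 times the Lambert series; together these are -E₂/3. -/
lemma tendsto_deriv_gTheta (hτ : 0 < τ.im) :
    Filter.Tendsto (fun z => deriv (fun z => gTheta z τ) z + 1 / z ^ 2) (𝓝[≠] 0)
      (𝓝 (-EisensteinSeries.E2 (UpperHalfPlane.ofComplex τ) / 3)) := by
  set R : ℂ → ℂ := fun z => 2 * Complex.I *
      (eulerLog (nomeSq τ) (Complex.exp (2 * Complex.I * z)) -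
        eulerLog (nomeSq τ) (Complex.exp (-(2 * Complex.I * z)))) with hR
  have hRan : AnalyticAt ℂ R 0 := by
    have h1 := analyticAt_eulerLog hτ
    have h2 : AnalyticAt ℂ (fun z => eulerLog (nomeSq τ) (Complex.exp (2 * Complex.I * z))) 0 :=
      AnalyticAt.fun_comp (by simpa using h1) (by fun_prop)
    have h3 : AnalyticAt ℂ (fun z => eulerLog (nomeSq τ) (Complex.exp (-(2 * Complex.I * z)))) 0 :=
      AnalyticAt.fun_comp (by simpa using h1) (by fun_prop)
    exact analyticAt_const.mul (h2.sub h3)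
  have hR0 : deriv R 0 = 8 * lambert (nomeSq τ) := by
    have h1 := hasDerivAt_eulerLog hτ
    have c1 : HasDerivAt (fun z => Complex.exp (2 * Complex.I * z)) (2 * Complex.I) 0 := by
      simpa using ((hasDerivAt_id (0 : ℂ)).const_mul (2 * Complex.I)).cexp
    have c2 : HasDerivAt (fun z => Complex.exp (-(2 * Complex.I * z))) (-(2 * Complex.I)) 0 := by
      simpa using ((hasDerivAt_id (0 : ℂ)).const_mul (2 * Complex.I)).fun_neg.cexp
    have d1 := HasDerivAt.comp (0 : ℂ) (h₂ := eulerLog (nomeSq τ)) (h₂' := -lambert (nomeSq τ))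
      (by simpa using h1) c1
    have d2 := HasDerivAt.comp (0 : ℂ) (h₂ := eulerLog (nomeSq τ)) (h₂' := -lambert (nomeSq τ))
      (by simpa using h1) c2
    have d := (d1.sub d2).const_mul (2 * Complex.I)
    rw [show deriv R 0 = _ from d.deriv]
    linear_combination (-8 * lambert (nomeSq τ)) * Complex.I_sq
  have hlim := tendsto_inv_sq_sub_inv_sin_sq.add
    (hRan.deriv.continuousAt.tendsto.mono_left (nhdsWithin_le_nhds (s := {0}ᶜ)))
  have hval : -1 / 3 + deriv R 0 =
      -EisensteinSeries.E2 (UpperHalfPlane.ofComplex τ) / 3 := by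
    rw [hR0, E2_eq_lambert hτ, nomeSq]; ring
  rw [hval] at hlim
  refine hlim.congr' ?_
  have hR1 : ∀ᶠ z in 𝓝[≠] (0 : ℂ), DifferentiableAt ℂ R z :=
    (hRan.eventually_analyticAt.mono fun _ h => h.differentiableAt).filter_mono nhdsWithin_le_nhds
  filter_upwards [hR1, eventually_notMem_lattice (thetaPair τ hτ)] with z hz hzL
  have hsin : Complex.sin z ≠ 0 := by
    have := thetaProd_ne_zero hτ hzL
    rw [thetaProd] at this
    exact left_ne_zero_of_mul (left_ne_zero_of_mul this)
  have h1 : (fun z => gTheta z τ) =ᶠ[𝓝 z] fun z => Complex.cos z / Complex.sin z + R z := by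
    filter_upwards [compl_lattice_mem_nhds hzL] with w hw using gTheta_eq_sum hτ hw
  rw [h1.deriv_eq]
  have h2 := ((Complex.hasDerivAt_cos z).fun_div (Complex.hasDerivAt_sin z) hsin).fun_add
    hz.hasDerivAt
  rw [h2.deriv]
  have h3 := Complex.sin_sq_add_cos_sq z
  have h4 : (-Complex.sin z * Complex.sin z - Complex.cos z * Complex.cos z) =
      -1 := by linear_combination -h3
  rw [h4]
  ring

lemma gTheta_add_pi (z τ : ℂ) : gTheta (z + Real.pi) τ = gTheta z τ := by
  simp only [gTheta, logDeriv_apply, theta_add_pi]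
  rw [← deriv_comp_add_const]
  simp only [theta_add_pi, deriv.fun_neg, neg_div_neg_eq]

lemma gTheta_add_pi_mul (hτ : 0 < τ.im) {z : ℂ} (hz : z ∉ (thetaPair τ hτ).lattice) :
    gTheta (z + Real.pi * τ) τ = gTheta z τ - 2 * Complex.I := by
  have h0 : theta1 z τ ≠ 0 := fun h => hz ((theta1_eq_zero_iff hτ z).1 h)
  have hd := (differentiable_theta1 hτ z).hasDerivAt
  have c1 : HasDerivAt (fun z => -Complex.exp (-Real.pi * Complex.I * τ - 2 * Complex.I * z))
      (-(Complex.exp (-Real.pi * Complex.I * τ - 2 * Complex.I * z) * (-(2 * Complex.I)))) z := by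
    simpa using (((hasDerivAt_id z).const_mul (2 * Complex.I)).const_sub
      (-Real.pi * Complex.I * τ)).cexp.fun_neg
  simp only [gTheta, logDeriv_apply, theta_add_pi_mul hτ]
  rw [← deriv_comp_add_const]
  simp only [theta_add_pi_mul hτ]
  rw [(c1.fun_mul hd).deriv]
  have := Complex.exp_ne_zero (-Real.pi * Complex.I * τ - 2 * Complex.I * z)
  field_simp
  ring

lemma analyticAt_gTheta (hτ : 0 < τ.im) {z : ℂ} (hz : z ∉ (thetaPair τ hτ).lattice) :
    AnalyticAt ℂ (fun z => gTheta z τ) z := by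
  have hd := (differentiable_theta1 hτ).analyticAt z
  exact hd.deriv.div hd fun h => hz ((theta1_eq_zero_iff hτ z).1 h)

/-- Under z ↦ z + πτ the function g changes by the constant -2i, so its derivative is elliptic.
Adding ℘ cancels the double pole, and the limit at 0 determines the constant. -/
theorem deriv_gTheta (hτ : 0 < τ.im) {z : ℂ} (hz : z ∉ (thetaPair τ hτ).lattice) :
    deriv (fun z => gTheta z τ) z = -(thetaPair τ hτ).weierstrassP z -
      EisensteinSeries.E2 (UpperHalfPlane.ofComplex τ) / 3 := by
  set L := thetaPair τ hτ with hL
  have hlim : Filter.Tendsto (fun z => deriv (fun z => gTheta z τ) z + L.weierstrassP z) (𝓝[≠] 0)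
      (𝓝 (-EisensteinSeries.E2 (UpperHalfPlane.ofComplex τ) / 3)) := by
    have h1 := (L.analyticAt_weierstrassPExcept 0).continuousAt.tendsto.mono_left
      (nhdsWithin_le_nhds (s := {0}ᶜ))
    rw [L.weierstrassPExcept_zero] at h1
    have h2 := (tendsto_deriv_gTheta hτ).add h1
    rw [add_zero] at h2
    refine h2.congr fun z => ?_
    have := L.weierstrassPExcept_def 0 z
    simp only [ZeroMemClass.coe_zero, sub_zero] at this
    rw [this]
    ring
  have := eq_const_of_periodic (L := L)
    (f := fun z => deriv (fun z => gTheta z τ) z + L.weierstrassP z) ?_ ?_ hlim hz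
  · linear_combination this
  · intro z hz ω hω
    have h1 := L.periodic_weierstrassP ⟨ω, hω⟩ z
    simp only at h1
    simp only [h1, add_left_inj]
    refine periodic_of_generators_off_lattice (L := L)
      (f := deriv (fun z => gTheta z τ)) (fun z hz => ?_) (fun z hz => ?_) hω hz
    · simp only [hL, thetaPair, periodPair]
      rw [← deriv_comp_add_const]
      simp only [gTheta_add_pi]
    · simp only [hL, thetaPair, periodPair]
      rw [← deriv_comp_add_const]
      have : (fun z => gTheta (z + Real.pi * τ) τ) =ᶠ[𝓝 z] fun z => gTheta z τ - 2 * Complex.I := by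
        filter_upwards [compl_lattice_mem_nhds hz] with w hw using gTheta_add_pi_mul hτ hw
      rw [this.deriv_eq, deriv_sub_const]
  · intro z hz
    exact (analyticAt_gTheta hτ hz).deriv.differentiableAt.add
      (L.analyticOnNhd_weierstrassP z hz).differentiableAt

end

/-! ### Factorisation of `℘(z) - ℘(a)` -/

section Factorisation

variable {τ : ℂ}

lemma deriv_theta1_zero_ne_zero (hτ : 0 < τ.im) : deriv (fun z => theta1 z τ) 0 ≠ 0 := by
  obtain ⟨C, hC, h⟩ := theta1_eq_mul_thetaProd hτ
  have h1 : (fun z => theta1 z τ) =ᶠ[𝓝 0] fun z => C * thetaProd τ z := by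
    have := eventually_nhdsWithin_iff.1 (eventually_notMem_lattice (thetaPair τ hτ))
    filter_upwards [this] with z hz
    by_cases h0 : z = 0
    · subst h0; simp [theta1_zero, thetaProd]
    · exact h z (hz h0)
  rw [h1.deriv_eq, ((hasDerivAt_thetaProd_zero hτ).const_mul C).deriv]
  exact mul_ne_zero hC (pow_ne_zero 2 (eulerProd_one_ne_zero hτ))

/-- Evenness forces N'(0) = 0, so a zero at the origin has order at least two. -/
lemma tendsto_div_sq_of_even {N : ℂ → ℂ} (hN : AnalyticAt ℂ N 0) (heven : ∀ z, N (-z) = N z)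
    (h0 : N 0 = 0) : ∃ c, Filter.Tendsto (fun z => N z / z ^ 2) (𝓝[≠] 0) (𝓝 c) := by
  have hd : deriv N 0 = 0 := by
    have h1 : deriv (fun z => N (-z)) 0 = -deriv N (-0) := deriv_comp_neg N 0
    simp only [heven, neg_zero] at h1
    exact self_eq_neg.1 h1
  obtain ⟨p, hp⟩ := hN
  have hs : AnalyticAt ℂ (dslope N 0) 0 := hp.has_fpower_series_dslope_fslope.analyticAt
  refine ⟨deriv (dslope N 0) 0, ?_⟩
  refine hs.differentiableAt.hasDerivAt.tendsto_slope.congr' ?_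
  filter_upwards [self_mem_nhdsWithin] with z (hz : z ≠ 0)
  rw [slope_def_field, dslope_same, hd, dslope_of_ne _ hz, slope_def_field, h0]
  simp only [sub_zero]
  field_simp

/-- The quotient θ(z - a)θ(z + a)/θ(z)² is elliptic with a double pole at 0. The constant K is
chosen so that adding K(℘(z) - ℘(a)) cancels the z⁻² term, and evenness excludes a z⁻¹ term; what
remains is constant. -/
theorem weierstrassP_sub_mul_theta (hτ : 0 < τ.im) {z a : ℂ}
    (hz : z ∉ (thetaPair τ hτ).lattice) (ha : a ∉ (thetaPair τ hτ).lattice) :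
    theta1 a τ ^ 2 * ((thetaPair τ hτ).weierstrassP z - (thetaPair τ hτ).weierstrassP a) *
      theta1 z τ ^ 2 =
    -deriv (fun z => theta1 z τ) 0 ^ 2 * (theta1 (z - a) τ * theta1 (z + a) τ) := by
  set L := thetaPair τ hτ with hL
  set D := deriv (fun z => theta1 z τ) 0 with hD
  have hD0 : D ≠ 0 := deriv_theta1_zero_ne_zero hτ
  have hθd := differentiable_theta1 hτ
  have hθ0 : ∀ {z}, z ∉ L.lattice → theta1 z τ ≠ 0 := fun hz h => hz ((theta1_eq_zero_iff hτ _).1 h)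
  set K := theta1 a τ ^ 2 / D ^ 2 with hK
  set f : ℂ → ℂ := fun z => theta1 (z - a) τ * theta1 (z + a) τ / theta1 z τ ^ 2 +
    K * (L.weierstrassP z - L.weierstrassP a) with hf
  have hA : Differentiable ℂ fun z => theta1 (z - a) τ * theta1 (z + a) τ :=
    (hθd.comp (f := fun z => z - a) (by fun_prop)).mul
      (hθd.comp (f := fun z => z + a) (by fun_prop))
  set u := dslope (fun z => theta1 z τ) 0 with hu
  have hu0 : u 0 = D := dslope_same _ _
  have huz : ∀ z ≠ 0, u z = theta1 z τ / z := fun z hz => by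
    rw [hu, dslope_of_ne _ hz, slope_def_field]; simp [theta1_zero]
  have huan : AnalyticAt ℂ u 0 := by
    obtain ⟨p, hp⟩ := hθd.analyticAt 0
    exact hp.has_fpower_series_dslope_fslope.analyticAt
  set N : ℂ → ℂ := fun z => theta1 (z - a) τ * theta1 (z + a) τ / u z ^ 2 +
    K * (1 + z ^ 2 * (L.weierstrassPExcept 0 z - L.weierstrassP a)) with hN
  have hNan : AnalyticAt ℂ N 0 := by
    have h1 := (hA.analyticAt 0).div (huan.pow 2) (by simpa [hu0] using hD0)
    have h2 := L.analyticAt_weierstrassPExcept 0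
    refine h1.add ?_
    fun_prop
  have hNeven : ∀ z, N (-z) = N z := by
    intro z
    have e1 : theta1 (-z - a) τ = -theta1 (z + a) τ := by
      rw [← theta_neg]; congr 1; ring
    have e2 : theta1 (-z + a) τ = -theta1 (z - a) τ := by
      rw [← theta_neg]; congr 1; ring
    have e3 : u (-z) = u z := by
      by_cases h : z = 0
      · simp [h]
      · rw [huz _ (neg_ne_zero.2 h), huz _ h, theta_neg, neg_div_neg_eq]
    have e4 : L.weierstrassPExcept 0 (-z) = L.weierstrassPExcept 0 z := by
      rw [L.weierstrassPExcept_neg, neg_zero]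
    simp only [hN, e1, e2, e3, e4]
    ring
  have hN0 : N 0 = 0 := by
    simp only [hN, hu0, zero_sub, zero_add, theta_neg, hK]
    field_simp
    ring
  obtain ⟨c, hc⟩ := tendsto_div_sq_of_even hNan hNeven hN0
  have hlim : Filter.Tendsto f (𝓝[≠] 0) (𝓝 c) := by
    refine hc.congr' ?_
    filter_upwards [self_mem_nhdsWithin, eventually_notMem_lattice L] with z (hz : z ≠ 0) hzL
    have hθz := hθ0 hzL
    have h1 := L.weierstrassPExcept_def 0 z
    simp only [ZeroMemClass.coe_zero, sub_zero] at h1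
    simp only [hN, hf, huz z hz, h1]
    field_simp
    ring
  have hconst : ∀ z ∉ L.lattice, f z = c := by
    intro z hz
    refine eq_const_of_periodic (L := L) ?_ ?_ hlim hz
    · intro z _ ω hω
      have h1 := L.periodic_weierstrassP ⟨ω, hω⟩ z
      simp only at h1
      simp only [hf, h1, add_left_inj]
      refine periodic_of_generators (L := L)
        (f := fun z => theta1 (z - a) τ * theta1 (z + a) τ / theta1 z τ ^ 2)
        (fun z => ?_) (fun z => ?_) hω z
      · simp only [hL, thetaPair, periodPair, add_sub_right_comm, add_right_comm z,
          theta_add_pi]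
        ring
      · simp only [hL, thetaPair, periodPair, add_sub_right_comm, add_right_comm z,
          theta_add_pi_mul hτ]
        have e : Complex.exp (-Real.pi * Complex.I * τ - 2 * Complex.I * (z - a)) *
            Complex.exp (-Real.pi * Complex.I * τ - 2 * Complex.I * (z + a)) =
            Complex.exp (-Real.pi * Complex.I * τ - 2 * Complex.I * z) ^ 2 := by
          rw [← Complex.exp_add, ← Complex.exp_nat_mul]; congr 1; push_cast; ring
        have e0 := Complex.exp_ne_zero (-Real.pi * Complex.I * τ - 2 * Complex.I * z)
        rw [mul_pow, neg_sq, ← mul_div_mul_left (theta1 (z - a) τ * theta1 (z + a) τ) _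
          (pow_ne_zero 2 e0), ← e]
        congr 1
        ring
    · intro z hz
      have h1 := (hA z).div ((hθd z).pow 2) (pow_ne_zero 2 (hθ0 hz))
      have h2 := (L.analyticOnNhd_weierstrassP z hz).differentiableAt
      exact h1.add ((h2.sub_const _).const_mul K)
  -- At z = a both summands of `f` vanish.
  have hc0 : c = 0 := by
    rw [← hconst a ha]
    simp [hf, theta1_zero]
  have := hconst z hz
  have hθz := hθ0 hz
  rw [hc0] at this
  simp only [hf, hK] at this
  field_simp at this
  linear_combination this

lemma weierstrassP_eq_iff (hτ : 0 < τ.im) {z a : ℂ}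
    (hz : z ∉ (thetaPair τ hτ).lattice) (ha : a ∉ (thetaPair τ hτ).lattice) :
    (thetaPair τ hτ).weierstrassP z = (thetaPair τ hτ).weierstrassP a ↔
      z - a ∈ (thetaPair τ hτ).lattice ∨ z + a ∈ (thetaPair τ hτ).lattice := by
  have h := weierstrassP_sub_mul_theta hτ hz ha
  have hD0 := deriv_theta1_zero_ne_zero hτ
  have h1 : theta1 z τ ≠ 0 := fun h => hz ((theta1_eq_zero_iff hτ _).1 h)
  have h2 : theta1 a τ ≠ 0 := fun h => ha ((theta1_eq_zero_iff hτ _).1 h)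
  rw [← theta1_eq_zero_iff, ← theta1_eq_zero_iff, ← mul_eq_zero, ← sub_eq_zero]
  constructor
  · intro h3
    rw [h3, mul_zero, zero_mul] at h
    exact (mul_eq_zero.1 h.symm).resolve_left (by simpa using hD0)
  · intro h3
    rw [h3, mul_zero] at h
    simpa [h1, h2] using h

/-- Differentiating the factorisation at z = a gives θ(a)⁴ ℘'(a) = -θ'(0)³ θ(2a). -/
lemma derivWeierstrassP_eq_zero_iff (hτ : 0 < τ.im) {a : ℂ} (ha : a ∉ (thetaPair τ hτ).lattice) :
    (thetaPair τ hτ).derivWeierstrassP a = 0 ↔ 2 * a ∈ (thetaPair τ hτ).lattice := by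
  set L := thetaPair τ hτ with hL
  have hθd := differentiable_theta1 hτ
  have hD0 := deriv_theta1_zero_ne_zero hτ
  have h2 : theta1 a τ ≠ 0 := fun h => ha ((theta1_eq_zero_iff hτ _).1 h)
  have hP : HasDerivAt L.weierstrassP (L.derivWeierstrassP a) a := by
    rw [← L.deriv_weierstrassP]
    exact (L.analyticOnNhd_weierstrassP a ha).differentiableAt.hasDerivAt
  have d1 := ((hP.sub_const (L.weierstrassP a)).const_mul (theta1 a τ ^ 2)).mul
    ((hθd a).hasDerivAt.pow 2)
  have hm : HasDerivAt (fun z => theta1 (z - a) τ) (deriv (fun z => theta1 z τ) 0) a := by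
    have := HasDerivAt.comp_sub_const a a (f := fun z => theta1 z τ)
      (f' := deriv (fun z => theta1 z τ) 0) (by rw [sub_self]; exact (hθd 0).hasDerivAt)
    exact this
  have hp : HasDerivAt (fun z => theta1 (z + a) τ) (deriv (fun z => theta1 z τ) (a + a)) a :=
    HasDerivAt.comp_add_const a a (f := fun z => theta1 z τ) (hθd (a + a)).hasDerivAt
  have d2 := (hm.mul hp).const_mul (-deriv (fun z => theta1 z τ) 0 ^ 2)
  have heq : (fun z => theta1 a τ ^ 2 * (L.weierstrassP z - L.weierstrassP a) *
      theta1 z τ ^ 2) =ᶠ[𝓝 a] fun z =>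
      -deriv (fun z => theta1 z τ) 0 ^ 2 * (theta1 (z - a) τ * theta1 (z + a) τ) := by
    filter_upwards [compl_lattice_mem_nhds ha] with z hz
    exact weierstrassP_sub_mul_theta hτ hz ha
  have h3 := (d1.congr_of_eventuallyEq heq.symm).unique d2
  simp only [sub_self, theta1_zero, mul_zero, zero_mul, add_zero, ← two_mul, Pi.pow_apply] at h3
  rw [← theta1_eq_zero_iff hτ]
  constructor
  · intro h
    rw [h] at h3
    simpa [hD0] using h3.symm
  · intro h
    rw [h] at h3
    simpa [h2] using h3

end Factorisation

/-! ### The differential equation and the half periods -/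

section HalfPeriods

variable {τ : ℂ}

/-- Differentiate the cubic equation and cancel 2℘'. The zeros of ℘' are isolated, so the identity
extends to them by continuity. -/
lemma deriv_derivWeierstrassP (hτ : 0 < τ.im) {z : ℂ} (hz : z ∉ (thetaPair τ hτ).lattice) :
    deriv (thetaPair τ hτ).derivWeierstrassP z =
      6 * (thetaPair τ hτ).weierstrassP z ^ 2 - (thetaPair τ hτ).g₂ / 2 := by
  set L := thetaPair τ hτ with hL
  have hP : ∀ z ∉ L.lattice, HasDerivAt L.weierstrassP (L.derivWeierstrassP z) z := by
    intro z hz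
    rw [← L.deriv_weierstrassP]
    exact (L.analyticOnNhd_weierstrassP z hz).differentiableAt.hasDerivAt
  have hP' : ∀ z ∉ L.lattice, HasDerivAt L.derivWeierstrassP (deriv L.derivWeierstrassP z) z :=
    fun z hz => (L.analyticOnNhd_derivWeierstrassP z hz).differentiableAt.hasDerivAt
  have h1 : ∀ z ∉ L.lattice, L.derivWeierstrassP z ≠ 0 → deriv L.derivWeierstrassP z =
      6 * L.weierstrassP z ^ 2 - L.g₂ / 2 := by
    intro z hz h0
    have d1 := (hP' z hz).pow 2
    have d2 := ((((hP z hz).pow 3).const_mul 4).sub ((hP z hz).const_mul L.g₂)).sub_const L.g₃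
    have heq : (fun z => L.derivWeierstrassP z ^ 2) =ᶠ[𝓝 z] fun z =>
        4 * L.weierstrassP z ^ 3 - L.g₂ * L.weierstrassP z - L.g₃ := by
      filter_upwards [compl_lattice_mem_nhds hz] with w hw using L.derivWeierstrassP_sq w hw
    have h3 := (d1.congr_of_eventuallyEq heq.symm).unique d2
    norm_num at h3
    apply mul_left_cancel₀ (mul_ne_zero two_ne_zero h0)
    linear_combination h3
  have hne : ∀ᶠ w in 𝓝[≠] z, L.derivWeierstrassP w ≠ 0 := by
    have h2 := L.compl_lattice_sdiff_singleton_mem_nhds (2 * z)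
    have h3 : Filter.Tendsto (fun w : ℂ => 2 * w) (𝓝 z) (𝓝 (2 * z)) :=
      (continuous_const.mul continuous_id).tendsto z
    rw [eventually_nhdsWithin_iff]
    filter_upwards [h3 h2, compl_lattice_mem_nhds hz] with w hw hwL hwz h0
    exact hw ⟨(derivWeierstrassP_eq_zero_iff hτ hwL).1 h0, fun h => hwz (by simpa using h)⟩
  have c1 := (L.analyticOnNhd_derivWeierstrassP z hz).deriv.continuousAt
  have c2 : ContinuousAt (fun z => 6 * L.weierstrassP z ^ 2 - L.g₂ / 2) z := by
    have := (L.analyticOnNhd_weierstrassP z hz).continuousAt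
    fun_prop
  refine tendsto_nhds_unique (c1.tendsto.mono_left (nhdsWithin_le_nhds (s := {z}ᶜ)))
    ((c2.tendsto.mono_left (nhdsWithin_le_nhds (s := {z}ᶜ))).congr' ?_)
  filter_upwards [hne, nhdsWithin_le_nhds (compl_lattice_mem_nhds hz)] with w hw hwL
  exact (h1 w hwL hw).symm

/-- The three half periods of the lattice. -/
def halfPeriod (τ : ℂ) : Fin 3 → ℂ :=
  ![Real.pi / 2, Real.pi * τ / 2, (Real.pi + Real.pi * τ) / 2]

/-- Reduces every membership question about half periods to denominators of rational coordinates. -/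
lemma rat_mem_lattice_iff (hτ : 0 < τ.im) (a b : ℚ) :
    (a : ℂ) * Real.pi + b * (Real.pi * τ) ∈ (thetaPair τ hτ).lattice ↔ a.den = 1 ∧ b.den = 1 :=
  PeriodPair.mul_ω₁_add_mul_ω₂_mem_lattice (L := thetaPair τ hτ)

lemma two_mul_halfPeriod_mem (hτ : 0 < τ.im) (i : Fin 3) :
    2 * halfPeriod τ i ∈ (thetaPair τ hτ).lattice := by
  have h := rat_mem_lattice_iff hτ
  fin_cases i
  · convert (h 1 0).2 ⟨rfl, rfl⟩ using 1; simp [halfPeriod]; ring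
  · convert (h 0 1).2 ⟨rfl, rfl⟩ using 1; simp [halfPeriod]; ring
  · convert (h 1 1).2 ⟨rfl, rfl⟩ using 1; simp [halfPeriod]; ring

lemma half_den : (1 / 2 : ℚ).den = 2 := by norm_num

lemma halfPeriod_notMem (hτ : 0 < τ.im) (i : Fin 3) :
    halfPeriod τ i ∉ (thetaPair τ hτ).lattice := by
  have h := rat_mem_lattice_iff hτ
  intro hm
  fin_cases i
  · have := (h (1 / 2) 0).1 (by convert hm using 1; simp [halfPeriod]; ring)
    rw [half_den] at this; omega
  · have := (h 0 (1 / 2)).1 (by convert hm using 1; simp [halfPeriod]; ring)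
    rw [half_den] at this; omega
  · have := (h (1 / 2) (1 / 2)).1 (by convert hm using 1; simp [halfPeriod]; ring)
    rw [half_den] at this; omega

lemma halfPeriod_sub_notMem (hτ : 0 < τ.im) {i j : Fin 3} (hij : i < j) :
    halfPeriod τ j - halfPeriod τ i ∉ (thetaPair τ hτ).lattice := by
  have h := rat_mem_lattice_iff hτ
  intro hm
  have hn : (-1 / 2 : ℚ).den = 2 := by norm_num
  fin_cases i <;> fin_cases j <;> simp at hij
  · have := (h (-1 / 2) (1 / 2)).1 (by convert hm using 1; simp [halfPeriod]; ring)
    rw [half_den] at this; omega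
  · have := (h 0 (1 / 2)).1 (by convert hm using 1; simp [halfPeriod]; ring)
    rw [half_den] at this; omega
  · have := (h (1 / 2) 0).1 (by convert hm using 1; simp [halfPeriod]; ring)
    rw [half_den] at this; omega

lemma exists_sub_halfPeriod_mem (hτ : 0 < τ.im) {a : ℂ} (ha : a ∉ (thetaPair τ hτ).lattice)
    (h2 : 2 * a ∈ (thetaPair τ hτ).lattice) :
    ∃ i, a - halfPeriod τ i ∈ (thetaPair τ hτ).lattice := by
  obtain ⟨m, n, hmn⟩ := PeriodPair.mem_lattice.1 h2
  simp only [thetaPair, periodPair] at hmn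
  rcases Int.even_or_odd' m with ⟨k, rfl | rfl⟩ <;> rcases Int.even_or_odd' n with ⟨l, rfl | rfl⟩
  · exfalso
    refine ha (PeriodPair.mem_lattice.2 ⟨k, l, ?_⟩)
    simp only [thetaPair, periodPair]
    push_cast at hmn
    linear_combination hmn / 2
  · refine ⟨1, PeriodPair.mem_lattice.2 ⟨k, l, ?_⟩⟩
    simp only [thetaPair, periodPair, halfPeriod, Matrix.cons_val]
    push_cast at hmn
    linear_combination hmn / 2
  · refine ⟨0, PeriodPair.mem_lattice.2 ⟨k, l, ?_⟩⟩
    simp only [thetaPair, periodPair, halfPeriod, Matrix.cons_val]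
    push_cast at hmn
    linear_combination hmn / 2
  · refine ⟨2, PeriodPair.mem_lattice.2 ⟨k, l, ?_⟩⟩
    simp only [thetaPair, periodPair, halfPeriod, Matrix.cons_val]
    push_cast at hmn
    linear_combination hmn / 2

/-- The values `e₁, e₂, e₃` of `℘` at the half periods. -/
def rootE (τ : ℂ) (hτ : 0 < τ.im) (i : Fin 3) : ℂ :=
  (thetaPair τ hτ).weierstrassP (halfPeriod τ i)

lemma rootE_injective (hτ : 0 < τ.im) : Function.Injective (rootE τ hτ) := by
  have key : ∀ i j : Fin 3, i < j → rootE τ hτ i ≠ rootE τ hτ j := by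
    intro i j hij h
    have h1 := halfPeriod_sub_notMem hτ hij
    rcases (weierstrassP_eq_iff hτ (halfPeriod_notMem hτ j) (halfPeriod_notMem hτ i)).1 h.symm
      with h2 | h2
    · exact h1 h2
    · apply h1
      have := (thetaPair τ hτ).lattice.sub_mem h2 (two_mul_halfPeriod_mem hτ i)
      convert this using 1
      ring
  intro i j h
  rcases lt_trichotomy i j with hij | hij | hij
  exacts [(key i j hij h).elim, hij, (key j i hij h.symm).elim]

lemma rootE_cubic (hτ : 0 < τ.im) (i : Fin 3) :
    4 * rootE τ hτ i ^ 3 - (thetaPair τ hτ).g₂ * rootE τ hτ i - (thetaPair τ hτ).g₃ = 0 := by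
  have h1 := (thetaPair τ hτ).derivWeierstrassP_sq _ (halfPeriod_notMem hτ i)
  rw [(derivWeierstrassP_eq_zero_iff hτ (halfPeriod_notMem hτ i)).2
    (two_mul_halfPeriod_mem hτ i)] at h1
  rw [rootE, ← h1]
  ring

/-- The three e_i are distinct roots of one cubic, so divided differences of the equation give the
symmetric functions. -/
lemma rootE_vieta (hτ : 0 < τ.im) :
    rootE τ hτ 0 + rootE τ hτ 1 + rootE τ hτ 2 = 0 ∧
    (thetaPair τ hτ).g₂ = -4 * (rootE τ hτ 0 * rootE τ hτ 1 + rootE τ hτ 0 * rootE τ hτ 2 +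
      rootE τ hτ 1 * rootE τ hτ 2) ∧
    (thetaPair τ hτ).g₃ = 4 * (rootE τ hτ 0 * rootE τ hτ 1 * rootE τ hτ 2) := by
  have h0 := rootE_cubic hτ 0
  have h1 := rootE_cubic hτ 1
  have h2 := rootE_cubic hτ 2
  have hi := rootE_injective hτ
  have n01 : rootE τ hτ 0 - rootE τ hτ 1 ≠ 0 := sub_ne_zero.2 (hi.ne (by decide))
  have n02 : rootE τ hτ 0 - rootE τ hτ 2 ≠ 0 := sub_ne_zero.2 (hi.ne (by decide))
  have n12 : rootE τ hτ 1 - rootE τ hτ 2 ≠ 0 := sub_ne_zero.2 (hi.ne (by decide))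
  generalize rootE τ hτ 0 = a at *
  generalize rootE τ hτ 1 = b at *
  generalize rootE τ hτ 2 = c at *
  generalize (thetaPair τ hτ).g₂ = p at *
  generalize (thetaPair τ hτ).g₃ = q at *
  have s1 : 4 * (a ^ 2 + a * b + b ^ 2) = p := by
    apply mul_left_cancel₀ n01; linear_combination h0 - h1
  have s2 : 4 * (a ^ 2 + a * c + c ^ 2) = p := by
    apply mul_left_cancel₀ n02; linear_combination h0 - h2
  have s3 : a + b + c = 0 := by
    apply mul_left_cancel₀ n12; linear_combination (s1 - s2) / 4
  have hc : c = -a - b := by linear_combination s3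
  subst hc
  refine ⟨s3, ?_, ?_⟩
  · linear_combination -s1
  · linear_combination -h0 + a * s1

end HalfPeriods

/-! ### Partial derivatives of analytic functions of two variables -/

section Partial

variable {f : ℂ × ℂ → ℂ} {x : ℂ × ℂ}

lemma hasDerivAt_dz (h : DifferentiableAt ℂ f x) :
    HasDerivAt (fun z => f (z, x.2)) (dz f x) x.1 := by
  have h1 : HasDerivAt (fun z : ℂ => (z, x.2)) ((1 : ℂ), (0 : ℂ)) x.1 :=
    (hasDerivAt_id x.1).prodMk (hasDerivAt_const x.1 x.2)
  exact HasFDerivAt.comp_hasDerivAt x.1 (l := f) (l' := fderiv ℂ f x) h.hasFDerivAt h1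

lemma hasDerivAt_dt (h : DifferentiableAt ℂ f x) :
    HasDerivAt (fun t => f (x.1, t)) (dt f x) x.2 := by
  have h1 : HasDerivAt (fun t : ℂ => (x.1, t)) ((0 : ℂ), (1 : ℂ)) x.2 :=
    (hasDerivAt_const x.2 x.1).prodMk (hasDerivAt_id x.2)
  exact HasFDerivAt.comp_hasDerivAt x.2 (l := f) (l' := fderiv ℂ f x) h.hasFDerivAt h1

lemma AnalyticAt.fderiv_apply_const {E : Type*} [NormedAddCommGroup E] [NormedSpace ℂ E]
    {f : E → ℂ} {x : E} (h : AnalyticAt ℂ f x) (v : E) :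
    AnalyticAt ℂ (fun y => fderiv ℂ f y v) x :=
  ((ContinuousLinearMap.apply ℂ ℂ v).analyticAt _).comp h.fderiv

lemma analyticAt_dz (h : AnalyticAt ℂ f x) : AnalyticAt ℂ (dz f) x :=
  AnalyticAt.fderiv_apply_const h _

lemma analyticAt_dt (h : AnalyticAt ℂ f x) : AnalyticAt ℂ (dt f) x :=
  AnalyticAt.fderiv_apply_const h _

lemma dt_dz_comm (h : AnalyticAt ℂ f x) : dt (dz f) x = dz (dt f) x := by
  have hs : IsSymmSndFDerivAt ℂ f x :=
    (h.contDiffAt (n := 2)).isSymmSndFDerivAt (by simp [minSmoothness_of_isRCLikeNormedField])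
  have h1 : ∀ v w : ℂ × ℂ, fderiv ℂ (fun y => fderiv ℂ f y v) x w = fderiv ℂ (fderiv ℂ f) x w v := by
    intro v w
    have h2 := h.fderiv.differentiableAt.hasFDerivAt
    exact congrArg (fun l => l w)
      (((ContinuousLinearMap.apply ℂ ℂ v).hasFDerivAt.comp x h2).fderiv)
  change fderiv ℂ (fun y => fderiv ℂ f y (1, 0)) x (0, 1) =
    fderiv ℂ (fun y => fderiv ℂ f y (0, 1)) x (1, 0)
  rw [h1, h1]
  exact hs _ _

lemma dz_congr {h : ℂ × ℂ → ℂ} {D : Set (ℂ × ℂ)} (hD : IsOpen D) (hfh : Set.EqOn f h D)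
    (hx : x ∈ D) : dz f x = dz h x := by
  rw [dz, dz, (hfh.eventuallyEq_of_mem (hD.mem_nhds hx)).fderiv_eq]

lemma dt_congr {h : ℂ × ℂ → ℂ} {D : Set (ℂ × ℂ)} (hD : IsOpen D) (hfh : Set.EqOn f h D)
    (hx : x ∈ D) : dt f x = dt h x := by
  rw [dt, dt, (hfh.eventuallyEq_of_mem (hD.mem_nhds hx)).fderiv_eq]

end Partial

/-! ### The heat equation for the logarithmic derivative -/

/-- The complement of the zero set of the theta function. -/
def thetaDom : Set (ℂ × ℂ) := {x | 0 < x.2.im ∧ theta1 x.1 x.2 ≠ 0}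

lemma isOpen_thetaDom : IsOpen thetaDom := by
  have h : ContinuousOn theta halfSpace := fun x hx =>
    (analyticAt_theta hx).continuousAt.continuousWithinAt
  exact h.isOpen_inter_preimage isOpen_halfSpace isOpen_compl_singleton

/-- The function `∂_z log θ₁(z, τ)` of two variables. -/
def gFun (x : ℂ × ℂ) : ℂ := gTheta x.1 x.2

lemma gFun_eq {x : ℂ × ℂ} (hx : x ∈ halfSpace) : gFun x = dz theta x / theta x := by
  rw [gFun, gTheta, logDeriv_apply]
  congr 1
  exact (hasDerivAt_dz (analyticAt_theta hx).differentiableAt).deriv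

lemma analyticAt_gFun {x : ℂ × ℂ} (hx : x ∈ thetaDom) : AnalyticAt ℂ gFun x := by
  have hx' : x ∈ halfSpace := hx.1
  have h := analyticAt_theta hx'
  refine ((analyticAt_dz h).div h hx.2).congr ?_
  filter_upwards [isOpen_halfSpace.mem_nhds hx'] with y hy using (gFun_eq hy).symm

/-- The constant `π i / 4`. -/
def kc : ℂ := Real.pi * Complex.I / 4

lemma dz_theta {x : ℂ × ℂ} (hx : x ∈ thetaDom) : dz theta x = gFun x * theta x := by
  rw [gFun_eq hx.1, div_mul_cancel₀ _ (show theta x ≠ 0 from hx.2)]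

lemma dt_theta_eq {x : ℂ × ℂ} (hx : x ∈ thetaDom) :
    dt theta x = -kc * ((dz gFun x + gFun x ^ 2) * theta x) := by
  have h1 := hasDerivAt_dz (analyticAt_gFun hx).differentiableAt
  have h2 := hasDerivAt_dz (analyticAt_theta hx.1).differentiableAt
  have hz : (fun z => dz theta (z, x.2)) =ᶠ[𝓝 x.1] fun z => gFun (z, x.2) * theta (z, x.2) := by
    have : ∀ᶠ z in 𝓝 x.1, (z, x.2) ∈ thetaDom :=
      ContinuousAt.preimage_mem_nhds (f := fun z => (z, x.2)) (by fun_prop)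
        (isOpen_thetaDom.mem_nhds hx)
    filter_upwards [this] with z hz using dz_theta hz
  have h3 := (hasDerivAt_dz (analyticAt_dz (analyticAt_theta hx.1)).differentiableAt).unique
    ((h1.mul h2).congr_of_eventuallyEq hz)
  rw [dt_theta hx.1, h3, dz_theta hx, kc]
  ring

/-- Compute θ_{zτ} in two ways: from θ_z = gθ, and from the heat equation written as θ_τ = -k(g_z +
g²)θ. Cancelling θ leaves an equation of Burgers type. -/
theorem dt_gFun {x : ℂ × ℂ} (hx : x ∈ thetaDom) :
    dt gFun x = -kc * (dz (dz gFun) x + 2 * gFun x * dz gFun x) := by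
  have hg := analyticAt_gFun hx
  have hθ := analyticAt_theta hx.1
  have e1 : dt (dz theta) x = dz (dt theta) x := dt_dz_comm hθ
  have e2 : dt (dz theta) x = dt (fun y => gFun y * theta y) x :=
    dt_congr isOpen_thetaDom (fun y hy => dz_theta hy) hx
  have e3 : dz (dt theta) x = dz (fun y => -kc * ((dz gFun y + gFun y ^ 2) * theta y)) x :=
    dz_congr isOpen_thetaDom (fun y hy => dt_theta_eq hy) hx
  have d2 := (hasDerivAt_dt hg.differentiableAt).mul (hasDerivAt_dt hθ.differentiableAt)
  have d3 := (((hasDerivAt_dz (analyticAt_dz hg).differentiableAt).add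
    ((hasDerivAt_dz hg.differentiableAt).pow 2)).mul
      (hasDerivAt_dz hθ.differentiableAt)).const_mul (-kc)
  have f2 := (hasDerivAt_dt (f := fun y => gFun y * theta y)
    (hg.mul hθ).differentiableAt).unique d2
  have f3 := (hasDerivAt_dz (f := fun y => -kc * ((dz gFun y + gFun y ^ 2) * theta y))
    (analyticAt_const.mul (((analyticAt_dz hg).add (hg.pow 2)).mul hθ)).differentiableAt).unique d3
  rw [e2, e3, f2, f3] at e1
  simp only [Prod.mk.eta, dz_theta hx, dt_theta_eq hx, Pi.add_apply, Pi.pow_apply] at e1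
  apply mul_right_cancel₀ hx.2
  change _ * theta x = _ * theta x
  linear_combination e1

/-! ### Derivatives with respect to the modulus -/

/-- `E₂` as a function on `ℂ`. -/
def e2 (τ : ℂ) : ℂ := EisensteinSeries.E2 (UpperHalfPlane.ofComplex τ)

/-- The invariant `g₂` of the lattice `π ℤ + π τ ℤ`. -/
def g2 (τ : ℂ) : ℂ := if h : 0 < τ.im then (thetaPair τ h).g₂ else 0

/-- The invariant `g₃` of the lattice `π ℤ + π τ ℤ`. -/
def g3 (τ : ℂ) : ℂ := if h : 0 < τ.im then (thetaPair τ h).g₃ else 0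

lemma analyticAt_e2 {τ : ℂ} (hτ : 0 < τ.im) : AnalyticAt ℂ e2 τ :=
  (UpperHalfPlane.mdifferentiable_iff.1 E2_mdifferentiable).analyticAt
    (UpperHalfPlane.isOpen_upperHalfPlaneSet.mem_nhds hτ)

/-- The Weierstrass function of the lattice `π ℤ + π τ ℤ` as a function of `(z, τ)`. -/
def wp (x : ℂ × ℂ) : ℂ := -dz gFun x - e2 x.2 / 3

/-- The derivative of `wp` in `z`. -/
def wp' (x : ℂ × ℂ) : ℂ := dz wp x

lemma notMem_of_mem_thetaDom {x : ℂ × ℂ} (hx : x ∈ thetaDom) :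
    x.1 ∉ (thetaPair x.2 hx.1).lattice :=
  fun h => hx.2 ((theta1_eq_zero_iff hx.1 _).2 h)

lemma analyticAt_e2_snd {x : ℂ × ℂ} (hx : x ∈ thetaDom) :
    AnalyticAt ℂ (fun y : ℂ × ℂ => e2 y.2) x :=
  (analyticAt_e2 hx.1).comp analyticAt_snd

lemma analyticAt_wp {x : ℂ × ℂ} (hx : x ∈ thetaDom) : AnalyticAt ℂ wp x :=
  (analyticAt_dz (analyticAt_gFun hx)).neg.sub ((analyticAt_e2_snd hx).mul
    (analyticAt_const (v := (3 : ℂ)⁻¹)) |>.congr (.of_forall fun _ => by simp [div_eq_mul_inv]))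

/-- Introducing ℘ through g makes joint analyticity in (z, τ) immediate; this identity transfers the
facts known on each single lattice. -/
lemma wp_eq {x : ℂ × ℂ} (hx : x ∈ thetaDom) :
    wp x = (thetaPair x.2 hx.1).weierstrassP x.1 := by
  have h1 := deriv_gTheta hx.1 (notMem_of_mem_thetaDom hx)
  have h2 := (hasDerivAt_dz (analyticAt_gFun hx).differentiableAt).deriv
  simp only [gFun] at h2
  rw [h2] at h1
  rw [wp, h1, e2]
  ring

lemma eventually_mem_thetaDom {x : ℂ × ℂ} (hx : x ∈ thetaDom) :
    ∀ᶠ z in 𝓝 x.1, (z, x.2) ∈ thetaDom :=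
  ContinuousAt.preimage_mem_nhds (f := fun z => (z, x.2)) (by fun_prop)
    (isOpen_thetaDom.mem_nhds hx)

lemma wp'_eq {x : ℂ × ℂ} (hx : x ∈ thetaDom) :
    wp' x = (thetaPair x.2 hx.1).derivWeierstrassP x.1 := by
  rw [wp', ← (hasDerivAt_dz (analyticAt_wp hx).differentiableAt).deriv,
    ← PeriodPair.deriv_weierstrassP]
  refine Filter.EventuallyEq.deriv_eq ?_
  filter_upwards [eventually_mem_thetaDom hx] with z hz using wp_eq hz

lemma analyticAt_wp' {x : ℂ × ℂ} (hx : x ∈ thetaDom) : AnalyticAt ℂ wp' x :=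
  analyticAt_dz (analyticAt_wp hx)

lemma dz_wp' {x : ℂ × ℂ} (hx : x ∈ thetaDom) : dz wp' x = 6 * wp x ^ 2 - g2 x.2 / 2 := by
  rw [← (hasDerivAt_dz (analyticAt_wp' hx).differentiableAt).deriv, wp_eq hx, g2, dif_pos hx.1,
    ← deriv_derivWeierstrassP hx.1 (notMem_of_mem_thetaDom hx)]
  refine Filter.EventuallyEq.deriv_eq ?_
  filter_upwards [eventually_mem_thetaDom hx] with z hz using wp'_eq hz

lemma wp'_sq {x : ℂ × ℂ} (hx : x ∈ thetaDom) :
    wp' x ^ 2 = 4 * wp x ^ 3 - g2 x.2 * wp x - g3 x.2 := by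
  rw [wp_eq hx, wp'_eq hx, g2, g3, dif_pos hx.1, dif_pos hx.1]
  exact PeriodPair.derivWeierstrassP_sq _ _ (notMem_of_mem_thetaDom hx)

lemma exists_mem_thetaDom {τ : ℂ} (hτ : 0 < τ.im) (i : Fin 3) :
    (halfPeriod τ i, τ) ∈ thetaDom :=
  ⟨hτ, fun h => halfPeriod_notMem hτ i ((theta1_eq_zero_iff hτ _).1 h)⟩

lemma eventually_mem_thetaDom' {x : ℂ × ℂ} (hx : x ∈ thetaDom) :
    ∀ᶠ t in 𝓝 x.2, (x.1, t) ∈ thetaDom :=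
  ContinuousAt.preimage_mem_nhds (f := fun t => (x.1, t)) (by fun_prop)
    (isOpen_thetaDom.mem_nhds hx)

/-- Read g₂ off from 12℘² - 2℘'' along a fixed z, a half period for the given τ; nearby values of
the modulus keep this z off the lattice. -/
lemma analyticAt_g2 {τ : ℂ} (hτ : 0 < τ.im) : AnalyticAt ℂ g2 τ := by
  have hx := exists_mem_thetaDom hτ 0
  have h1 : AnalyticAt ℂ (fun y => 12 * wp y ^ 2 - 2 * dz wp' y) (halfPeriod τ 0, τ) :=
    (analyticAt_const.mul ((analyticAt_wp hx).pow 2)).sub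
      (analyticAt_const.mul (analyticAt_dz (analyticAt_wp' hx)))
  have h2 := AnalyticAt.fun_comp (f := fun t : ℂ => (halfPeriod τ 0, t)) (x := τ) h1 (by fun_prop)
  refine h2.congr ?_
  filter_upwards [eventually_mem_thetaDom' hx] with t ht
  rw [dz_wp' ht]
  ring

/-! ### The Ramanujan identities -/

section Ramanujan

variable {x : ℂ × ℂ}

lemma dz_gFun (x : ℂ × ℂ) : dz gFun x = -(wp x + e2 x.2 / 3) := by
  rw [wp]; ring

lemma dz_dz_gFun (hx : x ∈ thetaDom) : dz (dz gFun) x = -wp' x := by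
  have h := (hasDerivAt_dz (analyticAt_wp hx).differentiableAt).add_const (e2 x.2 / 3) |>.fun_neg
  have h1 := (hasDerivAt_dz (analyticAt_dz (analyticAt_gFun hx)).differentiableAt)
  simp only [dz_gFun] at h1
  exact h1.unique h

lemma dt_gFun_eq (hx : x ∈ thetaDom) :
    dt gFun x = kc * (wp' x + 2 * gFun x * (wp x + e2 x.2 / 3)) := by
  rw [dt_gFun hx, dz_dz_gFun hx, dz_gFun]
  ring

lemma hasDerivAt_gFun_dz (hx : x ∈ thetaDom) :
    HasDerivAt (fun z => gFun (z, x.2)) (-(wp x + e2 x.2 / 3)) x.1 := by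
  rw [← dz_gFun]
  exact hasDerivAt_dz (analyticAt_gFun hx).differentiableAt

lemma hasDerivAt_wp_dz (hx : x ∈ thetaDom) : HasDerivAt (fun z => wp (z, x.2)) (wp' x) x.1 :=
  hasDerivAt_dz (analyticAt_wp hx).differentiableAt

lemma hasDerivAt_wp'_dz (hx : x ∈ thetaDom) :
    HasDerivAt (fun z => wp' (z, x.2)) (6 * wp x ^ 2 - g2 x.2 / 2) x.1 := by
  rw [← dz_wp' hx]
  exact hasDerivAt_dz (analyticAt_wp' hx).differentiableAt

lemma analyticAt_g2_snd (hx : x ∈ thetaDom) : AnalyticAt ℂ (fun y : ℂ × ℂ => g2 y.2) x :=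
  (analyticAt_g2 hx.1).comp analyticAt_snd

lemma dt_dz_gFun (hx : x ∈ thetaDom) : dt (dz gFun) x =
    kc * (6 * wp x ^ 2 - g2 x.2 / 2 - 2 * (wp x + e2 x.2 / 3) ^ 2 + 2 * gFun x * wp' x) := by
  rw [dt_dz_comm (analyticAt_gFun hx),
    dz_congr isOpen_thetaDom (fun y hy => dt_gFun_eq hy) hx]
  have ha : AnalyticAt ℂ (fun y => kc * (wp' y + 2 * gFun y * (wp y + e2 y.2 / 3))) x := by
    have h1 := analyticAt_wp' hx
    have h2 := analyticAt_gFun hx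
    have h3 := analyticAt_wp hx
    have h4 := analyticAt_e2_snd hx
    fun_prop (disch := norm_num)
  have h := (hasDerivAt_wp'_dz hx).fun_add (((hasDerivAt_gFun_dz hx).const_mul 2).fun_mul
    ((hasDerivAt_wp_dz hx).add_const (e2 x.2 / 3))) |>.const_mul kc
  rw [(hasDerivAt_dz ha.differentiableAt).unique h]
  ring

lemma dt_wp (hx : x ∈ thetaDom) : dt wp x = -deriv e2 x.2 / 3 -
    kc * (6 * wp x ^ 2 - g2 x.2 / 2 - 2 * (wp x + e2 x.2 / 3) ^ 2 + 2 * gFun x * wp' x) := by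
  have h1 := (hasDerivAt_dt (analyticAt_dz (analyticAt_gFun hx)).differentiableAt).fun_neg.fun_sub
    ((analyticAt_e2 hx.1).differentiableAt.hasDerivAt.div_const 3)
  rw [(hasDerivAt_dt (analyticAt_wp hx).differentiableAt).unique h1, dt_dz_gFun hx]
  ring

lemma dt_wp' (hx : x ∈ thetaDom) : dt wp' x =
    -kc * (6 * wp x * wp' x - 2 * e2 x.2 * wp' x + gFun x * (12 * wp x ^ 2 - g2 x.2)) := by
  have hc : dt wp' x = dz (dt wp) x := dt_dz_comm (analyticAt_wp hx)
  rw [hc, dz_congr isOpen_thetaDom (fun y hy => dt_wp hy) hx]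
  have ha : AnalyticAt ℂ (fun y => -deriv e2 y.2 / 3 -
      kc * (6 * wp y ^ 2 - g2 y.2 / 2 - 2 * (wp y + e2 y.2 / 3) ^ 2 + 2 * gFun y * wp' y)) x := by
    have h1 := analyticAt_wp' hx
    have h2 := analyticAt_gFun hx
    have h3 := analyticAt_wp hx
    have h4 := analyticAt_e2_snd hx
    have h5 : AnalyticAt ℂ (fun y : ℂ × ℂ => deriv e2 y.2) x :=
      (analyticAt_e2 hx.1).deriv.comp analyticAt_snd
    have h6 := analyticAt_g2_snd hx
    fun_prop (disch := norm_num)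
  have h := ((((((hasDerivAt_wp_dz hx).fun_pow 2).const_mul 6).sub_const (g2 x.2 / 2)).fun_sub
    ((((hasDerivAt_wp_dz hx).add_const (e2 x.2 / 3)).fun_pow 2).const_mul 2)).fun_add
    (((hasDerivAt_gFun_dz hx).const_mul 2).fun_mul (hasDerivAt_wp'_dz hx))).const_mul kc
      |>.const_sub (-deriv e2 x.2 / 3)
  rw [(hasDerivAt_dz ha.differentiableAt).unique h]
  simp only [Nat.reduceSub, pow_one, Prod.mk.eta]
  push_cast
  ring

lemma dt_dz_wp' (hx : x ∈ thetaDom) : dt (dz wp') x =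
    -kc * (6 * wp' x ^ 2 + (6 * wp x - 2 * e2 x.2) * (6 * wp x ^ 2 - g2 x.2 / 2) -
      (wp x + e2 x.2 / 3) * (12 * wp x ^ 2 - g2 x.2) + 24 * gFun x * wp x * wp' x) := by
  rw [dt_dz_comm (analyticAt_wp' hx), dz_congr isOpen_thetaDom (fun y hy => dt_wp' hy) hx]
  have ha : AnalyticAt ℂ (fun y => -kc * (6 * wp y * wp' y - 2 * e2 y.2 * wp' y +
      gFun y * (12 * wp y ^ 2 - g2 y.2))) x := by
    have h1 := analyticAt_wp' hx
    have h2 := analyticAt_gFun hx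
    have h3 := analyticAt_wp hx
    have h4 := analyticAt_e2_snd hx
    have h6 := analyticAt_g2_snd hx
    fun_prop
  have h := (((((hasDerivAt_wp_dz hx).const_mul 6).fun_mul (hasDerivAt_wp'_dz hx)).fun_sub
    ((hasDerivAt_wp'_dz hx).const_mul (2 * e2 x.2))).fun_add ((hasDerivAt_gFun_dz hx).fun_mul
      ((((hasDerivAt_wp_dz hx).fun_pow 2).const_mul 12).sub_const (g2 x.2)))).const_mul (-kc)
  rw [(hasDerivAt_dz ha.differentiableAt).unique h]
  simp only [Nat.reduceSub, pow_one, Prod.mk.eta]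
  push_cast
  ring

lemma hasDerivAt_wp_dt (hx : x ∈ thetaDom) : HasDerivAt (fun t => wp (x.1, t)) (dt wp x) x.2 :=
  hasDerivAt_dt (analyticAt_wp hx).differentiableAt

lemma hasDerivAt_wp'_dt (hx : x ∈ thetaDom) : HasDerivAt (fun t => wp' (x.1, t)) (dt wp' x) x.2 :=
  hasDerivAt_dt (analyticAt_wp' hx).differentiableAt

/-- Differentiate 12℘² - 2℘'' in τ at fixed z. The terms containing g cancel, and replacing ℘'² by
the cubic leaves degree one in ℘. -/
lemma deriv_g2_eq (hx : x ∈ thetaDom) : deriv g2 x.2 =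
    wp x * (-8 * deriv e2 x.2 + kc * (16 / 3 * e2 x.2 ^ 2 - 4 * g2 x.2)) +
      kc * (-12 * g3 x.2 + 8 / 3 * e2 x.2 * g2 x.2) := by
  have h1 := (((hasDerivAt_wp_dt hx).fun_pow 2).const_mul 12).fun_sub
    ((hasDerivAt_dt (analyticAt_dz (analyticAt_wp' hx)).differentiableAt).const_mul 2)
  have h2 : g2 =ᶠ[𝓝 x.2] fun t => 12 * wp (x.1, t) ^ 2 - 2 * dz wp' (x.1, t) := by
    filter_upwards [eventually_mem_thetaDom' hx] with t ht
    rw [dz_wp' ht]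
    ring
  rw [h2.deriv_eq, h1.deriv, dt_dz_wp' hx, dt_wp hx]
  norm_num
  linear_combination (12 * kc) * wp'_sq hx

variable {τ : ℂ}

/-- The left side of `deriv_g2_eq` does not depend on z, while ℘ takes different values at two half
periods. So the coefficient of ℘ vanishes, which gives E₂', and the constant term gives g₂'. -/
theorem ramanujan_e2_g2 (hτ : 0 < τ.im) :
    deriv e2 τ = kc * (2 / 3 * e2 τ ^ 2 - g2 τ / 2) ∧
      deriv g2 τ = kc * (8 / 3 * e2 τ * g2 τ - 12 * g3 τ) := by
  have h0 := deriv_g2_eq (exists_mem_thetaDom hτ 0)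
  have h1 := deriv_g2_eq (exists_mem_thetaDom hτ 1)
  have hne : wp (halfPeriod τ 0, τ) - wp (halfPeriod τ 1, τ) ≠ 0 := by
    rw [wp_eq (exists_mem_thetaDom hτ 0), wp_eq (exists_mem_thetaDom hτ 1), sub_ne_zero]
    exact (rootE_injective hτ).ne (by decide)
  simp only at h0 h1
  have h2 : -8 * deriv e2 τ + kc * (16 / 3 * e2 τ ^ 2 - 4 * g2 τ) = 0 := by
    apply mul_left_cancel₀ hne
    linear_combination h1 - h0
  refine ⟨by linear_combination -h2 / 8, ?_⟩
  linear_combination h0 + wp (halfPeriod τ 0, τ) * h2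

theorem ramanujan_e2 (hτ : 0 < τ.im) : HasDerivAt e2 (kc * (2 / 3 * e2 τ ^ 2 - g2 τ / 2)) τ := by
  rw [← (ramanujan_e2_g2 hτ).1]
  exact (analyticAt_e2 hτ).differentiableAt.hasDerivAt

theorem ramanujan_g2 (hτ : 0 < τ.im) :
    HasDerivAt g2 (kc * (8 / 3 * e2 τ * g2 τ - 12 * g3 τ)) τ := by
  rw [← (ramanujan_e2_g2 hτ).2]
  exact (analyticAt_g2 hτ).differentiableAt.hasDerivAt

/-- Differentiate g₃ = 4℘³ - g₂℘ - ℘'² in τ at a fixed half period, with the two preceding equations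
inserted. -/
theorem ramanujan_g3 (hτ : 0 < τ.im) :
    HasDerivAt g3 (kc * (4 * e2 τ * g3 τ - 2 / 3 * g2 τ ^ 2)) τ := by
  have hx := exists_mem_thetaDom hτ 0
  have h1 := ((((hasDerivAt_wp_dt hx).fun_pow 3).const_mul 4).fun_sub
    ((ramanujan_g2 hτ).fun_mul (hasDerivAt_wp_dt hx))).fun_sub ((hasDerivAt_wp'_dt hx).fun_pow 2)
  have h2 : g3 =ᶠ[𝓝 τ] fun t => 4 * wp (halfPeriod τ 0, t) ^ 3 - g2 t * wp (halfPeriod τ 0, t) -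
      wp' (halfPeriod τ 0, t) ^ 2 := by
    filter_upwards [eventually_mem_thetaDom' hx] with t ht
    rw [wp'_sq ht]
    ring
  have h3 := wp'_sq hx
  refine (h1.congr_of_eventuallyEq h2).congr_deriv ?_
  rw [dt_wp hx, dt_wp' hx]
  simp only at h3 ⊢
  rw [(ramanujan_e2 hτ).deriv]
  norm_num
  linear_combination (kc * (12 * wp (halfPeriod τ 0, τ) - 4 * e2 τ)) * h3

end Ramanujan

/-! ### Gradients of functions of several variables -/

section Gradient

variable {n : ℕ} {f g : (Fin n → ℂ) → ℂ} {f' g' : Fin n → ℂ} {x : Fin n → ℂ}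

/-- The linear form with the given coefficients. -/
def gradForm (f' : Fin n → ℂ) : (Fin n → ℂ) →L[ℂ] ℂ :=
  ∑ α, f' α • ContinuousLinearMap.proj (R := ℂ) (φ := fun _ : Fin n => ℂ) α

lemma gradForm_apply (f' v : Fin n → ℂ) : gradForm f' v = ∑ α, f' α * v α := by
  simp [gradForm]

/-- `f` is differentiable at `x` with partial derivatives `f'`. -/
def HasPd (f : (Fin n → ℂ) → ℂ) (f' : Fin n → ℂ) (x : Fin n → ℂ) : Prop :=
  HasFDerivAt f (gradForm f') x

lemma HasPd.pd_eq (h : HasPd f f' x) (α : Fin n) : pd α f x = f' α := by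
  rw [pd, HasFDerivAt.fderiv h, gradForm_apply]
  simp [Pi.single_apply]

lemma HasPd.congr_grad (h : HasPd f f' x) (hfg : ∀ α, f' α = g' α) : HasPd f g' x := by
  rw [← funext hfg]; exact h

lemma HasPd.of_hasFDerivAt {T : (Fin n → ℂ) →L[ℂ] ℂ} (h : HasFDerivAt f T x)
    (hT : ∀ v, T v = ∑ α, f' α * v α) : HasPd f f' x :=
  h.congr_fderiv (ContinuousLinearMap.ext fun v => by rw [hT, gradForm_apply])

lemma HasPd.const (c : ℂ) (x : Fin n → ℂ) : HasPd (fun _ => c) (fun _ => 0) x :=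
  .of_hasFDerivAt (hasFDerivAt_const c x) fun v => by simp

lemma HasPd.coord (i : Fin n) (x : Fin n → ℂ) :
    HasPd (fun x => x i) (fun α => if α = i then 1 else 0) x :=
  .of_hasFDerivAt
    (ContinuousLinearMap.proj (R := ℂ) (φ := fun _ : Fin n => ℂ) i).hasFDerivAt fun v => by simp

lemma HasPd.comp₂ {G : ℂ × ℂ → ℂ} (hf : HasPd f f' x) (hg : HasPd g g' x)
    (hG : DifferentiableAt ℂ G (f x, g x)) :
    HasPd (fun x => G (f x, g x))
      (fun α => dz G (f x, g x) * f' α + dt G (f x, g x) * g' α) x := by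
  refine .of_hasFDerivAt (hG.hasFDerivAt.comp x (HasFDerivAt.prodMk hf hg)) fun v => ?_
  have h2 (a b : ℂ) :
      fderiv ℂ G (f x, g x) (a, b) = dz G (f x, g x) * a + dt G (f x, g x) * b := by
    have : (a, b) = a • ((1 : ℂ), (0 : ℂ)) + b • ((0 : ℂ), (1 : ℂ)) := by simp
    rw [this, map_add, map_smul, map_smul, dz, dt, smul_eq_mul, smul_eq_mul]
    ring
  rw [ContinuousLinearMap.comp_apply, ContinuousLinearMap.prod_apply, h2, gradForm_apply,
    gradForm_apply, Finset.mul_sum, Finset.mul_sum, ← Finset.sum_add_distrib]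
  exact Finset.sum_congr rfl fun α _ => by ring

lemma HasPd.comp {φ : ℂ → ℂ} {φ' : ℂ} (hf : HasPd f f' x) (hφ : HasDerivAt φ φ' (f x)) :
    HasPd (fun x => φ (f x)) (fun α => φ' * f' α) x := by
  refine .of_hasFDerivAt (HasFDerivAt.comp x hφ.hasFDerivAt hf) fun v => ?_
  simp only [ContinuousLinearMap.comp_apply, gradForm_apply,
    ContinuousLinearMap.toSpanSingleton_apply, smul_eq_mul, Finset.sum_mul]
  exact Finset.sum_congr rfl fun α _ => by ring

lemma HasPd.add (hf : HasPd f f' x) (hg : HasPd g g' x) :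
    HasPd (fun x => f x + g x) (fun α => f' α + g' α) x :=
  .of_hasFDerivAt (HasFDerivAt.fun_add hf hg) fun v => by
    simp only [add_apply, gradForm_apply, ← Finset.sum_add_distrib, add_mul]

lemma HasPd.mul (hf : HasPd f f' x) (hg : HasPd g g' x) :
    HasPd (fun x => f x * g x) (fun α => f x * g' α + g x * f' α) x :=
  .of_hasFDerivAt (HasFDerivAt.fun_mul hf hg) fun v => by
    simp only [add_apply, smul_apply, smul_eq_mul, gradForm_apply, Finset.mul_sum,
      ← Finset.sum_add_distrib, add_mul, mul_assoc]

lemma HasPd.const_mul (hf : HasPd f f' x) (c : ℂ) :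
    HasPd (fun x => c * f x) (fun α => c * f' α) x :=
  ((HasPd.const c x).mul hf).congr_grad fun α => by simp

lemma HasPd.pow (hf : HasPd f f' x) (m : ℕ) :
    HasPd (fun x => f x ^ m) (fun α => m * f x ^ (m - 1) * f' α) x :=
  hf.comp (hasDerivAt_pow m (f x))

lemma HasPd.congr (h : HasPd f f' x) (hfg : g =ᶠ[𝓝 x] f) : HasPd g f' x :=
  HasFDerivAt.congr_of_eventuallyEq h hfg

end Gradient

/-! ### Third derivatives of `F` -/

/-- The function `-(π i / 48) E₂`. -/
def gam0 (τ : ℂ) : ℂ := -(kc / 12) * e2 τ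

/-- The first derivative of `gam0`. -/
def gam1 (τ : ℂ) : ℂ := -(kc ^ 2 / 12) * (2 / 3 * e2 τ ^ 2 - g2 τ / 2)

/-- The second derivative of `gam0`. -/
def gam2 (τ : ℂ) : ℂ := -(kc ^ 3 / 12) * (8 / 9 * e2 τ ^ 3 - 2 * e2 τ * g2 τ + 6 * g3 τ)

/-- The third derivative of `gam0`. -/
def gam3 (τ : ℂ) : ℂ :=
  -(kc ^ 4 / 12) * (16 / 9 * e2 τ ^ 4 - 8 * e2 τ ^ 2 * g2 τ + 48 * e2 τ * g3 τ - 3 * g2 τ ^ 2)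

/-! ### Derivatives of the E₂ term and the Chazy equation. -/

section Gam

variable {τ : ℂ}

lemma hasDerivAt_gam0 (hτ : 0 < τ.im) : HasDerivAt gam0 (gam1 τ) τ := by
  refine ((ramanujan_e2 hτ).const_mul (-(kc / 12))).congr_deriv ?_
  rw [gam1]; ring

lemma hasDerivAt_gam1 (hτ : 0 < τ.im) : HasDerivAt gam1 (gam2 τ) τ := by
  refine (((((ramanujan_e2 hτ).fun_pow 2).const_mul (2 / 3)).fun_sub
    ((ramanujan_g2 hτ).div_const 2)).const_mul (-(kc ^ 2 / 12))).congr_deriv ?_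
  simp only [Nat.reduceSub, pow_one, gam2]
  push_cast
  ring

lemma hasDerivAt_gam2 (hτ : 0 < τ.im) : HasDerivAt gam2 (gam3 τ) τ := by
  refine ((((((ramanujan_e2 hτ).fun_pow 3).const_mul (8 / 9)).fun_sub
    (((ramanujan_e2 hτ).const_mul 2).fun_mul (ramanujan_g2 hτ))).fun_add
      ((ramanujan_g3 hτ).const_mul 6)).const_mul (-(kc ^ 3 / 12))).congr_deriv ?_
  simp only [Nat.reduceSub, gam3]
  push_cast
  ring

/-- After Ramanujan's equations both sides are the same polynomial in E₂, g₂, g₃. This is what the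
associativity of the closed structure amounts to. -/
lemma chazy (τ : ℂ) : gam3 τ = 144 * gam1 τ ^ 2 - 96 * gam0 τ * gam2 τ := by
  simp only [gam0, gam1, gam2, gam3]
  ring

end Gam

/-! ### Derivatives of the potential; arbitrary coordinate positions serve both ℂ³ and the lift to
ℂ⁴. -/

section Potential

variable {n : ℕ} (i j k : Fin n)

/-- The potential as a function of the coordinates with indices `i, j, k`. -/
def pot (x : Fin n → ℂ) : ℂ := x i ^ 2 * x k / 2 + x i * x j ^ 2 / 2 + x j ^ 4 * gam0 (x k)

/-- The Kronecker symbol. -/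
def kron (i α : Fin n) : ℂ := if α = i then 1 else 0

/-- The gradient of `pot`. -/
def pot1 (α : Fin n) (x : Fin n → ℂ) : ℂ :=
  kron i α * (x i * x k + x j ^ 2 / 2) + kron j α * (x i * x j + 4 * x j ^ 3 * gam0 (x k)) +
    kron k α * (x i ^ 2 / 2 + x j ^ 4 * gam1 (x k))

/-- The Hessian of `pot`. -/
def pot2 (α β : Fin n) (x : Fin n → ℂ) : ℂ :=
  kron i α * (kron i β * x k + kron j β * x j + kron k β * x i) +
    kron j α * (kron i β * x j + kron j β * (x i + 12 * x j ^ 2 * gam0 (x k)) +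
      kron k β * (4 * x j ^ 3 * gam1 (x k))) +
    kron k α * (kron i β * x i + kron j β * (4 * x j ^ 3 * gam1 (x k)) +
      kron k β * (x j ^ 4 * gam2 (x k)))

/-- The third derivatives of `pot`. -/
def pot3 (α β δ : Fin n) (x : Fin n → ℂ) : ℂ :=
  kron i α * (kron i β * kron k δ + kron j β * kron j δ + kron k β * kron i δ) +
    kron j α * (kron i β * kron j δ + kron j β * (kron i δ + kron j δ * (24 * x j * gam0 (x k)) +
        kron k δ * (12 * x j ^ 2 * gam1 (x k))) +
      kron k β * (kron j δ * (12 * x j ^ 2 * gam1 (x k)) +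
        kron k δ * (4 * x j ^ 3 * gam2 (x k)))) +
    kron k α * (kron i β * kron i δ + kron j β * (kron j δ * (12 * x j ^ 2 * gam1 (x k)) +
        kron k δ * (4 * x j ^ 3 * gam2 (x k))) +
      kron k β * (kron j δ * (4 * x j ^ 3 * gam2 (x k)) + kron k δ * (x j ^ 4 * gam3 (x k))))

variable {i j k} {x : Fin n → ℂ}

lemma hasPd_pot (hx : 0 < (x k).im) :
    HasPd (pot i j k) (fun α => pot1 i j k α x) x := by
  have hi := HasPd.coord i x
  have hj := HasPd.coord j x
  have hk := HasPd.coord k x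
  have h := ((((hi.pow 2).mul hk).const_mul (1 / 2)).add
    ((hi.mul (hj.pow 2)).const_mul (1 / 2))).add ((hj.pow 4).mul (hk.comp (hasDerivAt_gam0 hx)))
  refine (h.congr (.of_forall fun y => ?_)).congr_grad fun α => ?_
  · simp only [pot]; ring
  · simp only [pot1, kron, Nat.reduceSub, pow_one]
    push_cast
    ring

lemma hasPd_pot1 (hx : 0 < (x k).im) (α : Fin n) :
    HasPd (pot1 i j k α) (fun β => pot2 i j k α β x) x := by
  have hi := HasPd.coord i x
  have hj := HasPd.coord j x
  have hk := HasPd.coord k x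
  have h := ((((hi.mul hk).add ((hj.pow 2).const_mul (1 / 2))).const_mul (kron i α)).add
    (((hi.mul hj).add (((hj.pow 3).mul (hk.comp (hasDerivAt_gam0 hx))).const_mul 4)).const_mul
      (kron j α))).add
    ((((hi.pow 2).const_mul (1 / 2)).add ((hj.pow 4).mul (hk.comp (hasDerivAt_gam1 hx)))).const_mul
      (kron k α))
  refine (h.congr (.of_forall fun y => ?_)).congr_grad fun β => ?_
  · simp only [pot1]; ring
  · simp only [pot2]
    -- Freeze the symbols of the derivative already taken, so that only those of the new index are
    -- unfolded.
    generalize kron i α = a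
    generalize kron j α = b
    generalize kron k α = c
    simp only [kron, Nat.reduceSub, pow_one]
    push_cast
    ring

lemma hasPd_pot2 (hx : 0 < (x k).im) (α β : Fin n) :
    HasPd (pot2 i j k α β) (fun δ => pot3 i j k α β δ x) x := by
  have hi := HasPd.coord i x
  have hj := HasPd.coord j x
  have hk := HasPd.coord k x
  have h0 := hk.comp (hasDerivAt_gam0 hx)
  have h1 := hk.comp (hasDerivAt_gam1 hx)
  have h2 := hk.comp (hasDerivAt_gam2 hx)
  have h := ((((hk.const_mul (kron i β)).add (hj.const_mul (kron j β))).add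
    (hi.const_mul (kron k β))).const_mul (kron i α)).add
    ((((hj.const_mul (kron i β)).add ((hi.add (((hj.pow 2).mul h0).const_mul 12)).const_mul
      (kron j β))).add (((hj.pow 3).mul h1).const_mul (4 * kron k β))).const_mul (kron j α)) |>.add
    ((((hi.const_mul (kron i β)).add (((hj.pow 3).mul h1).const_mul (4 * kron j β))).add
      (((hj.pow 4).mul h2).const_mul (kron k β))).const_mul (kron k α))
  refine (h.congr (.of_forall fun y => ?_)).congr_grad fun δ => ?_
  · simp only [pot2]; ring
  · simp only [pot3]
    generalize kron i α = a
    generalize kron j α = b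
    generalize kron k α = c
    generalize kron i β = a'
    generalize kron j β = b'
    generalize kron k β = c'
    simp only [kron, Nat.reduceSub, pow_one]
    push_cast
    ring

lemma isOpen_im_pos (k : Fin n) : IsOpen {x : Fin n → ℂ | 0 < (x k).im} :=
  isOpen_lt continuous_const (Complex.continuous_im.comp (continuous_apply k))

lemma pd_congr {f g : (Fin n → ℂ) → ℂ} {U : Set (Fin n → ℂ)} (hU : IsOpen U)
    (h : Set.EqOn f g U) (hx : x ∈ U) (α : Fin n) : pd α f x = pd α g x := by
  rw [pd, pd, (h.eventuallyEq_of_mem (hU.mem_nhds hx)).fderiv_eq]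

theorem cLow_pot (hx : 0 < (x k).im) (α β δ : Fin n) :
    cLow (pot i j k) x α β δ = pot3 i j k δ β α x := by
  have hU := isOpen_im_pos k
  have h1 : Set.EqOn (pd δ (pot i j k)) (pot1 i j k δ) {x | 0 < (x k).im} :=
    fun y hy => (hasPd_pot hy).pd_eq δ
  have h2 : Set.EqOn (pd β (pd δ (pot i j k))) (pot2 i j k δ β) {x | 0 < (x k).im} :=
    fun y hy => (pd_congr hU h1 hy β).trans ((hasPd_pot1 hy δ).pd_eq β)
  exact (pd_congr hU h2 hx α).trans ((hasPd_pot2 hx δ β).pd_eq α)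

end Potential

/-! ### The closed WDVV equations -/

lemma F11_eq : F11 = pot 0 1 2 := by
  funext t
  simp only [F11, pot, gam0, e2, kc]
  ring

lemma lift_F11_eq : lift F11 = pot (0 : Fin 4) 1 2 := by
  rw [F11_eq]
  rfl

lemma cLow_F11 {t : Fin 3 → ℂ} (ht : 0 < (t 2).im) (α β δ : Fin 3) :
    cLow F11 t α β δ = pot3 0 1 2 δ β α t := by
  rw [F11_eq]
  exact cLow_pot ht α β δ

/-- The antidiagonal metric. -/
def etaMat : Matrix (Fin 3) (Fin 3) ℂ := !![0, 0, 1; 0, 1, 0; 1, 0, 0]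

lemma eta_F11 {t : Fin 3 → ℂ} (ht : 0 < (t 2).im) : eta F11 t = etaMat := by
  ext α β
  simp only [eta, Matrix.of_apply, cLow_F11 ht, etaMat]
  fin_cases α <;> fin_cases β <;> simp [pot3, kron]

lemma etaMat_mul_self : etaMat * etaMat = 1 := by
  ext α β
  fin_cases α <;> fin_cases β <;> simp [etaMat, Matrix.mul_apply, Fin.sum_univ_three]

lemma etaMat_inv : etaMat⁻¹ = etaMat := Matrix.inv_eq_left_inv etaMat_mul_self

lemma sum_etaMat (f : Fin 3 → ℂ) (g : Fin 3 → ℂ) :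
    ∑ μ, ∑ l, f μ * etaMat μ l * g l = f 0 * g 2 + f 1 * g 1 + f 2 * g 0 := by
  simp [Fin.sum_univ_three, etaMat]

lemma analyticAt_coord {n : ℕ} (i : Fin n) (t : Fin n → ℂ) :
    AnalyticAt ℂ (fun t : Fin n → ℂ => t i) t :=
  (ContinuousLinearMap.proj (R := ℂ) (φ := fun _ : Fin n => ℂ) i).analyticAt t

lemma analyticOnNhd_F11 : AnalyticOnNhd ℂ F11 U11 := by
  intro t ht
  have h0 := analyticAt_coord 0 t
  have h1 := analyticAt_coord 1 t
  have h2 := analyticAt_coord 2 t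
  have h3 : AnalyticAt ℂ (fun t : Fin 3 → ℂ => e2 (t 2)) t :=
    AnalyticAt.comp_of_eq (g := e2) (analyticAt_e2 ht) h2 rfl
  have h := (((h0.pow 2).mul h2).mul (analyticAt_const (v := (1 / 2 : ℂ)))).add
    ((h0.mul (h1.pow 2)).mul (analyticAt_const (v := (1 / 2 : ℂ)))) |>.add
    ((h1.pow 4).mul ((analyticAt_const (v := -(kc / 12))).mul h3))
  refine h.congr (.of_forall fun y => ?_)
  rw [F11_eq]
  simp only [Pi.add_apply, Pi.mul_apply, Pi.pow_apply, pot, gam0]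
  ring

theorem isWDVVSolution_F11 : IsWDVVSolution U11 F11 ![0, 1 / 2, 1] ![0, 0, 0] 1 where
  isOpen := isOpen_im_pos 2
  analytic := analyticOnNhd_F11
  metric := ⟨etaMat, by
    have h := congrArg Matrix.det etaMat_mul_self
    rw [Matrix.det_mul, Matrix.det_one] at h
    exact IsUnit.of_mul_eq_one _ h, fun t ht => eta_F11 ht⟩
  assoc := by
    intro t ht α β γ δ
    rw [eta_F11 ht, etaMat_inv]
    simp only [cLow_F11 ht]
    rw [sum_etaMat (fun μ => pot3 0 1 2 μ β α t) (fun l => pot3 0 1 2 δ γ l t),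
      sum_etaMat (fun μ => pot3 0 1 2 μ β γ t) (fun l => pot3 0 1 2 δ α l t)]
    have h := chazy (t 2)
    -- The only condition with content is F₂₂₃² = F₃₃₃ + F₂₂₂F₂₃₃, which is the Chazy equation times
    -- (t²)⁴.
    fin_cases α <;> fin_cases γ <;> fin_cases β <;> fin_cases δ <;>
      simp [pot3, kron, h] <;> ring
  -- With weights 1, 1/2, 0 the function F is exactly homogeneous of degree 2, so no polynomial
  -- correction is needed.
  quasihomogeneous := ⟨0, 0, 0, fun t ht => by
    have h : ∀ α, pd α F11 t = pot1 0 1 2 α t := fun α => by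
      rw [F11_eq]; exact (hasPd_pot ht).pd_eq α
    simp only [eulerDeriv, h, Fin.sum_univ_three]
    simp [F11_eq, pot, pot1, kron]
    ring⟩

/-! ### The Hessian of the open potential -/

section Open

variable {κ : ℂ} {x : Fin 4 → ℂ}

/-- The arguments of the theta function. -/
def zt (κ : ℂ) (x : Fin 4 → ℂ) : ℂ × ℂ := (κ * x 3, x 2)

lemma dlogTheta1_eq (κ p τ : ℂ) : dlogTheta1 κ p τ = κ * gTheta (κ * p) τ := by
  rw [dlogTheta1, gTheta, logDeriv_apply, logDeriv_apply]
  have h := deriv_comp_mul_left κ (fun z => theta1 z τ) p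
  rw [h, smul_eq_mul, mul_div_assoc]

lemma Omega11_eq (κ : ℂ) (x : Fin 4 → ℂ) :
    Omega11 κ x = x 0 * x 3 + coeff κ * κ * x 1 ^ 2 * gFun (zt κ x) := by
  rw [Omega11, dlogTheta1_eq, gFun, zt]
  ring

lemma kc_eq (hκ : κ ≠ 0) : kc = coeff κ * κ ^ 2 := by
  rw [kc, coeff]
  field_simp

lemma HasPd.comp_zt {G : ℂ × ℂ → ℂ} (hG : AnalyticAt ℂ G (zt κ x)) :
    HasPd (fun x => G (zt κ x))
      (fun α => dz G (zt κ x) * (κ * kron 3 α) + dt G (zt κ x) * kron 2 α) x :=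
  ((HasPd.coord 3 x).const_mul κ).comp₂ (HasPd.coord 2 x) hG.differentiableAt

lemma isOpen_V11 (κ : ℂ) : IsOpen (V11 κ) :=
  isOpen_thetaDom.preimage (f := zt κ)
    ((continuous_const.mul (continuous_apply 3)).prodMk (continuous_apply 2))

/-- The gradient of `Omega11`. -/
def om1 (κ : ℂ) (α : Fin 4) (x : Fin 4 → ℂ) : ℂ :=
  kron 0 α * x 3 + kron 1 α * (2 * coeff κ * κ * x 1 * gFun (zt κ x)) +
    kron 2 α * (coeff κ * κ * kc * x 1 ^ 2 *
      (wp' (zt κ x) - 2 * gFun (zt κ x) * dz gFun (zt κ x))) +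
    kron 3 α * (x 0 + coeff κ * κ ^ 2 * x 1 ^ 2 * dz gFun (zt κ x))

/-- The Hessian of `Omega11`. -/
def om2 (κ : ℂ) (α β : Fin 4) (x : Fin 4 → ℂ) : ℂ :=
  kron 0 α * kron 3 β +
    kron 1 α * (2 * coeff κ * κ * (kron 1 β * gFun (zt κ x) +
      x 1 * (κ * kron 3 β * dz gFun (zt κ x) +
        kron 2 β * kc * (wp' (zt κ x) - 2 * gFun (zt κ x) * dz gFun (zt κ x))))) +
    kron 2 α * (coeff κ * κ * kc * (2 * x 1 * kron 1 β *
        (wp' (zt κ x) - 2 * gFun (zt κ x) * dz gFun (zt κ x)) +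
      x 1 ^ 2 * (κ * kron 3 β * (dz wp' (zt κ x) - 2 * dz gFun (zt κ x) ^ 2 +
          2 * gFun (zt κ x) * wp' (zt κ x)) +
        kron 2 β * (dt wp' (zt κ x) -
          2 * kc * (wp' (zt κ x) - 2 * gFun (zt κ x) * dz gFun (zt κ x)) * dz gFun (zt κ x) -
          2 * gFun (zt κ x) * dt (dz gFun) (zt κ x))))) +
    kron 3 α * (kron 0 β + coeff κ * κ ^ 2 * (2 * x 1 * kron 1 β * dz gFun (zt κ x) +
      x 1 ^ 2 * (-κ * kron 3 β * wp' (zt κ x) + kron 2 β * dt (dz gFun) (zt κ x))))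

lemma dt_gFun_eq' {y : ℂ × ℂ} (hy : y ∈ thetaDom) :
    dt gFun y = kc * (wp' y - 2 * gFun y * dz gFun y) := by
  rw [dt_gFun_eq hy, dz_gFun]
  ring

/-- In `om1` the derivative ∂_τ g is already replaced by k(℘' - 2 g g_z). A further derivative then
needs only the τ-derivatives of g, g_z and ℘'. -/
lemma hasPd_Omega11 (hx : x ∈ V11 κ) : HasPd (Omega11 κ) (fun α => om1 κ α x) x := by
  have hz : zt κ x ∈ thetaDom := hx
  have hG := HasPd.comp_zt (analyticAt_gFun hz)
  have h := ((HasPd.coord 0 x).mul (HasPd.coord 3 x)).add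
    ((((HasPd.coord 1 x).pow 2).mul hG).const_mul (coeff κ * κ))
  refine (h.congr (.of_forall fun y => ?_)).congr_grad fun α => ?_
  · rw [Omega11_eq]; ring
  · simp only [om1, dt_gFun_eq' hz]
    simp only [kron, Nat.reduceSub, pow_one]
    push_cast
    ring

lemma hasPd_om1 (hx : x ∈ V11 κ) (α : Fin 4) : HasPd (om1 κ α) (fun β => om2 κ α β x) x := by
  have hz : zt κ x ∈ thetaDom := hx
  have hG := HasPd.comp_zt (analyticAt_gFun hz)
  have hD := HasPd.comp_zt (analyticAt_dz (analyticAt_gFun hz))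
  have hP := HasPd.comp_zt (analyticAt_wp' hz)
  have hc (i : Fin 4) := HasPd.coord i x
  have hm := hP.add ((hG.mul hD).const_mul (-2))
  have h := ((hc 3).const_mul (kron 0 α)).add
    (((hc 1).mul hG).const_mul (kron 1 α * (2 * coeff κ * κ))) |>.add
    ((((hc 1).pow 2).mul hm).const_mul (kron 2 α * (coeff κ * κ * kc))) |>.add
    (((hc 0).add ((((hc 1).pow 2).mul hD).const_mul (coeff κ * κ ^ 2))).const_mul (kron 3 α))
  refine (h.congr (.of_forall fun y => ?_)).congr_grad fun β => ?_
  · simp only [om1]; ring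
  · simp only [om2, dt_gFun_eq' hz, dz_dz_gFun hz]
    generalize kron 0 α = a
    generalize kron 1 α = b
    generalize kron 2 α = c
    generalize kron 3 α = d
    simp only [kron, Nat.reduceSub, pow_one]
    push_cast
    ring

lemma pd_Omega11 (hx : x ∈ V11 κ) (α : Fin 4) : pd α (Omega11 κ) x = om1 κ α x :=
  (hasPd_Omega11 hx).pd_eq α

lemma pd_pd_Omega11 (hx : x ∈ V11 κ) (α β : Fin 4) :
    pd α (pd β (Omega11 κ)) x = om2 κ β α x :=
  (pd_congr (isOpen_V11 κ) (fun _ hy => pd_Omega11 hy β) hx α).trans ((hasPd_om1 hx β).pd_eq α)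

/-- The inverse metric is antidiagonal, so raising an index exchanges t¹ with t³ and fixes t². -/
lemma openTerm_eq (hx : x ∈ V11 κ) (α β γ : Fin 4) :
    openTerm F11 (Omega11 κ) x α β γ =
      pot3 0 1 2 0 β α x * om2 κ γ 2 x + pot3 0 1 2 1 β α x * om2 κ γ 1 x +
        pot3 0 1 2 2 β α x * om2 κ γ 0 x + om2 κ β α x * om2 κ γ 3 x := by
  have hτ : 0 < (x 2).im := hx.1
  rw [openTerm, eta_F11 (t := fun i => x i.castSucc) hτ, etaMat_inv]
  simp only [lift_F11_eq, cLow_pot hτ, pd_pd_Omega11 hx]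
  rw [sum_etaMat (fun μ => pot3 0 1 2 μ.castSucc β α x) (fun l => om2 κ γ l.castSucc x)]
  rfl

set_option maxHeartbeats 2000000 in
theorem openTerm_comm (hκ : κ ≠ 0) (hx : x ∈ V11 κ) (α β γ : Fin 4) :
    openTerm F11 (Omega11 κ) x α β γ = openTerm F11 (Omega11 κ) x γ β α := by
  have hz : zt κ x ∈ thetaDom := hx
  rw [openTerm_eq hx, openTerm_eq hx]
  -- The one algebraic relation among the generators. With g₃ eliminated, the identities hold for g,
  -- ℘, ℘', E₂, g₂ as free variables.
  have h3 : g3 (x 2) = 4 * wp (zt κ x) ^ 3 - g2 (x 2) * wp (zt κ x) - wp' (zt κ x) ^ 2 := by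
    rw [wp'_sq hz]
    simp only [zt]
    ring
  simp only [om2, dz_wp' hz, dt_wp' hz, dt_dz_gFun hz, dz_gFun, pot3, gam0, gam1, gam2, gam3, h3]
  have h2 : (zt κ x).2 = x 2 := rfl
  rw [h2, kc_eq hκ]
  generalize wp (zt κ x) = P
  generalize wp' (zt κ x) = P'
  generalize gFun (zt κ x) = G
  generalize e2 (x 2) = e
  generalize g2 (x 2) = g
  generalize coeff κ = c
  fin_cases α <;> fin_cases γ <;> fin_cases β <;> simp [kron] <;> ring

end Open

/-! ### The superpotential as ∂_p Ω, and the open WDVV equations. -/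

section OpenSolution

variable {κ : ℂ} {x : Fin 4 → ℂ}

lemma lambda11_eq (hx : x ∈ V11 κ) :
    lambda11 κ x = x 0 + coeff κ * κ ^ 2 * x 1 ^ 2 * dz gFun (zt κ x) := by
  have hz : zt κ x ∈ thetaDom := hx
  have h1 : HasDerivAt (fun z => gFun (z, x 2)) (dz gFun (zt κ x)) (κ * x 3) :=
    hasDerivAt_dz (x := zt κ x) (analyticAt_gFun hz).differentiableAt
  have h2 : HasDerivAt (fun p => dlogTheta1 κ p (x 2)) (κ * (dz gFun (zt κ x) * κ)) (x 3) := by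
    simp only [dlogTheta1_eq]
    have h3 : HasDerivAt (fun p => κ * p) κ (x 3) := by
      simpa using (hasDerivAt_id (x 3)).const_mul κ
    exact (h1.comp (x 3) h3).const_mul κ
  rw [lambda11, h2.deriv]
  ring

lemma pd_last_Omega11 (hx : x ∈ V11 κ) : pd 3 (Omega11 κ) x = lambda11 κ x := by
  rw [pd_Omega11 hx, lambda11_eq hx]
  simp [om1, kron]

lemma analyticAt_zt (κ : ℂ) (x : Fin 4 → ℂ) : AnalyticAt ℂ (zt κ) x :=
  (analyticAt_const.mul (analyticAt_coord 3 x)).prod (analyticAt_coord 2 x)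

lemma analyticOnNhd_Omega11 (κ : ℂ) : AnalyticOnNhd ℂ (Omega11 κ) (V11 κ) := by
  intro x hx
  have hG : AnalyticAt ℂ (fun x => gFun (zt κ x)) x :=
    AnalyticAt.comp (g := gFun) (analyticAt_gFun (x := zt κ x) hx) (analyticAt_zt κ x)
  rw [funext (Omega11_eq κ)]
  exact ((analyticAt_coord 0 x).mul (analyticAt_coord 3 x)).add
    ((analyticAt_const.mul ((analyticAt_coord 1 x).pow 2)).mul hG)

theorem isOpenWDVVSolution_Omega11 (hκ : κ ≠ 0) :
    IsOpenWDVVSolution U11 F11 (V11 κ) (Omega11 κ) ![0, 1 / 2, 1] ![0, 0, 0] 1 where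
  closed := isWDVVSolution_F11
  isOpen := isOpen_V11 κ
  mapsTo _ hx := hx.1
  analytic := analyticOnNhd_Omega11 κ
  assoc _ hx α β γ := openTerm_comm hκ hx α β γ
  unit x hx β := by
    rw [pd_pd_Omega11 hx]
    fin_cases β <;> simp [om2, kron, Fin.ext_iff]
  quasihomogeneous := ⟨0, 0, fun x hx => by
    simp only [pd_Omega11 hx, Fin.sum_univ_three]
    simp [om1, kron, Omega11_eq, Fin.ext_iff]
    ring⟩

end OpenSolution

/-! ### Residues at simple zeros of the denominator -/

/-- Factor u = (z - c)v with v(c) = u' ≠ 0. Cauchy's formula for h/v makes the contour integral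
independent of ρ for small ρ, so the limit is attained. -/
theorem residue_div {h u f : ℂ → ℂ} {c u' : ℂ} (hh : AnalyticAt ℂ h c) (hu : AnalyticAt ℂ u c)
    (h0 : u c = 0) (hu' : HasDerivAt u u' c) (hne : u' ≠ 0)
    (hf : ∀ᶠ z in 𝓝 c, f z = h z / u z) : residue f c = h c / u' := by
  set v := dslope u c with hv
  have hvc : v c = u' := by rw [hv, dslope_same, hu'.deriv]
  have hva : AnalyticAt ℂ v c := by
    obtain ⟨p, hp⟩ := hu
    exact ⟨_, hp.has_fpower_series_dslope_fslope⟩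
  have hw : AnalyticAt ℂ (fun z => h z / v z) c := hh.fun_div hva (by rwa [hvc])
  obtain ⟨r, hr, hball⟩ := Metric.eventually_nhds_iff_ball.1 (hw.eventually_analyticAt.and hf)
  have hev : ∀ᶠ ρ in 𝓝[>] (0 : ℝ),
      (2 * (Real.pi : ℂ) * Complex.I)⁻¹ * (∮ z in C(c, ρ), f z) = h c / u' := by
    filter_upwards [Ioo_mem_nhdsGT hr] with ρ hρ
    have hsub : Metric.closedBall c ρ ⊆ Metric.ball c r := Metric.closedBall_subset_ball hρ.2
    have h1 : ∮ z in C(c, ρ), f z = ∮ z in C(c, ρ), (z - c)⁻¹ • (h z / v z) := by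
      refine circleIntegral.integral_congr hρ.1.le fun z hz => ?_
      have hzc : z ≠ c := by
        rintro rfl
        rw [Metric.mem_sphere, dist_self] at hz
        exact hρ.1.ne hz
      rw [(hball z (hsub (Metric.sphere_subset_closedBall hz))).2, hv, dslope_of_ne _ hzc,
        slope_def_field, h0, sub_zero, smul_eq_mul]
      have := sub_ne_zero.2 hzc
      field_simp
    have h2 : DiffContOnCl ℂ (fun z => h z / v z) (Metric.ball c ρ) :=
      DifferentiableOn.diffContOnCl_ball (U := Metric.ball c r) (fun z hz =>
        (hball z hz).1.differentiableAt.differentiableWithinAt) hsub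
    rw [h1, h2.circleIntegral_sub_inv_smul (Metric.mem_ball_self hρ.1), smul_eq_mul,
      ← mul_assoc, inv_mul_cancel₀ Complex.two_pi_I_ne_zero, one_mul, hvc]
  exact (tendsto_const_nhds.congr' (hev.mono fun _ h => h.symm)).limUnder_eq

/-! ### Lagrange sums -/

/-- The denominator at a root is half the derivative of 4z³ - gz - h, so each monomial z^m
contributes half of the complete homogeneous symmetric function of degree m - 2. As a + b + c = 0,
those of degrees 0 to 4 are 1, 0, g/4, h/4, g²/16, and m = 0, 1 contribute nothing. -/
lemma lagrange_sum {a b c : ℂ} (hab : a ≠ b) (hac : a ≠ c) (hbc : b ≠ c) (hs : a + b + c = 0)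
    {g h : ℂ} (hg : g = -4 * (a * b + a * c + b * c)) (hh : h = 4 * (a * b * c))
    (c0 c1 c2 c3 c4 c5 c6 : ℂ) (p : ℂ → ℂ)
    (hp : ∀ z, p z = c0 + c1 * z + c2 * z ^ 2 + c3 * z ^ 3 + c4 * z ^ 4 + c5 * z ^ 5 +
      c6 * z ^ 6) :
    p a / (6 * a ^ 2 - g / 2) + p b / (6 * b ^ 2 - g / 2) + p c / (6 * c ^ 2 - g / 2) =
      (c2 + c4 * g / 4 + c5 * h / 4 + c6 * g ^ 2 / 16) / 2 := by
  obtain rfl : c = -a - b := by linear_combination hs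
  have h1 := sub_ne_zero.2 hab
  have h2 : 2 * a + b ≠ 0 := by
    have := sub_ne_zero.2 hac
    intro h; apply this; linear_combination h
  have h3 : a + 2 * b ≠ 0 := by
    have := sub_ne_zero.2 hbc
    intro h; apply this; linear_combination h
  have e1 : 6 * a ^ 2 - g / 2 = 2 * (a - b) * (2 * a + b) := by rw [hg]; ring
  have e2 : 6 * b ^ 2 - g / 2 = -2 * (a - b) * (a + 2 * b) := by rw [hg]; ring
  have e3 : 6 * (-a - b) ^ 2 - g / 2 = 2 * (2 * a + b) * (a + 2 * b) := by rw [hg]; ring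
  rw [e1, e2, e3, hp, hp, hp, hg, hh]
  -- Opaque names keep the three root differences atomic while the denominators are cleared.
  obtain ⟨u, hu⟩ : ∃ u, u = a - b := ⟨_, rfl⟩
  obtain ⟨v, hv⟩ : ∃ v, v = 2 * a + b := ⟨_, rfl⟩
  obtain ⟨w, hw⟩ : ∃ w, w = a + 2 * b := ⟨_, rfl⟩
  rw [← hu] at h1 ⊢
  rw [← hv] at h2 ⊢
  rw [← hw] at h3 ⊢
  field_simp
  rw [hu, hv, hw]
  ring

/-- Because the roots sum to zero, this number is 2 ∏_{j≠i} (e_i - e_j). -/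
lemma rootE_denom_ne_zero {τ : ℂ} (hτ : 0 < τ.im) (i : Fin 3) :
    6 * rootE τ hτ i ^ 2 - (thetaPair τ hτ).g₂ / 2 ≠ 0 := by
  obtain ⟨h0, h2, -⟩ := rootE_vieta hτ
  have hne {i j : Fin 3} (hij : i ≠ j) : rootE τ hτ i - rootE τ hτ j ≠ 0 :=
    sub_ne_zero.2 ((rootE_injective hτ).ne hij)
  rw [h2]
  fin_cases i
  · have h := mul_ne_zero (mul_ne_zero two_ne_zero (hne (i := 0) (j := 1) (by decide)))
      (hne (i := 0) (j := 2) (by decide))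
    convert h using 1
    simp only [Fin.zero_eta]
    linear_combination 4 * rootE τ hτ 0 * h0
  · have h := mul_ne_zero (mul_ne_zero two_ne_zero (hne (i := 1) (j := 0) (by decide)))
      (hne (i := 1) (j := 2) (by decide))
    convert h using 1
    simp only [Fin.mk_one]
    linear_combination 4 * rootE τ hτ 1 * h0
  · have h := mul_ne_zero (mul_ne_zero two_ne_zero (hne (i := 2) (j := 0) (by decide)))
      (hne (i := 2) (j := 1) (by decide))
    convert h using 1
    simp only [Fin.reduceFinMk]
    linear_combination 4 * rootE τ hτ 2 * h0

lemma g2_eq {τ : ℂ} (hτ : 0 < τ.im) : g2 τ = (thetaPair τ hτ).g₂ := dif_pos hτ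

lemma g3_eq {τ : ℂ} (hτ : 0 < τ.im) : g3 τ = (thetaPair τ hτ).g₃ := dif_pos hτ

/-- The value of `∂_α λ` at a critical point at which the Weierstrass function takes the
value `z`. -/
def critVal (τ s : ℂ) (α : Fin 3) (z : ℂ) : ℂ :=
  (kron 0 α - kron 1 α * (2 * kc * s * e2 τ / 3) -
      kron 2 α * (kc ^ 2 * s ^ 2 * (2 / 9 * e2 τ ^ 2 + g2 τ / 2))) +
    (-kron 1 α * (2 * kc * s) - kron 2 α * (4 / 3 * kc ^ 2 * s ^ 2 * e2 τ)) * z +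
    kron 2 α * (4 * kc ^ 2 * s ^ 2) * z ^ 2

lemma kc_ne_zero : kc ≠ 0 := by
  simp [kc, Real.pi_ne_zero]

/-- Each factor is quadratic in the root, so the numerator has degree six; its coefficients are fed
into `lagrange_sum` and compared with F case by case. -/
theorem sum_critVal {t : Fin 3 → ℂ} (ht : t ∈ U11') (α β γ : Fin 3) :
    ∑ i, critVal (t 2) (t 1) α (rootE (t 2) ht.1 i) * critVal (t 2) (t 1) β (rootE (t 2) ht.1 i) *
        critVal (t 2) (t 1) γ (rootE (t 2) ht.1 i) /
          (6 * rootE (t 2) ht.1 i ^ 2 - g2 (t 2) / 2) =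
      2 * kc ^ 2 * t 1 ^ 2 * cLow F11 t α β γ := by
  obtain ⟨h0, h2, h3⟩ := rootE_vieta ht.1
  have hne {i j : Fin 3} (hij : i ≠ j) : rootE (t 2) ht.1 i ≠ rootE (t 2) ht.1 j :=
    (rootE_injective ht.1).ne hij
  rw [← g2_eq ht.1] at h2
  rw [← g3_eq ht.1] at h3
  rw [Fin.sum_univ_three]
  set A : Fin 3 → ℂ := fun α => kron 0 α - kron 1 α * (2 * kc * t 1 * e2 (t 2) / 3) -
    kron 2 α * (kc ^ 2 * t 1 ^ 2 * (2 / 9 * e2 (t 2) ^ 2 + g2 (t 2) / 2)) with hA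
  set B : Fin 3 → ℂ := fun α =>
    -kron 1 α * (2 * kc * t 1) - kron 2 α * (4 / 3 * kc ^ 2 * t 1 ^ 2 * e2 (t 2)) with hB
  set C : Fin 3 → ℂ := fun α => kron 2 α * (4 * kc ^ 2 * t 1 ^ 2) with hC
  have hv (α : Fin 3) (z : ℂ) : critVal (t 2) (t 1) α z = A α + B α * z + C α * z ^ 2 := rfl
  rw [lagrange_sum (hne (i := 0) (j := 1) (by decide)) (hne (i := 0) (j := 2) (by decide))
    (hne (i := 1) (j := 2) (by decide)) h0 h2 h3 (A α * A β * A γ)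
    (A α * A β * B γ + A α * B β * A γ + B α * A β * A γ)
    (A α * A β * C γ + A α * C β * A γ + C α * A β * A γ +
      A α * B β * B γ + B α * A β * B γ + B α * B β * A γ)
    (B α * B β * B γ + A α * B β * C γ + A α * C β * B γ + B α * A β * C γ + B α * C β * A γ +
      C α * A β * B γ + C α * B β * A γ)
    (B α * B β * C γ + B α * C β * B γ + C α * B β * B γ +
      A α * C β * C γ + C α * A β * C γ + C α * C β * A γ)
    (B α * C β * C γ + C α * B β * C γ + C α * C β * B γ) (C α * C β * C γ)
    (fun z => critVal (t 2) (t 1) α z * critVal (t 2) (t 1) β z * critVal (t 2) (t 1) γ z)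
    (fun z => by simp only [hv]; ring), cLow_F11 ht.1]
  simp only [hA, hB, hC, pot3, gam0, gam1, gam2, gam3]
  generalize kc = k
  generalize e2 (t 2) = e
  generalize g2 (t 2) = g
  generalize g3 (t 2) = h
  fin_cases α <;> fin_cases β <;> fin_cases γ <;> simp [kron] <;> ring

/-! ### The superpotential on the torus -/

section Superpotential

variable {κ : ℂ} {t : Fin 3 → ℂ} {p : ℂ}

/-- The period lattice of the superpotential. -/
def lamPair (κ : ℂ) (t : Fin 3 → ℂ) : PeriodPair :=
  open Classical in
  if h : κ ≠ 0 ∧ t ∈ U11' then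
    periodPair (Real.pi / κ) (t 2) (div_ne_zero (by exact_mod_cast Real.pi_ne_zero) h.1) h.2.1
  -- A default lattice where λ has no period lattice of the required form; it is never used.
  else periodPair 1 Complex.I one_ne_zero (by simp)

lemma lamPair_ω₁ (hκ : κ ≠ 0) (ht : t ∈ U11') : (lamPair κ t).ω₁ = Real.pi / κ := by
  rw [lamPair, dif_pos ⟨hκ, ht⟩, periodPair]

lemma lamPair_ω₂ (hκ : κ ≠ 0) (ht : t ∈ U11') : (lamPair κ t).ω₂ = Real.pi * t 2 / κ := by
  rw [lamPair, dif_pos ⟨hκ, ht⟩, periodPair]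
  ring

lemma mem_lamPair_iff (hκ : κ ≠ 0) (ht : t ∈ U11') :
    p ∈ (lamPair κ t).lattice ↔ κ * p ∈ (thetaPair (t 2) ht.1).lattice := by
  rw [PeriodPair.mem_lattice, PeriodPair.mem_lattice, lamPair_ω₁ hκ ht, lamPair_ω₂ hκ ht]
  refine exists_congr fun m => exists_congr fun n => ?_
  simp only [thetaPair, periodPair]
  rw [← (mul_right_injective₀ hκ).eq_iff]
  have : κ * (m * (Real.pi / κ) + n * (Real.pi * t 2 / κ)) = m * Real.pi + n * (Real.pi * t 2) := by
    field_simp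
  rw [this]

lemma pt_coord (t : Fin 3 → ℂ) (p : ℂ) :
    pt t p 0 = t 0 ∧ pt t p 1 = t 1 ∧ pt t p 2 = t 2 ∧ pt t p 3 = p :=
  ⟨rfl, rfl, rfl, rfl⟩

lemma zt_pt (κ : ℂ) (t : Fin 3 → ℂ) (p : ℂ) : zt κ (pt t p) = (κ * p, t 2) := rfl

lemma pt_mem_V11 (hκ : κ ≠ 0) (ht : t ∈ U11') (hp : p ∉ (lamPair κ t).lattice) :
    pt t p ∈ V11 κ := by
  refine ⟨ht.1, fun h => hp ((mem_lamPair_iff hκ ht).2 ?_)⟩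
  exact (theta1_eq_zero_iff ht.1 _).1 h

lemma lambda11_pt (hκ : κ ≠ 0) (ht : t ∈ U11') (hp : p ∉ (lamPair κ t).lattice) :
    lambda11 κ (pt t p) =
      t 0 - kc * t 1 ^ 2 * ((thetaPair (t 2) ht.1).weierstrassP (κ * p) + e2 (t 2) / 3) := by
  have hx := pt_mem_V11 hκ ht hp
  have hz : zt κ (pt t p) ∈ thetaDom := hx
  rw [lambda11_eq hx, dz_gFun, wp_eq hz, ← kc_eq hκ]
  simp only [zt_pt, pt_coord]
  ring

lemma pd_lambda11 {x : Fin 4 → ℂ} (hx : x ∈ V11 κ) (α : Fin 4) :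
    pd α (lambda11 κ) x = om2 κ 3 α x :=
  (pd_congr (isOpen_V11 κ) (fun _ hy => (pd_last_Omega11 hy).symm) hx α).trans
    (pd_pd_Omega11 hx α 3)

lemma pd_last_lambda11 {x : Fin 4 → ℂ} (hx : x ∈ V11 κ) :
    pd 3 (lambda11 κ) x = -(coeff κ * κ ^ 3) * (x 1 ^ 2 * wp' (zt κ x)) := by
  rw [pd_lambda11 hx]
  simp [om2, kron]
  ring

lemma pd_last_lambda11_pt (hκ : κ ≠ 0) (ht : t ∈ U11') (hp : p ∉ (lamPair κ t).lattice) :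
    pd 3 (lambda11 κ) (pt t p) =
      -(kc * κ * t 1 ^ 2) * (thetaPair (t 2) ht.1).derivWeierstrassP (κ * p) := by
  have hx := pt_mem_V11 hκ ht hp
  have hz : zt κ (pt t p) ∈ thetaDom := hx
  rw [pd_last_lambda11 hx, wp'_eq hz, kc_eq hκ]
  simp only [zt_pt, pt_coord]
  ring

lemma pd_last_pd_last_lambda11 {x : Fin 4 → ℂ} (hx : x ∈ V11 κ) :
    pd 3 (pd 3 (lambda11 κ)) x =
      -(coeff κ * κ ^ 4) * (x 1 ^ 2 * (6 * wp (zt κ x) ^ 2 - g2 (x 2) / 2)) := by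
  have hz : zt κ x ∈ thetaDom := hx
  have h := (((HasPd.coord 1 x).pow 2).mul (HasPd.comp_zt (analyticAt_wp' hz))).const_mul
    (-(coeff κ * κ ^ 3))
  rw [pd_congr (isOpen_V11 κ) (fun y hy => pd_last_lambda11 hy) hx, h.pd_eq, dz_wp' hz]
  simp [kron, zt]
  ring

lemma hasDerivAt_derivWeierstrassP_mul (hκ : κ ≠ 0) (ht : t ∈ U11')
    (hp : p ∉ (lamPair κ t).lattice) :
    HasDerivAt (fun p => (thetaPair (t 2) ht.1).derivWeierstrassP (κ * p))
      ((6 * (thetaPair (t 2) ht.1).weierstrassP (κ * p) ^ 2 - (thetaPair (t 2) ht.1).g₂ / 2) * κ)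
      p := by
  have hz := (mem_lamPair_iff (p := p) hκ ht).not.1 hp
  have h1 := ((thetaPair (t 2) ht.1).analyticOnNhd_derivWeierstrassP _ hz).differentiableAt.hasDerivAt
  rw [deriv_derivWeierstrassP ht.1 hz] at h1
  have h3 : HasDerivAt (fun p => κ * p) κ p := by simpa using (hasDerivAt_id p).const_mul κ
  exact h1.comp p h3

lemma deriv_lambda11_pt (hκ : κ ≠ 0) (ht : t ∈ U11') (hp : p ∉ (lamPair κ t).lattice) :
    deriv (fun p => lambda11 κ (pt t p)) p =
      -(kc * κ * t 1 ^ 2) * (thetaPair (t 2) ht.1).derivWeierstrassP (κ * p) := by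
  have hz := (mem_lamPair_iff (p := p) hκ ht).not.1 hp
  have h1 := ((thetaPair (t 2) ht.1).analyticOnNhd_weierstrassP _ hz).differentiableAt.hasDerivAt
  rw [PeriodPair.deriv_weierstrassP] at h1
  have h3 : HasDerivAt (fun p => κ * p) κ p := by simpa using (hasDerivAt_id p).const_mul κ
  have h4 := (((h1.comp p h3).add_const (e2 (t 2) / 3)).const_mul (kc * t 1 ^ 2)).const_sub (t 0)
  have h5 : (fun p => lambda11 κ (pt t p)) =ᶠ[𝓝 p] fun p => t 0 -
      kc * t 1 ^ 2 * ((thetaPair (t 2) ht.1).weierstrassP (κ * p) + e2 (t 2) / 3) := by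
    filter_upwards [compl_lattice_mem_nhds hp] with q hq using lambda11_pt hκ ht hq
  rw [h5.deriv_eq]
  refine h4.deriv.trans ?_
  ring

lemma isH11Covering_lambda11 (hκ : κ ≠ 0) (ht : t ∈ U11') :
    IsH11Covering (lamPair κ t) fun p => lambda11 κ (pt t p) where
  periodic p hp ω hω := by
    have h : p + ω ∉ (lamPair κ t).lattice := fun h =>
      hp (by simpa using (lamPair κ t).lattice.sub_mem h hω)
    have h1 := (thetaPair (t 2) ht.1).weierstrassP_add_coe (κ * p)
      ⟨κ * ω, (mem_lamPair_iff hκ ht).1 hω⟩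
    simp only [lambda11_pt hκ ht h, lambda11_pt hκ ht hp, mul_add, h1]
  analytic p hp := by
    have hz := (mem_lamPair_iff (p := p) hκ ht).not.1 hp
    have h1 : AnalyticAt ℂ (fun p => (thetaPair (t 2) ht.1).weierstrassP (κ * p)) p :=
      AnalyticAt.comp_of_eq ((thetaPair (t 2) ht.1).analyticOnNhd_weierstrassP _ hz)
        (analyticAt_const.mul analyticAt_id) rfl
    have h2 : AnalyticAt ℂ (fun p => t 0 - kc * t 1 ^ 2 *
        ((thetaPair (t 2) ht.1).weierstrassP (κ * p) + e2 (t 2) / 3)) p :=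
      analyticAt_const.sub (analyticAt_const.mul (h1.add analyticAt_const))
    refine h2.congr ?_
    filter_upwards [compl_lattice_mem_nhds hp] with q hq using (lambda11_pt hκ ht hq).symm
  pole := by
    set P := (thetaPair (t 2) ht.1).weierstrassP with hP
    have hg : AnalyticAt ℂ (fun p => κ * p) 0 := analyticAt_const.mul analyticAt_id
    have hg' : deriv (fun p => κ * p) 0 ≠ 0 := by
      rw [deriv_const_mul_field, deriv_id'', mul_one]
      exact hκ
    have hm : MeromorphicAt (P ∘ fun p => κ * p) 0 := by
      rw [meromorphicAt_comp_iff_of_deriv_ne_zero hg hg']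
      exact (thetaPair (t 2) ht.1).meromorphic_weierstrassP _
    have ho : meromorphicOrderAt (P ∘ fun p => κ * p) 0 = -2 := by
      rw [meromorphicOrderAt_comp_of_deriv_ne_zero hg hg']
      exact (thetaPair (t 2) ht.1).order_weierstrassP _ (by simp)
    -- Off the lattice λ = c ℘(κp) + d. The condition t² ≠ 0 gives c ≠ 0, and adding the constant d
    -- does not affect a pole of order two.
    set c : ℂ := -(kc * t 1 ^ 2) with hc
    have hc0 : c ≠ 0 := neg_ne_zero.2 (mul_ne_zero kc_ne_zero (pow_ne_zero _ ht.2))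
    have hcm : MeromorphicAt (fun _ : ℂ => c) 0 := MeromorphicAt.const c 0
    set d : ℂ := t 0 - kc * t 1 ^ 2 * (e2 (t 2) / 3) with hd
    have hdm : MeromorphicAt (fun _ : ℂ => d) 0 := MeromorphicAt.const d 0
    have ho1 : meromorphicOrderAt ((fun _ : ℂ => c) * (P ∘ fun p => κ * p)) 0 = -2 := by
      rw [meromorphicOrderAt_mul hcm hm, ho, meromorphicOrderAt_const, if_neg hc0, zero_add]
    have ho2 : meromorphicOrderAt (((fun _ : ℂ => c) * (P ∘ fun p => κ * p)) + fun _ => d) 0 =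
        -2 := by
      rw [meromorphicOrderAt_add_eq_left_of_lt hdm, ho1]
      rw [ho1]
      refine lt_of_lt_of_le ?_ (analyticAt_const (v := d)).meromorphicOrderAt_nonneg
      exact WithTop.coe_lt_coe.2 (by norm_num : (-2 : ℤ) < 0)
    have hev : ((fun _ : ℂ => c) * (P ∘ fun p => κ * p)) + (fun _ => d) =ᶠ[𝓝[≠] 0]
        fun p => lambda11 κ (pt t p) := by
      filter_upwards [eventually_notMem_lattice (lamPair κ t)] with q hq
      rw [lambda11_pt hκ ht hq]
      simp only [Pi.add_apply, Pi.mul_apply, Function.comp_apply, hc, hd, hP]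
      ring
    exact ⟨((hcm.mul hm).add hdm).congr hev, (meromorphicOrderAt_congr hev).symm.trans ho2⟩

/-! ### Critical points -/

lemma deriv_lambda11_eq_zero_iff (hκ : κ ≠ 0) (ht : t ∈ U11') (hp : p ∉ (lamPair κ t).lattice) :
    deriv (fun p => lambda11 κ (pt t p)) p = 0 ↔
      2 * (κ * p) ∈ (thetaPair (t 2) ht.1).lattice := by
  rw [deriv_lambda11_pt hκ ht hp,
    ← derivWeierstrassP_eq_zero_iff ht.1 ((mem_lamPair_iff hκ ht).not.1 hp),
    mul_eq_zero_iff_left]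
  exact neg_ne_zero.2 (mul_ne_zero (mul_ne_zero kc_ne_zero hκ) (pow_ne_zero _ ht.2))

lemma pd_last_eq_deriv (hκ : κ ≠ 0) (ht : t ∈ U11') (hp : p ∉ (lamPair κ t).lattice) :
    pd 3 (lambda11 κ) (pt t p) = deriv (fun p => lambda11 κ (pt t p)) p := by
  rw [pd_last_lambda11_pt hκ ht hp, deriv_lambda11_pt hκ ht hp]

/-- The critical points of the superpotential. -/
def critPt (κ : ℂ) (t : Fin 3 → ℂ) (i : Fin 3) : ℂ := halfPeriod (t 2) i / κ

lemma mul_critPt (hκ : κ ≠ 0) (i : Fin 3) : κ * critPt κ t i = halfPeriod (t 2) i :=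
  mul_div_cancel₀ _ hκ

lemma critPt_notMem (hκ : κ ≠ 0) (ht : t ∈ U11') (i : Fin 3) :
    critPt κ t i ∉ (lamPair κ t).lattice := by
  rw [mem_lamPair_iff hκ ht, mul_critPt hκ]
  exact halfPeriod_notMem ht.1 i

lemma deriv_critPt (hκ : κ ≠ 0) (ht : t ∈ U11') (i : Fin 3) :
    deriv (fun p => lambda11 κ (pt t p)) (critPt κ t i) = 0 := by
  rw [deriv_lambda11_eq_zero_iff hκ ht (critPt_notMem hκ ht i), mul_critPt hκ]
  exact two_mul_halfPeriod_mem ht.1 i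

lemma eq_of_critPt_sub_mem (hκ : κ ≠ 0) (ht : t ∈ U11') {i j : Fin 3}
    (h : critPt κ t i - critPt κ t j ∈ (lamPair κ t).lattice) : i = j := by
  rw [mem_lamPair_iff hκ ht, mul_sub, mul_critPt hκ, mul_critPt hκ] at h
  rcases lt_trichotomy i j with hij | hij | hij
  · refine absurd ?_ (halfPeriod_sub_notMem ht.1 hij)
    simpa using (thetaPair (t 2) ht.1).lattice.neg_mem h
  · exact hij
  · exact absurd h (halfPeriod_sub_notMem ht.1 hij)

lemma exists_sub_critPt_mem (hκ : κ ≠ 0) (ht : t ∈ U11') (hp : p ∉ (lamPair κ t).lattice)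
    (hd : deriv (fun p => lambda11 κ (pt t p)) p = 0) :
    ∃ i, p - critPt κ t i ∈ (lamPair κ t).lattice := by
  obtain ⟨i, hi⟩ := exists_sub_halfPeriod_mem ht.1 ((mem_lamPair_iff hκ ht).not.1 hp)
    ((deriv_lambda11_eq_zero_iff hκ ht hp).1 hd)
  refine ⟨i, ?_⟩
  rwa [mem_lamPair_iff hκ ht, mul_sub, mul_critPt hκ]

lemma weierstrassP_of_sub_critPt_mem (hκ : κ ≠ 0) (ht : t ∈ U11') {i : Fin 3}
    (h : p - critPt κ t i ∈ (lamPair κ t).lattice) :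
    (thetaPair (t 2) ht.1).weierstrassP (κ * p) = rootE (t 2) ht.1 i := by
  have h1 := (thetaPair (t 2) ht.1).weierstrassP_add_coe (halfPeriod (t 2) i)
    ⟨_, (mem_lamPair_iff hκ ht).1 h⟩
  rw [rootE, ← h1]
  simp only [mul_sub, mul_critPt hκ, add_sub_cancel]

theorem isCriticalSystem_critPt (hκ : κ ≠ 0) (ht : t ∈ U11') :
    IsCriticalSystem (lamPair κ t) (fun p => lambda11 κ (pt t p))
      (Finset.univ.image (critPt κ t)) where
  critical s hs := by
    obtain ⟨i, -, rfl⟩ := Finset.mem_image.1 hs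
    exact ⟨critPt_notMem hκ ht i, deriv_critPt hκ ht i⟩
  complete p hp hd := by
    obtain ⟨i, hi⟩ := exists_sub_critPt_mem hκ ht hp hd
    refine ⟨critPt κ t i, ⟨Finset.mem_image_of_mem _ (Finset.mem_univ i), hi⟩, ?_⟩
    rintro s ⟨hs, hps⟩
    obtain ⟨j, -, rfl⟩ := Finset.mem_image.1 hs
    rw [eq_of_critPt_sub_mem hκ ht (i := j) (j := i)]
    simpa using (lamPair κ t).lattice.sub_mem hi hps

lemma critPt_injective (hκ : κ ≠ 0) (ht : t ∈ U11') : Function.Injective (critPt κ t) :=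
  fun _ _ h => eq_of_critPt_sub_mem hκ ht (by simp [h])

lemma IsCriticalSystem.eq_of_sub_mem {L : PeriodPair} {f : ℂ → ℂ} {S : Finset ℂ}
    (hS : IsCriticalSystem L f S) {s s' : ℂ} (hs : s ∈ S) (hs' : s' ∈ S)
    (h : s - s' ∈ L.lattice) : s = s' :=
  (hS.complete s (hS.critical s hs).1 (hS.critical s hs).2).unique ⟨hs, by simp⟩ ⟨hs', h⟩

/-- The value ℘(κs) depends only on the class of s modulo the lattice, so every system of
representatives gives the same sum as the half periods. -/
theorem sum_criticalSystem (hκ : κ ≠ 0) (ht : t ∈ U11') {S : Finset ℂ}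
    (hS : IsCriticalSystem (lamPair κ t) (fun p => lambda11 κ (pt t p)) S) (Φ : ℂ → ℂ) :
    ∑ s ∈ S, Φ ((thetaPair (t 2) ht.1).weierstrassP (κ * s)) =
      ∑ i, Φ (rootE (t 2) ht.1 i) := by
  have hex (i : Fin 3) : ∃ s ∈ S, critPt κ t i - s ∈ (lamPair κ t).lattice :=
    (hS.complete _ (critPt_notMem hκ ht i) (deriv_critPt hκ ht i)).exists
  choose σ hσ hσ' using hex
  symm
  refine Finset.sum_bij (fun i _ => σ i) (fun i _ => hσ i) (fun i _ j _ hij => ?_)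
    (fun s hs => ?_) (fun i _ => ?_)
  · refine eq_of_critPt_sub_mem hκ ht ?_
    have := (lamPair κ t).lattice.sub_mem (hσ' i) (hσ' j)
    simpa [hij] using this
  · obtain ⟨i, hi⟩ := exists_sub_critPt_mem hκ ht (hS.critical s hs).1 (hS.critical s hs).2
    refine ⟨i, Finset.mem_univ i, (hS.eq_of_sub_mem hs (hσ i) ?_).symm⟩
    simpa using (lamPair κ t).lattice.add_mem hi (hσ' i)
  · rw [weierstrassP_of_sub_critPt_mem hκ ht (i := i)]
    simpa using (lamPair κ t).lattice.neg_mem (hσ' i)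

/-! ### Residues at the critical points -/

lemma analyticAt_pd_lambda11_pt (hκ : κ ≠ 0) (ht : t ∈ U11')
    (hp : p ∉ (lamPair κ t).lattice) (α : Fin 4) :
    AnalyticAt ℂ (fun p => pd α (lambda11 κ) (pt t p)) p := by
  have hz : zt κ (pt t p) ∈ thetaDom := pt_mem_V11 hκ ht hp
  have hl : AnalyticAt ℂ (fun p => zt κ (pt t p)) p :=
    (analyticAt_const.mul analyticAt_id).prod analyticAt_const
  have hc {G : ℂ × ℂ → ℂ} (hG : AnalyticAt ℂ G (zt κ (pt t p))) :
      AnalyticAt ℂ (fun p => G (zt κ (pt t p))) p := AnalyticAt.comp_of_eq hG hl rfl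
  have h1 := hc (analyticAt_dz (analyticAt_gFun hz))
  have h2 := hc (analyticAt_wp' hz)
  have h3 := hc (analyticAt_dt (analyticAt_dz (analyticAt_gFun hz)))
  have h : AnalyticAt ℂ (fun p => kron 0 α + coeff κ * κ ^ 2 *
      (2 * t 1 * kron 1 α * dz gFun (zt κ (pt t p)) +
        t 1 ^ 2 * (-κ * kron 3 α * wp' (zt κ (pt t p)) +
          kron 2 α * dt (dz gFun) (zt κ (pt t p))))) p := by
    fun_prop
  refine h.congr ?_
  filter_upwards [compl_lattice_mem_nhds hp] with q hq
  rw [pd_lambda11 (pt_mem_V11 hκ ht hq)]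
  simp [om2, kron, pt_coord]

/-- In ∂_τ λ the function g, which is not elliptic, occurs only multiplied by ℘'. At critical points
this term vanishes, and what is left is a polynomial in ℘; in particular it is the same for all
representatives. -/
lemma pd_lambda11_critical (hκ : κ ≠ 0) (ht : t ∈ U11') (hp : p ∉ (lamPair κ t).lattice)
    (hd : deriv (fun p => lambda11 κ (pt t p)) p = 0) (α : Fin 3) :
    pd α.castSucc (lambda11 κ) (pt t p) =
      critVal (t 2) (t 1) α ((thetaPair (t 2) ht.1).weierstrassP (κ * p)) := by
  have hx := pt_mem_V11 hκ ht hp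
  have hz : zt κ (pt t p) ∈ thetaDom := hx
  have hw : wp' (zt κ (pt t p)) = 0 := by
    rw [wp'_eq hz]
    exact (derivWeierstrassP_eq_zero_iff ht.1 ((mem_lamPair_iff hκ ht).not.1 hp)).2
      ((deriv_lambda11_eq_zero_iff hκ ht hp).1 hd)
  have hw' : wp (zt κ (pt t p)) = (thetaPair (t 2) ht.1).weierstrassP (κ * p) := wp_eq hz
  rw [pd_lambda11 hx, om2, dt_dz_gFun hz, dz_gFun, hw, hw', ← kc_eq hκ]
  simp only [zt_pt, pt_coord, critVal]
  fin_cases α <;> simp [kron, Fin.ext_iff] <;> ring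

lemma hasDerivAt_pd_last (hκ : κ ≠ 0) (ht : t ∈ U11') (hp : p ∉ (lamPair κ t).lattice) :
    HasDerivAt (fun p => pd 3 (lambda11 κ) (pt t p))
      (-(kc * κ ^ 2 * t 1 ^ 2) *
        (6 * (thetaPair (t 2) ht.1).weierstrassP (κ * p) ^ 2 - g2 (t 2) / 2)) p := by
  have h := (hasDerivAt_derivWeierstrassP_mul hκ ht hp).const_mul (-(kc * κ * t 1 ^ 2))
  refine (h.congr_of_eventuallyEq ?_).congr_deriv ?_
  · filter_upwards [compl_lattice_mem_nhds hp] with q hq using pd_last_lambda11_pt hκ ht hq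
  · rw [g2_eq ht.1]; ring

lemma weierstrassP_denom_ne_zero (hκ : κ ≠ 0) (ht : t ∈ U11') (hp : p ∉ (lamPair κ t).lattice)
    (hd : deriv (fun p => lambda11 κ (pt t p)) p = 0) :
    6 * (thetaPair (t 2) ht.1).weierstrassP (κ * p) ^ 2 - g2 (t 2) / 2 ≠ 0 := by
  obtain ⟨i, hi⟩ := exists_sub_critPt_mem hκ ht hp hd
  rw [weierstrassP_of_sub_critPt_mem hκ ht hi, g2_eq ht.1]
  exact rootE_denom_ne_zero ht.1 i

lemma residue_critical (hκ : κ ≠ 0) (ht : t ∈ U11') (hp : p ∉ (lamPair κ t).lattice)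
    (hd : deriv (fun p => lambda11 κ (pt t p)) p = 0) {h : ℂ → ℂ} (hh : AnalyticAt ℂ h p) :
    residue (fun p => h p / pd 3 (lambda11 κ) (pt t p)) p =
      h p / (-(kc * κ ^ 2 * t 1 ^ 2) *
        (6 * (thetaPair (t 2) ht.1).weierstrassP (κ * p) ^ 2 - g2 (t 2) / 2)) := by
  refine residue_div hh (analyticAt_pd_lambda11_pt hκ ht hp 3) ?_ (hasDerivAt_pd_last hκ ht hp)
    (mul_ne_zero ?_ (weierstrassP_denom_ne_zero hκ ht hp hd)) (.of_forall fun _ => rfl)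
  · rw [pd_last_eq_deriv hκ ht hp, hd]
  · exact neg_ne_zero.2
      (mul_ne_zero (mul_ne_zero kc_ne_zero (pow_ne_zero _ hκ)) (pow_ne_zero _ ht.2))

/-- The form in which N cancels the factor -k κ² (t²)² of λ'' against the 2k² (t²)² of
`sum_critVal`. -/
lemma normalization (hκ : κ ≠ 0) :
    2 * Complex.I * κ ^ 2 / Real.pi = -κ ^ 2 / (2 * kc) := by
  have hpi : (Real.pi : ℂ) ≠ 0 := by exact_mod_cast Real.pi_ne_zero
  rw [kc]
  field_simp
  rw [Complex.I_sq]
  norm_num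

/-- At a simple zero of ∂_p λ the residue sees only the value of the numerator there. So `h` is
prescribed only on S, which lets one statement cover both the metric and the structure constants. -/
theorem cLow_F11_eq_sum_residue (hκ : κ ≠ 0) (ht : t ∈ U11') {S : Finset ℂ}
    (hS : IsCriticalSystem (lamPair κ t) (fun p => lambda11 κ (pt t p)) S) (α β γ : Fin 3)
    {h : ℂ → ℂ} (hh : ∀ s ∈ S, AnalyticAt ℂ h s)
    (hv : ∀ s ∈ S, h s = pd α.castSucc (lambda11 κ) (pt t s) *
      pd β.castSucc (lambda11 κ) (pt t s) * pd γ.castSucc (lambda11 κ) (pt t s)) :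
    cLow F11 t α β γ = 2 * Complex.I * κ ^ 2 / Real.pi *
      ∑ s ∈ S, residue (fun p => h p / pd 3 (lambda11 κ) (pt t p)) s := by
  set c : ℂ := -(kc * κ ^ 2 * t 1 ^ 2) with hc
  have hsum : ∑ s ∈ S, residue (fun p => h p / pd 3 (lambda11 κ) (pt t p)) s =
      c⁻¹ * (2 * kc ^ 2 * t 1 ^ 2 * cLow F11 t α β γ) := by
    rw [← sum_critVal ht, ← sum_criticalSystem hκ ht hS (fun z => critVal (t 2) (t 1) α z *
      critVal (t 2) (t 1) β z * critVal (t 2) (t 1) γ z / (6 * z ^ 2 - g2 (t 2) / 2)),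
      Finset.mul_sum]
    refine Finset.sum_congr rfl fun s hs => ?_
    obtain ⟨h1, h2⟩ := hS.critical s hs
    rw [residue_critical hκ ht h1 h2 (hh s hs), hv s hs]
    simp only [pd_lambda11_critical hκ ht h1 h2, ← hc]
    rw [div_mul_eq_div_div, div_eq_mul_inv _ c]
    ring
  rw [hsum, normalization hκ, hc]
  have := kc_ne_zero
  have := ht.2
  field_simp

theorem isH11Potential_F11 (hκ : κ ≠ 0) :
    IsH11Potential U11' F11 (lamPair κ) (lambda11 κ) (2 * Complex.I * κ ^ 2 / Real.pi)
      ![0, 1 / 2, 1] ![0, 0, 0] where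
  covering t ht := isH11Covering_lambda11 hκ ht
  exists_criticalSystem t ht := ⟨_, isCriticalSystem_critPt hκ ht, by
    rw [Finset.card_image_of_injective _ (critPt_injective hκ ht), Finset.card_univ,
      Fintype.card_fin]⟩
  simple t ht p hp hd := by
    rw [pd_last_eq_deriv hκ ht hp] at hd
    have hx := pt_mem_V11 hκ ht hp
    have hw : wp (zt κ (pt t p)) = (thetaPair (t 2) ht.1).weierstrassP (κ * p) := wp_eq hx
    rw [pd_last_pd_last_lambda11 hx, hw]
    have hne : coeff κ * κ ^ 4 = kc * κ ^ 2 := by rw [kc_eq hκ]; ring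
    rw [hne]
    exact mul_ne_zero (neg_ne_zero.2 (mul_ne_zero kc_ne_zero (pow_ne_zero _ hκ)))
      (mul_ne_zero (pow_ne_zero _ ht.2) (weierstrassP_denom_ne_zero hκ ht hp hd))
  distinct t ht S hS s hs s' hs' h := by
    obtain ⟨h1, -⟩ := hS.critical s hs
    obtain ⟨h2, h3⟩ := hS.critical s' hs'
    simp only [lambda11_pt hκ ht h1, lambda11_pt hκ ht h2] at h
    have h4 := add_right_cancel (mul_left_cancel₀
      (mul_ne_zero kc_ne_zero (pow_ne_zero _ ht.2)) (sub_right_injective h))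
    refine hS.eq_of_sub_mem hs hs' ((mem_lamPair_iff hκ ht).2 ?_)
    -- Equal critical values mean equal values of ℘, hence κs ≡ ±κs'. Since 2κs' lies in the
    -- lattice, the two signs agree.
    rcases (weierstrassP_eq_iff ht.1 ((mem_lamPair_iff hκ ht).not.1 h1)
      ((mem_lamPair_iff hκ ht).not.1 h2)).1 h4 with h5 | h5
    · rwa [mul_sub]
    · have h6 := (thetaPair (t 2) ht.1).lattice.sub_mem h5
        ((deriv_lambda11_eq_zero_iff hκ ht h2).1 h3)
      convert h6 using 1
      ring
  euler t ht p hp _ := by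
    have hx := pt_mem_V11 hκ ht hp
    simp only [pd_lambda11 hx, Fin.sum_univ_three, lambda11_eq hx]
    simp [om2, kron, pt_coord, Fin.ext_iff]
    ring
  metric t ht S hS α β := by
    have ha (s) (hs : s ∈ S) := analyticAt_pd_lambda11_pt hκ ht (hS.critical s hs).1
    refine cLow_F11_eq_sum_residue hκ ht hS 0 α β (fun s hs => (ha s hs _).mul (ha s hs _))
      fun s hs => ?_
    -- As ∂₁λ = 1, the metric is the case of the structure constants with first index ∂₁.
    have h0 : pd (0 : Fin 3).castSucc (lambda11 κ) (pt t s) = 1 := by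
      rw [pd_lambda11 (pt_mem_V11 hκ ht (hS.critical s hs).1)]
      simp [om2, kron]
    rw [h0, one_mul]
  structureConstants t ht S hS α β γ := by
    have ha (s) (hs : s ∈ S) := analyticAt_pd_lambda11_pt hκ ht (hS.critical s hs).1
    exact cLow_F11_eq_sum_residue hκ ht hS α β γ
      (fun s hs => ((ha s hs _).mul (ha s hs _)).mul (ha s hs _)) fun s hs => rfl

end Superpotential

end OpenWDVV

end

theorem mainTheorem4 (κ : ℂ) (hκ : κ ≠ 0) :
    OpenWDVV.IsOpenWDVVSolution OpenWDVV.U11 OpenWDVV.F11 (OpenWDVV.V11 κ) (OpenWDVV.Omega11 κ)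
        ![0, 1 / 2, 1] ![0, 0, 0] 1 ∧
      (∀ x ∈ OpenWDVV.V11 κ, OpenWDVV.pd 3 (OpenWDVV.Omega11 κ) x = OpenWDVV.lambda11 κ x) ∧
      ∃ L : (Fin 3 → ℂ) → PeriodPair,
        (∀ t ∈ OpenWDVV.U11', (L t).ω₁ = (Real.pi : ℂ) / κ ∧
          (L t).ω₂ = (Real.pi : ℂ) * t 2 / κ) ∧
        OpenWDVV.IsH11Potential OpenWDVV.U11' OpenWDVV.F11 L (OpenWDVV.lambda11 κ)
          (2 * Complex.I * κ ^ 2 / (Real.pi : ℂ)) ![0, 1 / 2, 1] ![0, 0, 0] :=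
  ⟨OpenWDVV.isOpenWDVVSolution_Omega11 hκ, fun _ hx => OpenWDVV.pd_last_Omega11 hx,
    OpenWDVV.lamPair κ,
    fun _ ht => ⟨OpenWDVV.lamPair_ω₁ hκ ht, OpenWDVV.lamPair_ω₂ hκ ht⟩,
    OpenWDVV.isH11Potential_F11 hκ⟩
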